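/- Let $\Bbbk$ be a field. A (symmetric) operad $\mathcal P$ over $\Bbbk$ is given by right $\Bbbk\mathbb S_n$-modules $\mathcal P(n)$ ($n\ge 0$, action $\ast$), an identity $\mathbf 1\in\mathcal P(1)$ and partial compositions $\circ_i:\mathcal P(m)\otimes\mathcal P(n)\to\mathcal P(m+n-1)$ ($1\le i\le m$) subject to the usual identity, associativity and equivariance axioms. Consider pairs $(\wp,\varsigma)$ of families of $\Bbbk$-linear maps $\wp_i:\mathcal P(m)\otimes\mathcal P(n)\to\mathcal P(m+n-1)$ ($m\ge1$, $n\ge0$, $1\le i\le m$) and $\varsigma:\mathcal P(m)\otimes\Bbbk\mathbb S_m\to\mathcal P(m)$ ($m\ge 0$). Such a pair is a *2-cocycle* if, for $\lambda\in\mathcal P(l)$, $\mu\in\mathcal P(m)$, $\nu\in\mathcal P(n)$, $$\wp_{i-1+j}(\lambda\circ_i\mu,\nu)+\wp_i(\lambda,\mu)\circ_{i-1+j}\nu=\wp_i(\lambda,\mu\circ_j\nu)+\lambda\circ_i\wp_j(\mu,\nu)\quad(1\le i\le l,\ 1\le j\le m),$$ $$\wp_{k-1+m}(\lambda\circ_i\mu,\nu)+\wp_i(\lambda,\mu)\circ_{k-1+m}\nu=\wp_i(\lambda\circ_k\nu,\mu)+\wp_k(\lambda,\nu)\circ_i\mu\quad(1\le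 i<k\le l),$$ $$\wp_i(\mu,\nu\ast\sigma)+\mu\circ_i\varsigma(\nu,\sigma)=\wp_i(\mu,\nu)\ast\sigma'+\varsigma(\mu\circ_i\nu,\sigma')\quad(\sigma\in\mathbb S_n,\ 1\le i\le m),$$ $$\wp_i(\mu\ast\phi,\nu)+\varsigma(\mu,\phi)\circ_i\nu=\wp_{\phi(i)}(\mu,\nu)\ast\phi''+\varsigma(\mu\circ_{\phi(i)}\nu,\phi'')\quad(\phi\in\mathbb S_m,\ 1\le i\le m),$$ $$\varsigma(\mu,\sigma\tau)=\varsigma(\mu\ast\sigma,\tau)+\varsigma(\mu,\sigma)\ast\tau\quad(\sigma,\tau\in\mathbb S_m),$$ where $\sigma'=1_m\circ_i\sigma$ and $\phi''=\phi\circ_i1_n$ are partial compositions of permutations (block permutations). It is a *2-coboundary* if there is a degree-preserving $\Bbbk$-linear map $\partial:\mathcal P\to\mathcal P$ with $\wp_i(\mu,\nu)=\partial(\mu\circ_i\nu)-\partial(\mu)\circ_i\nu-\mu\circ_i\partial(\nu)$ and $\varsigma(\mu,\sigma)=\partial(\mu\ast\sigma)-\partial(\mu)\ast\sigma$. Let $Z^2_*(\mathcal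 P)\supseteq B^2_*(\mathcal P)$ be the spaces of 2-cocycles and 2-coboundaries, let $Z^2(\mathcal P)\supseteq B^2(\mathcal P)$ be their subspaces given by $\varsigma=0$, and put $H^2_*(\mathcal P)=Z^2_*(\mathcal P)/B^2_*(\mathcal P)$, $H^2(\mathcal P)=Z^2(\mathcal P)/B^2(\mathcal P)$. The inclusion $Z^2(\mathcal P)\subseteq Z^2_*(\mathcal P)$ induces a natural map $H^2(\mathcal P)\to H^2_*(\mathcal P)$. Let $\mathcal{A}s$, $\mathcal{C}om$, $\mathcal{L}ie$, $\mathcal{P}ois$ be the operads over $\Bbbk$ of unital associative algebras, unital commutative associative algebras, Lie algebras, and unital commutative Poisson algebras. Here $\mathcal{L}ie$ is the operad generated by $\mathfrak b\in\mathcal{L}ie(2)$ subject to $\mathfrak b\ast(12)=-\mathfrak b$ and $\mathfrak b\circ_2\mathfrak b=\mathfrak b\circ_1\mathfrak b+(\mathfrak b\circ_2\mathfrak b)\ast(12)$. **Theorem 0.6.** 1. $H^2_*(\mathcal{A}s)=H^2(\mathcal{A}s)=0$. 2. $H^2_*(\mathcal{C}om)=H^2(\mathcal{C}om)=0$. 3.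 $H^2(\mathcal{L}ie)=0$, and if $\operatorname{char}\Bbbk\ne2,3$ (in particular if $\operatorname{char}\Bbbk=0$), then also $H^2_*(\mathcal{L}ie)=0$. 4. If $\operatorname{char}\Bbbk=0$, then the natural map $H^2(\mathcal{P}ois)\to H^2_*(\mathcal{P}ois)$ is an isomorphism and $H^2_*(\mathcal{P}ois)\cong H^2(\mathcal{P}ois)\cong\Bbbk$. -/

import Mathlib

universe u v

namespace Opd

/-! Slots are numbered from `0`.  In a partial composition `μ ∘ᵢ ν` with `μ` of arity `m` and `ν` of
arity `n`, the arity `r = m + n - 1` of the result is recorded by a proof of `m + n = r + 1`. -/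

/-- The slot of `μ ∘ᵢ ν` that comes from the slot `j` of `ν`. -/
def innerPos {m n r : ℕ} (h : m + n = r + 1) (i : Fin m) (j : Fin n) : Fin r :=
  ⟨i.1 + j.1, by omega⟩

/-- The slot of `μ ∘ᵢ ν` that comes from the slot `j ≠ i` of `μ`. -/
def outerPos {m n r : ℕ} (h : m + n = r + 1) (i j : Fin m) (hj : j ≠ i) : Fin r :=
  ⟨if j.1 < i.1 then j.1 else j.1 + n - 1, by
    have : j.1 ≠ i.1 := fun e => hj (Fin.ext e)
    split_ifs <;> omega⟩

/-- The slots of `μ ∘ᵢ ν` are the slots of `μ` other than `i` together with the slots of `ν`. -/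
def slots {m n r : ℕ} (h : m + n = r + 1) (i : Fin m) : {j : Fin m // j ≠ i} ⊕ Fin n ≃ Fin r where
  toFun := Sum.elim (fun j => outerPos h i j.1 j.2) (fun j => innerPos h i j)
  invFun x :=
    if h1 : x.1 < i.1 then Sum.inl ⟨⟨x.1, by omega⟩, fun e => by simp [← e] at h1⟩
    else if h2 : x.1 < i.1 + n then Sum.inr ⟨x.1 - i.1, by omega⟩
    else Sum.inl ⟨⟨x.1 + 1 - n, by omega⟩, fun e => by
      have := congrArg Fin.val e
      simp only at this
      omega⟩
  left_inv := by
    rintro (⟨j, hj⟩ | j)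
    · have hj' : j.1 ≠ i.1 := fun e => hj (Fin.ext e)
      simp only [Sum.elim_inl, outerPos]
      by_cases hlt : j.1 < i.1
      · simp [hlt]
      · have h1 : ¬ j.1 + n - 1 < i.1 := by omega
        have h2 : ¬ j.1 + n - 1 < i.1 + n := by omega
        have h3 : j.1 + n - 1 + 1 - n = j.1 := by omega
        simp [hlt, h1, h2, h3]
    · simp [innerPos]
  right_inv := by
    intro x
    by_cases h1 : x.1 < i.1
    · simp only [h1, dif_pos, Sum.elim_inl, outerPos, if_true]
    · by_cases h2 : x.1 < i.1 + n
      · simp only [h1, h2, dif_pos, dif_neg, not_false_eq_true, Sum.elim_inr, innerPos, Fin.ext_iff]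
        omega
      · simp only [h1, h2, dif_neg, not_false_eq_true, Sum.elim_inl, outerPos, Fin.ext_iff]
        split_ifs <;> omega

/-- The partial composition `φ ∘ᵢ σ` of permutations: slots outside the block move by `φ`, the block
inserted in slot `i` moves to slot `φ i`, and inside the block one uses `σ`. -/
def permComp {m n r : ℕ} (h : m + n = r + 1) (i : Fin m)
    (φ : Equiv.Perm (Fin m)) (σ : Equiv.Perm (Fin n)) : Equiv.Perm (Fin r) :=
  (slots h i).symm.trans
    ((Equiv.sumCongr
        (φ.subtypeEquiv (fun a => by simp) : {j : Fin m // j ≠ i} ≃ {j : Fin m // j ≠ φ i}) σ).trans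
      (slots h (φ i)))

/-- A symmetric operad over `k` (partial definition): right `𝕊ₙ`-modules `P n`, written with
`act σ μ = μ ∗ σ`, an identity, and partial compositions `comp h i μ ν = μ ∘ᵢ ν`. -/
class SymOperad (k : Type u) [CommRing k] (P : ℕ → Type v)
    [∀ n, AddCommGroup (P n)] [∀ n, Module k (P n)] where
  one : P 1
  act {n : ℕ} (σ : Equiv.Perm (Fin n)) : P n →ₗ[k] P n
  comp {m n r : ℕ} (h : m + n = r + 1) (i : Fin m) : P m →ₗ[k] P n →ₗ[k] P r
  act_one {n : ℕ} (μ : P n) : act 1 μ = μ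
  act_mul {n : ℕ} (σ τ : Equiv.Perm (Fin n)) (μ : P n) : act (σ * τ) μ = act τ (act σ μ)
  comp_one {n : ℕ} (i : Fin n) (θ : P n) : comp (rfl : n + 1 = n + 1) i θ one = θ
  one_comp {n : ℕ} (θ : P n) : comp (Nat.add_comm 1 n) 0 one θ = θ
  /-- `(λ ∘ᵢ μ) ∘ᵢ₊ⱼ ν = λ ∘ᵢ (μ ∘ⱼ ν)` (slots counted from `0`) -/
  assoc_inner {l m n r s t : ℕ} (hr : l + m = r + 1) (ht : r + n = t + 1)
    (hs : m + n = s + 1) (ht' : l + s = t + 1) (i : Fin l) (j : Fin m)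
    (lam : P l) (μ : P m) (ν : P n) :
    comp ht (innerPos hr i j) (comp hr i lam μ) ν = comp ht' i lam (comp hs j μ ν)
  /-- `(λ ∘ᵢ μ) ∘ₖ₊ₘ₋₁ ν = (λ ∘ₖ ν) ∘ᵢ μ` for `i < k` -/
  assoc_outer {l m n r s t : ℕ} (hr : l + m = r + 1) (ht : r + n = t + 1)
    (hs : l + n = s + 1) (ht' : s + m = t + 1) (i p : Fin l) (hip : i < p)
    (lam : P l) (μ : P m) (ν : P n) :
    comp ht (outerPos hr i p hip.ne') (comp hr i lam μ) ν =
      comp ht' (outerPos hs p i hip.ne) (comp hs p lam ν) μ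
  /-- `μ ∘ᵢ (ν ∗ σ) = (μ ∘ᵢ ν) ∗ (1 ∘ᵢ σ)` -/
  comp_act {m n r : ℕ} (h : m + n = r + 1) (i : Fin m) (σ : Equiv.Perm (Fin n))
    (μ : P m) (ν : P n) :
    comp h i μ (act σ ν) = act (permComp h i 1 σ) (comp h i μ ν)
  /-- `(μ ∗ φ) ∘ᵢ ν = (μ ∘_{φ(i)} ν) ∗ (φ ∘ᵢ 1)` -/
  act_comp {m n r : ℕ} (h : m + n = r + 1) (i : Fin m) (φ : Equiv.Perm (Fin m))
    (μ : P m) (ν : P n) :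
    comp h i (act φ μ) ν = act (permComp h i φ 1) (comp h (φ i) μ ν)

/-! ### The second cohomology groups -/

section Cohomology

open SymOperad

/-- An index `(m, n, r, i)` of a partial composition `P m ⊗ P n → P r`, `r = m + n - 1`. -/
structure CompIdx where
  m : ℕ
  n : ℕ
  r : ℕ
  arity : m + n = r + 1
  i : Fin m

variable (k : Type u) [CommRing k] (P : ℕ → Type v)
  [∀ n, AddCommGroup (P n)] [∀ n, Module k (P n)]

/-- The `k`-module of collections `(℘, ς)`, where `℘` consists of linear maps
`P m ⊗ P n → P (m + n - 1)` and `ς` of linear maps `P m ⊗ k𝕊ₘ → P m`. -/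
def Collection : Type v :=
  ((q : CompIdx) → P q.m →ₗ[k] P q.n →ₗ[k] P q.r) ×
    ((n : ℕ) → Equiv.Perm (Fin n) → P n →ₗ[k] P n)

instance : AddCommGroup (Collection k P) :=
  inferInstanceAs (AddCommGroup (((q : CompIdx) → P q.m →ₗ[k] P q.n →ₗ[k] P q.r) ×
    ((n : ℕ) → Equiv.Perm (Fin n) → P n →ₗ[k] P n)))

instance : Module k (Collection k P) :=
  inferInstanceAs (Module k (((q : CompIdx) → P q.m →ₗ[k] P q.n →ₗ[k] P q.r) ×
    ((n : ℕ) → Equiv.Perm (Fin n) → P n →ₗ[k] P n)))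

variable {k P}

/-- `c.wp h i μ ν = ℘ᵢ(μ, ν)`. -/
def Collection.wp (c : Collection k P) {m n r : ℕ} (h : m + n = r + 1) (i : Fin m) :
    P m →ₗ[k] P n →ₗ[k] P r :=
  c.1 ⟨m, n, r, h, i⟩

/-- `c.vs σ μ = ς(μ, σ)`. -/
def Collection.vs (c : Collection k P) {n : ℕ} (σ : Equiv.Perm (Fin n)) : P n →ₗ[k] P n :=
  c.2 n σ

theorem Collection.ext {c d : Collection k P}
    (hwp : ∀ {m n r : ℕ} (h : m + n = r + 1) (i : Fin m) (μ : P m) (ν : P n),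
      c.wp h i μ ν = d.wp h i μ ν)
    (hvs : ∀ {n : ℕ} (σ : Equiv.Perm (Fin n)) (μ : P n), c.vs σ μ = d.vs σ μ) : c = d :=
  Prod.ext (funext fun q => LinearMap.ext₂ fun μ ν => hwp q.arity q.i μ ν)
    (funext fun _ => funext fun σ => LinearMap.ext fun μ => hvs σ μ)

theorem Collection.wp_add (c d : Collection k P) {m n r : ℕ} (h : m + n = r + 1) (i : Fin m) :
    (c + d).wp h i = c.wp h i + d.wp h i := rfl

theorem Collection.vs_add (c d : Collection k P) {n : ℕ} (σ : Equiv.Perm (Fin n)) :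
    (c + d).vs σ = c.vs σ + d.vs σ := rfl

theorem Collection.wp_smul (a : k) (c : Collection k P) {m n r : ℕ} (h : m + n = r + 1)
    (i : Fin m) : (a • c).wp h i = a • c.wp h i := rfl

theorem Collection.vs_smul (a : k) (c : Collection k P) {n : ℕ} (σ : Equiv.Perm (Fin n)) :
    (a • c).vs σ = a • c.vs σ := rfl

theorem Collection.wp_zero {m n r : ℕ} (h : m + n = r + 1) (i : Fin m) :
    (0 : Collection k P).wp h i = 0 := rfl

theorem Collection.vs_zero {n : ℕ} (σ : Equiv.Perm (Fin n)) :
    (0 : Collection k P).vs σ = 0 := rfl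

variable [SymOperad k P]

/-- The 2-cocycle conditions on a collection `(℘, ς)`. -/
structure IsTwoCocycle (c : Collection k P) : Prop where
  inner {l m n r s t : ℕ} (hr : l + m = r + 1) (ht : r + n = t + 1)
    (hs : m + n = s + 1) (ht' : l + s = t + 1) (i : Fin l) (j : Fin m)
    (lam : P l) (μ : P m) (ν : P n) :
    c.wp ht (innerPos hr i j) (comp (k := k) hr i lam μ) ν
        + comp (k := k) ht (innerPos hr i j) (c.wp hr i lam μ) ν =
      c.wp ht' i lam (comp (k := k) hs j μ ν) + comp (k := k) ht' i lam (c.wp hs j μ ν)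
  outer {l m n r s t : ℕ} (hr : l + m = r + 1) (ht : r + n = t + 1)
    (hs : l + n = s + 1) (ht' : s + m = t + 1) (i p : Fin l) (hip : i < p)
    (lam : P l) (μ : P m) (ν : P n) :
    c.wp ht (outerPos hr i p hip.ne') (comp (k := k) hr i lam μ) ν
        + comp (k := k) ht (outerPos hr i p hip.ne') (c.wp hr i lam μ) ν =
      c.wp ht' (outerPos hs p i hip.ne) (comp (k := k) hs p lam ν) μ
        + comp (k := k) ht' (outerPos hs p i hip.ne) (c.wp hs p lam ν) μ
  right_equivariant {m n r : ℕ} (h : m + n = r + 1) (i : Fin m) (σ : Equiv.Perm (Fin n))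
    (μ : P m) (ν : P n) :
    c.wp h i μ (act (k := k) σ ν) + comp (k := k) h i μ (c.vs σ ν) =
      act (k := k) (permComp h i 1 σ) (c.wp h i μ ν) + c.vs (permComp h i 1 σ) (comp (k := k) h i μ ν)
  left_equivariant {m n r : ℕ} (h : m + n = r + 1) (i : Fin m) (φ : Equiv.Perm (Fin m))
    (μ : P m) (ν : P n) :
    c.wp h i (act (k := k) φ μ) ν + comp (k := k) h i (c.vs φ μ) ν =
      act (k := k) (permComp h i φ 1) (c.wp h (φ i) μ ν)
        + c.vs (permComp h i φ 1) (comp (k := k) h (φ i) μ ν)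
  mul {n : ℕ} (σ τ : Equiv.Perm (Fin n)) (μ : P n) :
    c.vs (σ * τ) μ = c.vs τ (act (k := k) σ μ) + act (k := k) τ (c.vs σ μ)

variable (k P)

/-- The module `Z²_*(P)` of 2-cocycles. -/
def Z2star : Submodule k (Collection k P) where
  carrier := {c | IsTwoCocycle c}
  zero_mem' := by
    constructor <;> intros <;> simp [Collection.wp_zero, Collection.vs_zero]
  add_mem' := by
    intro c d hc hd
    constructor
    · intro l m n r s t hr ht hs ht' i j lam μ ν
      have h1 := hc.inner hr ht hs ht' i j lam μ ν
      have h2 := hd.inner hr ht hs ht' i j lam μ ν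
      simp only [Collection.wp_add, LinearMap.add_apply, map_add]
      rw [add_add_add_comm, h1, h2, add_add_add_comm]
    · intro l m n r s t hr ht hs ht' i p hip lam μ ν
      have h1 := hc.outer hr ht hs ht' i p hip lam μ ν
      have h2 := hd.outer hr ht hs ht' i p hip lam μ ν
      simp only [Collection.wp_add, LinearMap.add_apply, map_add]
      rw [add_add_add_comm, h1, h2, add_add_add_comm]
    · intro m n r h i σ μ ν
      have h1 := hc.right_equivariant h i σ μ ν
      have h2 := hd.right_equivariant h i σ μ ν
      simp only [Collection.wp_add, Collection.vs_add, LinearMap.add_apply, map_add]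
      rw [add_add_add_comm, h1, h2, add_add_add_comm]
    · intro m n r h i φ μ ν
      have h1 := hc.left_equivariant h i φ μ ν
      have h2 := hd.left_equivariant h i φ μ ν
      simp only [Collection.wp_add, Collection.vs_add, LinearMap.add_apply, map_add]
      rw [add_add_add_comm, h1, h2, add_add_add_comm]
    · intro n σ τ μ
      have h1 := hc.mul σ τ μ
      have h2 := hd.mul σ τ μ
      simp only [Collection.vs_add, LinearMap.add_apply, map_add]
      rw [add_add_add_comm, h1, h2, add_add_add_comm]
  smul_mem' := by
    intro a c hc
    constructor
    · intro l m n r s t hr ht hs ht' i j lam μ ν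
      have h1 := hc.inner hr ht hs ht' i j lam μ ν
      simp only [Collection.wp_smul, LinearMap.smul_apply, map_smul, ← smul_add, h1]
    · intro l m n r s t hr ht hs ht' i p hip lam μ ν
      have h1 := hc.outer hr ht hs ht' i p hip lam μ ν
      simp only [Collection.wp_smul, LinearMap.smul_apply, map_smul, ← smul_add, h1]
    · intro m n r h i σ μ ν
      have h1 := hc.right_equivariant h i σ μ ν
      simp only [Collection.wp_smul, Collection.vs_smul, LinearMap.smul_apply, map_smul,
        ← smul_add, h1]
    · intro m n r h i φ μ ν
      have h1 := hc.left_equivariant h i φ μ ν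
      simp only [Collection.wp_smul, Collection.vs_smul, LinearMap.smul_apply, map_smul,
        ← smul_add, h1]
    · intro n σ τ μ
      have h1 := hc.mul σ τ μ
      simp only [Collection.vs_smul, LinearMap.smul_apply, map_smul, ← smul_add, h1]

/-- The coboundary of a degree-preserving linear map `∂ : P → P`:
`℘ᵢ(μ, ν) = ∂(μ ∘ᵢ ν) - (∂μ ∘ᵢ ν + μ ∘ᵢ ∂ν)` and `ς(μ, σ) = ∂(μ ∗ σ) - ∂μ ∗ σ`. -/
def coboundaryFun (d : (n : ℕ) → P n →ₗ[k] P n) : Collection k P :=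
  (fun q => (comp (k := k) q.arity q.i).compr₂ (d q.r)
      - ((comp (k := k) q.arity q.i).comp (d q.m) + (comp (k := k) q.arity q.i).compl₂ (d q.n)),
    fun n σ => d n ∘ₗ act σ - act σ ∘ₗ d n)

theorem coboundaryFun_wp (d : (n : ℕ) → P n →ₗ[k] P n) {m n r : ℕ} (h : m + n = r + 1)
    (i : Fin m) (μ : P m) (ν : P n) :
    (coboundaryFun k P d).wp h i μ ν =
      d r (comp (k := k) h i μ ν)
        - (comp (k := k) h i (d m μ) ν + comp (k := k) h i μ (d n ν)) := rfl

theorem coboundaryFun_vs (d : (n : ℕ) → P n →ₗ[k] P n) {n : ℕ} (σ : Equiv.Perm (Fin n))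
    (μ : P n) :
    (coboundaryFun k P d).vs σ μ = d n (act (k := k) σ μ) - act (k := k) σ (d n μ) := rfl

/-- `∂ ↦ coboundaryFun ∂` as a linear map. -/
def coboundary : ((n : ℕ) → P n →ₗ[k] P n) →ₗ[k] Collection k P where
  toFun := coboundaryFun k P
  map_add' d e := by
    refine Collection.ext (fun h i μ ν => ?_) (fun σ μ => ?_)
    · simp only [Collection.wp_add, coboundaryFun_wp, LinearMap.add_apply, Pi.add_apply, map_add]
      abel
    · simp only [Collection.vs_add, coboundaryFun_vs, LinearMap.add_apply, Pi.add_apply, map_add]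
      abel
  map_smul' a d := by
    refine Collection.ext (fun h i μ ν => ?_) (fun σ μ => ?_)
    · simp only [Collection.wp_smul, coboundaryFun_wp, LinearMap.smul_apply, Pi.smul_apply,
        map_smul, smul_sub, smul_add, RingHom.id_apply]
    · simp only [Collection.vs_smul, coboundaryFun_vs, LinearMap.smul_apply, Pi.smul_apply,
        map_smul, smul_sub, RingHom.id_apply]

/-- The module `B²_*(P)` of 2-coboundaries. -/
def B2star : Submodule k (Collection k P) := LinearMap.range (coboundary k P)

/-- Every 2-coboundary is a 2-cocycle. -/
theorem B2star_le_Z2star : B2star k P ≤ Z2star k P := by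
  rintro _ ⟨d, rfl⟩
  change IsTwoCocycle (coboundaryFun k P d)
  constructor
  · intro l m n r s t hr ht hs ht' i j lam μ ν
    simp only [coboundaryFun_wp, map_sub, map_add, LinearMap.sub_apply, LinearMap.add_apply,
      assoc_inner hr ht hs ht']
    abel
  · intro l m n r s t hr ht hs ht' i p hip lam μ ν
    simp only [coboundaryFun_wp, map_sub, map_add, LinearMap.sub_apply, LinearMap.add_apply,
      assoc_outer hr ht hs ht' i p hip]
    abel
  · intro m n r h i σ μ ν
    simp only [coboundaryFun_wp, coboundaryFun_vs, map_sub, map_add, comp_act]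
    abel
  · intro m n r h i φ μ ν
    simp only [coboundaryFun_wp, coboundaryFun_vs, map_sub, map_add, LinearMap.sub_apply,
      act_comp]
    abel
  · intro n σ τ μ
    simp only [coboundaryFun_vs, map_sub, act_mul]
    abel

/-- The collections with `ς = 0`. -/
def equivariantCollections : Submodule k (Collection k P) where
  carrier := {c | ∀ (n : ℕ) (σ : Equiv.Perm (Fin n)), c.vs σ = 0}
  zero_mem' := fun _ _ => rfl
  add_mem' := fun hc hd n σ => by rw [Collection.vs_add, hc n σ, hd n σ, add_zero]
  smul_mem' := fun a c hc n σ => by rw [Collection.vs_smul, hc n σ, smul_zero]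

/-- The module `Z²(P)` of 𝕊-2-cocycles: the 2-cocycles with `ς = 0`. -/
def Z2 : Submodule k (Collection k P) := Z2star k P ⊓ equivariantCollections k P

/-- The module `B²(P)` of 𝕊-2-coboundaries: the 2-coboundaries with `ς = 0`. -/
def B2 : Submodule k (Collection k P) := B2star k P ⊓ equivariantCollections k P

/-- `H²_*(P) = Z²_*(P) / B²_*(P)`. -/
abbrev H2star : Type v := Z2star k P ⧸ (B2star k P).submoduleOf (Z2star k P)

/-- `H²(P) = Z²(P) / B²(P)`. -/
abbrev H2 : Type v := Z2 k P ⧸ (B2 k P).submoduleOf (Z2 k P)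

/-- The natural map `H²(P) → H²_*(P)` induced by the inclusion of the cocycles. -/
def H2.toH2star : H2 k P →ₗ[k] H2star k P :=
  Submodule.mapQ _ _ (Submodule.inclusion (inf_le_left : Z2 k P ≤ Z2star k P)) (by
    intro c hc
    exact hc.1)

end Cohomology

/-! ### Partial composition of permutations -/

theorem permComp_innerPos {m n r : ℕ} (h : m + n = r + 1) (i : Fin m)
    (φ : Equiv.Perm (Fin m)) (σ : Equiv.Perm (Fin n)) (j : Fin n) :
    permComp h i φ σ (innerPos h i j) = innerPos h (φ i) (σ j) := by
  have : (slots h i).symm (innerPos h i j) = Sum.inr j := by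
    rw [Equiv.symm_apply_eq]; rfl
  simp only [permComp, Equiv.trans_apply, this]
  rfl

theorem permComp_outerPos {m n r : ℕ} (h : m + n = r + 1) (i : Fin m)
    (φ : Equiv.Perm (Fin m)) (σ : Equiv.Perm (Fin n)) (j : Fin m) (hj : j ≠ i) :
    permComp h i φ σ (outerPos h i j hj) = outerPos h (φ i) (φ j) (φ.injective.ne hj) := by
  have : (slots h i).symm (outerPos h i j hj) = Sum.inl ⟨j, hj⟩ := by
    rw [Equiv.symm_apply_eq]; rfl
  simp only [permComp, Equiv.trans_apply, this]
  rfl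

theorem slot_cases {m n r : ℕ} (h : m + n = r + 1) (i : Fin m) (x : Fin r) :
    (∃ j, x = innerPos h i j) ∨ ∃ j, ∃ hj : j ≠ i, x = outerPos h i j hj := by
  obtain ⟨y, rfl⟩ := (slots h i).surjective x
  rcases y with ⟨j, hj⟩ | j
  · exact Or.inr ⟨j, hj, rfl⟩
  · exact Or.inl ⟨j, rfl⟩

section

variable {l m n r s t : ℕ}

theorem inner_inner (hr : l + m = r + 1) (ht : r + n = t + 1)
    (hs : m + n = s + 1) (ht' : l + s = t + 1) (i : Fin l) (j : Fin m) (c : Fin n) :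
    innerPos ht (innerPos hr i j) c = innerPos ht' i (innerPos hs j c) := by
  simp only [innerPos, Fin.ext_iff]; omega

theorem outer_inner_inner (hr : l + m = r + 1) (ht : r + n = t + 1)
    (hs : m + n = s + 1) (ht' : l + s = t + 1) (i : Fin l) (j b : Fin m)
    (hb : innerPos hr i b ≠ innerPos hr i j) (hb' : b ≠ j) :
    outerPos ht (innerPos hr i j) (innerPos hr i b) hb =
      innerPos ht' i (outerPos hs j b hb') := by
  have : b.1 ≠ j.1 := fun e => hb' (Fin.ext e)
  simp only [innerPos, outerPos, Fin.ext_iff, add_lt_add_iff_left]; split_ifs <;> omega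

theorem outer_inner_outer (hr : l + m = r + 1) (ht : r + n = t + 1)
    (hs : m + n = s + 1) (ht' : l + s = t + 1) (i : Fin l) (j : Fin m) (a : Fin l) (ha : a ≠ i)
    (ha' : outerPos hr i a ha ≠ innerPos hr i j) :
    outerPos ht (innerPos hr i j) (outerPos hr i a ha) ha' = outerPos ht' i a ha := by
  have : a.1 ≠ i.1 := fun e => ha (Fin.ext e)
  simp only [innerPos, outerPos, Fin.ext_iff]; split_ifs <;> omega

theorem inner_outer (hr : l + m = r + 1) (ht : r + n = t + 1)
    (hs : l + n = s + 1) (ht' : s + m = t + 1) (i p : Fin l) (hip : p ≠ i) (c : Fin n)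
    (hc : innerPos hs p c ≠ outerPos hs p i hip.symm) :
    innerPos ht (outerPos hr i p hip) c =
      outerPos ht' (outerPos hs p i hip.symm) (innerPos hs p c) hc := by
  have : p.1 ≠ i.1 := fun e => hip (Fin.ext e)
  simp only [innerPos, outerPos, Fin.ext_iff]; split_ifs <;> omega

theorem outer_outer (hr : l + m = r + 1) (ht : r + n = t + 1)
    (hs : l + n = s + 1) (ht' : s + m = t + 1) (i p a : Fin l) (hip : p ≠ i) (hai : a ≠ i)
    (hap : a ≠ p) (h1 : outerPos hr i a hai ≠ outerPos hr i p hip)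
    (h2 : outerPos hs p a hap ≠ outerPos hs p i hip.symm) :
    outerPos ht (outerPos hr i p hip) (outerPos hr i a hai) h1 =
      outerPos ht' (outerPos hs p i hip.symm) (outerPos hs p a hap) h2 := by
  have e1 : p.1 ≠ i.1 := fun e => hip (Fin.ext e)
  have e2 : a.1 ≠ i.1 := fun e => hai (Fin.ext e)
  have e3 : a.1 ≠ p.1 := fun e => hap (Fin.ext e)
  simp only [outerPos, Fin.ext_iff]; split_ifs <;> omega

theorem permComp_mul (h : m + n = r + 1) (i : Fin m) (φ ψ : Equiv.Perm (Fin m))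
    (σ τ : Equiv.Perm (Fin n)) :
    permComp h i (φ * ψ) (σ * τ) = permComp h (ψ i) φ σ * permComp h i ψ τ := by
  ext1 x
  rcases slot_cases h i x with ⟨j, rfl⟩ | ⟨j, hj, rfl⟩
  · simp only [Equiv.Perm.mul_apply, permComp_innerPos]
  · simp only [Equiv.Perm.mul_apply, permComp_outerPos]

theorem permComp_one (i : Fin n) (φ : Equiv.Perm (Fin n)) :
    permComp (rfl : n + 1 = n + 1) i φ 1 = φ := by
  have ho : ∀ (i j : Fin n) (hj : j ≠ i), outerPos (rfl : n + 1 = n + 1) i j hj = j := by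
    intro i j hj
    simp only [outerPos, Fin.ext_iff]; split_ifs <;> omega
  have hi : ∀ (i : Fin n) (j : Fin 1), innerPos (rfl : n + 1 = n + 1) i j = i := by
    intro i j
    simp only [innerPos, Fin.ext_iff]; omega
  ext1 x
  rcases slot_cases (rfl : n + 1 = n + 1) i x with ⟨j, rfl⟩ | ⟨j, hj, rfl⟩
  · rw [permComp_innerPos, hi, hi]
  · rw [permComp_outerPos, ho, ho]

theorem one_permComp (φ : Equiv.Perm (Fin n)) :
    permComp (Nat.add_comm 1 n) 0 1 φ = φ := by
  have hi : ∀ j : Fin n, innerPos (Nat.add_comm 1 n) (0 : Fin 1) j = j := by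
    intro j
    simp [innerPos]
  ext1 x
  rcases slot_cases (Nat.add_comm 1 n) (0 : Fin 1) x with ⟨j, rfl⟩ | ⟨j, hj, rfl⟩
  · rw [permComp_innerPos, hi]
    exact hi _
  · exact absurd (Subsingleton.elim j 0) hj

theorem permComp_assoc_inner (hr : l + m = r + 1) (ht : r + n = t + 1)
    (hs : m + n = s + 1) (ht' : l + s = t + 1) (i : Fin l) (j : Fin m)
    (φ : Equiv.Perm (Fin l)) (ψ : Equiv.Perm (Fin m)) (σ : Equiv.Perm (Fin n)) :
    permComp ht (innerPos hr i j) (permComp hr i φ ψ) σ =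
      permComp ht' i φ (permComp hs j ψ σ) := by
  ext1 x
  rcases slot_cases ht (innerPos hr i j) x with ⟨c, rfl⟩ | ⟨y, hy, rfl⟩
  · rw [permComp_innerPos, inner_inner hr ht hs ht', permComp_innerPos, permComp_innerPos]
    simp only [permComp_innerPos]
    exact inner_inner hr ht hs ht' _ _ _
  · rw [permComp_outerPos]
    rcases slot_cases hr i y with ⟨b, rfl⟩ | ⟨a, ha, rfl⟩
    · have hb : b ≠ j := fun e => hy (by rw [e])
      rw [outer_inner_inner hr ht hs ht' i j b hy hb]
      simp only [permComp_innerPos, permComp_outerPos]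
      exact outer_inner_inner hr ht hs ht' _ _ _ _ _
    · rw [outer_inner_outer hr ht hs ht']
      simp only [permComp_innerPos, permComp_outerPos]
      exact outer_inner_outer hr ht hs ht' _ _ _ _ _

theorem permComp_assoc_outer (hr : l + m = r + 1) (ht : r + n = t + 1)
    (hs : l + n = s + 1) (ht' : s + m = t + 1) (i p : Fin l) (hip : p ≠ i)
    (φ : Equiv.Perm (Fin l)) (ψ : Equiv.Perm (Fin m)) (σ : Equiv.Perm (Fin n)) :
    permComp ht (outerPos hr i p hip) (permComp hr i φ ψ) σ =
      permComp ht' (outerPos hs p i hip.symm) (permComp hs p φ σ) ψ := by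
  have key : ∀ a : Fin l, ∀ (c : Fin n),
      a = p → innerPos hs a c ≠ outerPos hs p i hip.symm := by
    rintro a c rfl e
    exact Sum.inr_ne_inl ((slots hs a).injective (a₁ := Sum.inr c) (a₂ := Sum.inl ⟨i, hip.symm⟩) e)
  have inj : ∀ {m n r : ℕ} (h : m + n = r + 1) (i a b : Fin m) (ha : a ≠ i) (hb : b ≠ i),
      a ≠ b → outerPos h i a ha ≠ outerPos h i b hb := by
    intro m n r h i a b ha hb hab e
    have := (slots h i).injective (a₁ := Sum.inl ⟨a, ha⟩) (a₂ := Sum.inl ⟨b, hb⟩) e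
    simp only [Sum.inl.injEq, Subtype.mk.injEq] at this
    exact hab this
  ext1 x
  rcases slot_cases ht (outerPos hr i p hip) x with ⟨c, rfl⟩ | ⟨y, hy, rfl⟩
  · rw [permComp_innerPos, inner_outer hr ht hs ht' i p hip c (key p c rfl), permComp_outerPos]
    simp only [permComp_innerPos, permComp_outerPos]
    exact inner_outer hr ht hs ht' _ _ _ _ _
  · rw [permComp_outerPos]
    rcases slot_cases hr i y with ⟨b, rfl⟩ | ⟨a, ha, rfl⟩
    · have hb : innerPos hr i b ≠ outerPos hr i p hip := hy
      rw [← inner_outer hs ht' hr ht p i hip.symm b hb]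
      simp only [permComp_innerPos, permComp_outerPos]
      exact (inner_outer hs ht' hr ht _ _ _ _ _).symm
    · have hap : a ≠ p := fun e => hy (by subst e; rfl)
      rw [outer_outer hr ht hs ht' i p a hip ha hap hy (inj hs p a i hap hip.symm ha)]
      simp only [permComp_outerPos]
      exact outer_outer hr ht hs ht' _ _ _ _ _ _ _ _

end

/-! ### The operads of unital commutative and of unital associative algebras -/

/-- `Com n = k` for every `n ≥ 0`, with trivial `𝕊ₙ`-action. -/
def Com (k : Type u) : ℕ → Type u := fun _ => k

instance (k : Type u) [CommRing k] (n : ℕ) : AddCommGroup (Com k n) :=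
  inferInstanceAs (AddCommGroup k)

instance (k : Type u) [CommRing k] (n : ℕ) : Module k (Com k n) :=
  inferInstanceAs (Module k k)

instance (k : Type u) [CommRing k] : SymOperad k (Com k) where
  one := (1 : k)
  act _ := LinearMap.id
  comp _ _ := LinearMap.mul k k
  act_one _ := rfl
  act_mul _ _ _ := rfl
  comp_one _ θ := mul_one (M := k) θ
  one_comp θ := one_mul (M := k) θ
  assoc_inner _ _ _ _ _ _ a b c := mul_assoc (G := k) a b c
  assoc_outer _ _ _ _ _ _ _ a b c := mul_right_comm (G := k) a b c
  comp_act _ _ _ _ _ := rfl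
  act_comp _ _ _ _ _ := rfl

/-- `As n = k𝕊ₙ` for every `n ≥ 0`; the permutation `σ` stands for the operation
`1ₙ ∗ σ`, where `1ₙ` is the product `x₁ ⋯ xₙ`. -/
def As (k : Type u) [CommRing k] : ℕ → Type u := fun n => Equiv.Perm (Fin n) →₀ k

noncomputable instance (k : Type u) [CommRing k] (n : ℕ) : AddCommGroup (As k n) :=
  inferInstanceAs (AddCommGroup (Equiv.Perm (Fin n) →₀ k))

noncomputable instance (k : Type u) [CommRing k] (n : ℕ) : Module k (As k n) :=
  inferInstanceAs (Module k (Equiv.Perm (Fin n) →₀ k))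

/-- The basis element of `As n` given by a permutation. -/
noncomputable def As.of (k : Type u) [CommRing k] {n : ℕ} (σ : Equiv.Perm (Fin n)) : As k n :=
  Finsupp.single σ 1

/-- The right action `τ ∗ σ = τσ`, extended linearly. -/
noncomputable def As.act (k : Type u) [CommRing k] {n : ℕ} (σ : Equiv.Perm (Fin n)) :
    As k n →ₗ[k] As k n :=
  Finsupp.lmapDomain k k (fun τ => τ * σ)

/-- The partial composition of permutations, extended bilinearly. -/
noncomputable def As.comp (k : Type u) [CommRing k] {m n r : ℕ} (h : m + n = r + 1) (i : Fin m) :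
    As k m →ₗ[k] As k n →ₗ[k] As k r :=
  Finsupp.linearCombination k
    (fun φ : Equiv.Perm (Fin m) =>
      (Finsupp.linearCombination k (fun σ => As.of k (permComp h i φ σ)) : As k n →ₗ[k] As k r))

theorem As.act_of (k : Type u) [CommRing k] {n : ℕ} (σ τ : Equiv.Perm (Fin n)) :
    As.act k σ (As.of k τ) = As.of k (τ * σ) :=
  Finsupp.mapDomain_single

theorem As.comp_of (k : Type u) [CommRing k] {m n r : ℕ} (h : m + n = r + 1) (i : Fin m)
    (φ : Equiv.Perm (Fin m)) (σ : Equiv.Perm (Fin n)) :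
    As.comp k h i (As.of k φ) (As.of k σ) = As.of k (permComp h i φ σ) := by
  have h1 : As.comp k h i (As.of k φ) =
      (Finsupp.linearCombination k (fun σ => As.of k (permComp h i φ σ)) :
        As k n →ₗ[k] As k r) := by
    refine (Finsupp.linearCombination_single k (1 : k) φ).trans (one_smul _ _)
  rw [h1]
  exact (Finsupp.linearCombination_single k (1 : k) σ).trans (one_smul _ _)

theorem As.induction {k : Type u} [CommRing k] {n : ℕ} {p : As k n → Prop} (x : As k n)
    (h0 : p 0) (hadd : ∀ x y, p x → p y → p (x + y))
    (hof : ∀ (a : k) (σ : Equiv.Perm (Fin n)), p (a • As.of k σ)) : p x := by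
  refine Finsupp.induction_linear (motive := p) x h0 hadd fun σ a => ?_
  have : (Finsupp.single σ a : As k n) = a • As.of k σ := by
    exact (Finsupp.smul_single_one σ a).symm
  exact this ▸ hof a σ

noncomputable instance (k : Type u) [CommRing k] : SymOperad k (As k) where
  one := As.of k 1
  act σ := As.act k σ
  comp h i := As.comp k h i
  act_one μ := by
    induction μ using As.induction <;> simp_all [As.act_of]
  act_mul σ τ μ := by
    induction μ using As.induction <;> simp_all [As.act_of, mul_assoc]
  comp_one i θ := by
    induction θ using As.induction <;> simp_all [As.comp_of, permComp_one]
  one_comp θ := by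
    induction θ using As.induction <;> simp_all [As.comp_of, one_permComp]
  assoc_inner hr ht hs ht' i j lam μ ν := by
    induction lam using As.induction with
    | h0 => simp
    | hadd x y hx hy => simp [hx, hy]
    | hof a φ =>
      induction μ using As.induction with
      | h0 => simp
      | hadd x y hx hy => simp only [map_add, LinearMap.add_apply, hx, hy]
      | hof b ψ =>
        induction ν using As.induction with
        | h0 => simp
        | hadd x y hx hy => simp only [map_add, hx, hy]
        | hof c σ =>
          simp only [map_smul, LinearMap.smul_apply, As.comp_of,
            permComp_assoc_inner hr ht hs ht']
  assoc_outer hr ht hs ht' i p hip lam μ ν := by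
    induction lam using As.induction with
    | h0 => simp
    | hadd x y hx hy => simp [hx, hy]
    | hof a φ =>
      induction μ using As.induction with
      | h0 => simp
      | hadd x y hx hy => simp only [map_add, LinearMap.add_apply, hx, hy]
      | hof b ψ =>
        induction ν using As.induction with
        | h0 => simp
        | hadd x y hx hy => simp only [map_add, LinearMap.add_apply, hx, hy]
        | hof c σ =>
          simp only [map_smul, LinearMap.smul_apply, As.comp_of,
            permComp_assoc_outer hr ht hs ht' i p hip.ne']
          rw [smul_comm b c]
  comp_act h i σ μ ν := by
    induction μ using As.induction with
    | h0 => simp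
    | hadd x y hx hy => simp only [map_add, LinearMap.add_apply, hx, hy]
    | hof a φ =>
      induction ν using As.induction with
      | h0 => simp
      | hadd x y hx hy => simp only [map_add, hx, hy]
      | hof b τ =>
        have e := permComp_mul h i φ 1 τ σ
        rw [mul_one] at e
        simp only [map_smul, LinearMap.smul_apply, As.comp_of, As.act_of, e]
        rfl
  act_comp h i φ μ ν := by
    induction μ using As.induction with
    | h0 => simp
    | hadd x y hx hy => simp only [map_add, LinearMap.add_apply, hx, hy]
    | hof a ψ =>
      induction ν using As.induction with
      | h0 => simp
      | hadd x y hx hy => simp only [map_add, hx, hy]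
      | hof b τ =>
        simp only [map_smul, LinearMap.smul_apply, As.comp_of, As.act_of, ← permComp_mul,
          mul_one]

/-! ### Operads presented by generators and relations -/

/-- Formal expressions in the generators `G` and in all the operations of a `k`-linear symmetric
operad. -/
inductive Expr (k : Type u) (G : ℕ → Type) : ℕ → Type u
  | gen {n : ℕ} (g : G n) : Expr k G n
  | one : Expr k G 1
  | act {n : ℕ} (σ : Equiv.Perm (Fin n)) (x : Expr k G n) : Expr k G n
  | comp {m n r : ℕ} (h : m + n = r + 1) (i : Fin m) (x : Expr k G m) (y : Expr k G n) :
      Expr k G r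
  | zero {n : ℕ} : Expr k G n
  | add {n : ℕ} (x y : Expr k G n) : Expr k G n
  | smul {n : ℕ} (a : k) (x : Expr k G n) : Expr k G n

/-- The smallest congruence on formal expressions that contains the relations `R` and turns the
quotient into a `k`-linear symmetric operad. -/
inductive Congr (k : Type u) [CommRing k] (G : ℕ → Type)
    (R : (n : ℕ) → Expr k G n → Expr k G n → Prop) :
    (n : ℕ) → Expr k G n → Expr k G n → Prop
  | rel {n : ℕ} {x y : Expr k G n} : R n x y → Congr k G R n x y
  /- equivalence relation -/
  | refl {n : ℕ} (x : Expr k G n) : Congr k G R n x x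
  | symm {n : ℕ} {x y : Expr k G n} : Congr k G R n x y → Congr k G R n y x
  | trans {n : ℕ} {x y z : Expr k G n} :
      Congr k G R n x y → Congr k G R n y z → Congr k G R n x z
  /- compatibility with the operations -/
  | act_congr {n : ℕ} (σ : Equiv.Perm (Fin n)) {x y : Expr k G n} :
      Congr k G R n x y → Congr k G R n (.act σ x) (.act σ y)
  | comp_congr {m n r : ℕ} (h : m + n = r + 1) (i : Fin m) {x x' : Expr k G m}
      {y y' : Expr k G n} : Congr k G R m x x' → Congr k G R n y y' →
      Congr k G R r (.comp h i x y) (.comp h i x' y')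
  | add_congr {n : ℕ} {x x' y y' : Expr k G n} : Congr k G R n x x' → Congr k G R n y y' →
      Congr k G R n (.add x y) (.add x' y')
  | smul_congr {n : ℕ} (a : k) {x y : Expr k G n} :
      Congr k G R n x y → Congr k G R n (.smul a x) (.smul a y)
  /- module axioms -/
  | add_assoc {n : ℕ} (x y z : Expr k G n) :
      Congr k G R n (.add (.add x y) z) (.add x (.add y z))
  | add_comm {n : ℕ} (x y : Expr k G n) : Congr k G R n (.add x y) (.add y x)
  | zero_add {n : ℕ} (x : Expr k G n) : Congr k G R n (.add .zero x) x
  | neg_add {n : ℕ} (x : Expr k G n) : Congr k G R n (.add (.smul (-1) x) x) .zero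
  | one_smul {n : ℕ} (x : Expr k G n) : Congr k G R n (.smul 1 x) x
  | mul_smul {n : ℕ} (a b : k) (x : Expr k G n) :
      Congr k G R n (.smul (a * b) x) (.smul a (.smul b x))
  | smul_add {n : ℕ} (a : k) (x y : Expr k G n) :
      Congr k G R n (.smul a (.add x y)) (.add (.smul a x) (.smul a y))
  | add_smul {n : ℕ} (a b : k) (x : Expr k G n) :
      Congr k G R n (.smul (a + b) x) (.add (.smul a x) (.smul b x))
  /- linearity of the operations -/
  | act_add {n : ℕ} (σ : Equiv.Perm (Fin n)) (x y : Expr k G n) :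
      Congr k G R n (.act σ (.add x y)) (.add (.act σ x) (.act σ y))
  | act_smul {n : ℕ} (σ : Equiv.Perm (Fin n)) (a : k) (x : Expr k G n) :
      Congr k G R n (.act σ (.smul a x)) (.smul a (.act σ x))
  | add_comp {m n r : ℕ} (h : m + n = r + 1) (i : Fin m) (x x' : Expr k G m) (y : Expr k G n) :
      Congr k G R r (.comp h i (.add x x') y) (.add (.comp h i x y) (.comp h i x' y))
  | smul_comp {m n r : ℕ} (h : m + n = r + 1) (i : Fin m) (a : k) (x : Expr k G m)
      (y : Expr k G n) :
      Congr k G R r (.comp h i (.smul a x) y) (.smul a (.comp h i x y))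
  | comp_add {m n r : ℕ} (h : m + n = r + 1) (i : Fin m) (x : Expr k G m) (y y' : Expr k G n) :
      Congr k G R r (.comp h i x (.add y y')) (.add (.comp h i x y) (.comp h i x y'))
  | comp_smul {m n r : ℕ} (h : m + n = r + 1) (i : Fin m) (a : k) (x : Expr k G m)
      (y : Expr k G n) :
      Congr k G R r (.comp h i x (.smul a y)) (.smul a (.comp h i x y))
  /- operad axioms -/
  | act_one {n : ℕ} (x : Expr k G n) : Congr k G R n (.act 1 x) x
  | act_mul {n : ℕ} (σ τ : Equiv.Perm (Fin n)) (x : Expr k G n) :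
      Congr k G R n (.act (σ * τ) x) (.act τ (.act σ x))
  | comp_one {n : ℕ} (i : Fin n) (x : Expr k G n) :
      Congr k G R n (.comp (rfl : n + 1 = n + 1) i x .one) x
  | one_comp {n : ℕ} (x : Expr k G n) :
      Congr k G R n (.comp (Nat.add_comm 1 n) 0 .one x) x
  | assoc_inner {l m n r s t : ℕ} (hr : l + m = r + 1) (ht : r + n = t + 1)
      (hs : m + n = s + 1) (ht' : l + s = t + 1) (i : Fin l) (j : Fin m)
      (x : Expr k G l) (y : Expr k G m) (z : Expr k G n) :
      Congr k G R t (.comp ht (innerPos hr i j) (.comp hr i x y) z)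
        (.comp ht' i x (.comp hs j y z))
  | assoc_outer {l m n r s t : ℕ} (hr : l + m = r + 1) (ht : r + n = t + 1)
      (hs : l + n = s + 1) (ht' : s + m = t + 1) (i p : Fin l) (hip : i < p)
      (x : Expr k G l) (y : Expr k G m) (z : Expr k G n) :
      Congr k G R t (.comp ht (outerPos hr i p hip.ne') (.comp hr i x y) z)
        (.comp ht' (outerPos hs p i hip.ne) (.comp hs p x z) y)
  | comp_act {m n r : ℕ} (h : m + n = r + 1) (i : Fin m) (σ : Equiv.Perm (Fin n))
      (x : Expr k G m) (y : Expr k G n) :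
      Congr k G R r (.comp h i x (.act σ y)) (.act (permComp h i 1 σ) (.comp h i x y))
  | act_comp {m n r : ℕ} (h : m + n = r + 1) (i : Fin m) (φ : Equiv.Perm (Fin m))
      (x : Expr k G m) (y : Expr k G n) :
      Congr k G R r (.comp h i (.act φ x) y) (.act (permComp h i φ 1) (.comp h (φ i) x y))

section Presented

variable (k : Type u) [CommRing k] (G : ℕ → Type)
  (R : (n : ℕ) → Expr k G n → Expr k G n → Prop)

/-- The congruence in arity `n` as a setoid. -/
def congrSetoid (n : ℕ) : Setoid (Expr k G n) where
  r := Congr k G R n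
  iseqv := ⟨Congr.refl, Congr.symm, Congr.trans⟩

/-- The symmetric operad over `k` generated by `G` subject to the relations `R`. -/
def Presented (n : ℕ) : Type u := Quotient (congrSetoid k G R n)

namespace Presented

/-- The class of a formal expression. -/
def mk {n : ℕ} (x : Expr k G n) : Presented k G R n := Quotient.mk (congrSetoid k G R n) x

variable {k G R}

theorem sound {n : ℕ} {x y : Expr k G n} (h : Congr k G R n x y) : mk k G R x = mk k G R y :=
  Quotient.sound h

theorem ind {n : ℕ} {p : Presented k G R n → Prop} (h : ∀ x, p (mk k G R x)) (x) : p x :=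
  Quotient.ind h x

instance (n : ℕ) : Zero (Presented k G R n) := ⟨mk k G R .zero⟩

instance (n : ℕ) : Add (Presented k G R n) :=
  ⟨Quotient.map₂ .add fun _ _ hx _ _ hy => .add_congr hx hy⟩

instance (n : ℕ) : SMul k (Presented k G R n) :=
  ⟨fun a => Quotient.map (.smul a) fun _ _ hx => .smul_congr a hx⟩

instance (n : ℕ) : Neg (Presented k G R n) := ⟨fun x => (-1 : k) • x⟩

instance (n : ℕ) : AddCommGroup (Presented k G R n) where
  add_assoc x y z := by
    induction x using ind; induction y using ind; induction z using ind
    exact sound (.add_assoc _ _ _)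
  zero_add x := by
    induction x using ind
    exact sound (.zero_add _)
  add_zero x := by
    induction x using ind
    exact sound ((Congr.add_comm _ _).trans (.zero_add _))
  neg_add_cancel x := by
    induction x using ind
    exact sound (.neg_add _)
  add_comm x y := by
    induction x using ind; induction y using ind
    exact sound (.add_comm _ _)
  nsmul := nsmulRec
  zsmul := zsmulRec

instance (n : ℕ) : Module k (Presented k G R n) :=
  Module.ofMinimalAxioms
    (fun a x y => by
      induction x using ind; induction y using ind
      exact sound (.smul_add _ _ _))
    (fun a b x => by
      induction x using ind
      exact sound (.add_smul _ _ _))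
    (fun a b x => by
      induction x using ind
      exact sound (.mul_smul _ _ _))
    (fun x => by
      induction x using ind
      exact sound (.one_smul _))

instance : SymOperad k (Presented k G R) where
  one := mk k G R .one
  act σ :=
    { toFun := Quotient.map (.act σ) fun _ _ hx => .act_congr σ hx
      map_add' := fun x y => by
        induction x using ind; induction y using ind
        exact sound (.act_add _ _ _)
      map_smul' := fun a x => by
        induction x using ind
        exact sound (.act_smul _ _ _) }
  comp h i :=
    LinearMap.mk₂ k (Quotient.map₂ (.comp h i) fun _ _ hx _ _ hy => .comp_congr h i hx hy)
      (fun x x' y => by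
        induction x using ind; induction x' using ind; induction y using ind
        exact sound (.add_comp _ _ _ _ _))
      (fun a x y => by
        induction x using ind; induction y using ind
        exact sound (.smul_comp _ _ _ _ _))
      (fun x y y' => by
        induction x using ind; induction y using ind; induction y' using ind
        exact sound (.comp_add _ _ _ _ _))
      (fun a x y => by
        induction x using ind; induction y using ind
        exact sound (.comp_smul _ _ _ _ _))
  act_one x := by
    induction x using ind
    exact sound (.act_one _)
  act_mul σ τ x := by
    induction x using ind
    exact sound (.act_mul _ _ _)
  comp_one i x := by
    induction x using ind
    exact sound (.comp_one _ _)
  one_comp x := by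
    induction x using ind
    exact sound (.one_comp _)
  assoc_inner hr ht hs ht' i j x y z := by
    induction x using ind; induction y using ind; induction z using ind
    exact sound (.assoc_inner hr ht hs ht' i j _ _ _)
  assoc_outer hr ht hs ht' i p hip x y z := by
    induction x using ind; induction y using ind; induction z using ind
    exact sound (.assoc_outer hr ht hs ht' i p hip _ _ _)
  comp_act h i σ x y := by
    induction x using ind; induction y using ind
    exact sound (.comp_act h i σ _ _)
  act_comp h i φ x y := by
    induction x using ind; induction y using ind
    exact sound (.act_comp h i φ _ _)

end Presented

end Presented

/-! ### The operads of Lie algebras and of unital Poisson algebras -/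

/-- The generator of the Lie operad: a bracket in arity `2`. -/
inductive LieGen : ℕ → Type
  | bracket : LieGen 2

/-- The bracket `𝔟` as a formal expression. -/
def LieGen.b (k : Type u) : Expr k LieGen 2 := .gen .bracket

/-- The relations of the Lie operad. -/
inductive LieRel (k : Type u) [CommRing k] :
    (n : ℕ) → Expr k LieGen n → Expr k LieGen n → Prop
  /-- `𝔟 ∗ (12) = -𝔟` -/
  | antisymm : LieRel k 2 (.act (Equiv.swap 0 1) (LieGen.b k)) (.smul (-1) (LieGen.b k))
  /-- `𝔟 ∘₂ 𝔟 = 𝔟 ∘₁ 𝔟 + (𝔟 ∘₂ 𝔟) ∗ (12)` -/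
  | jacobi : LieRel k 3
      (.comp (m := 2) (n := 2) rfl 1 (LieGen.b k) (LieGen.b k))
      (.add (.comp (m := 2) (n := 2) rfl 0 (LieGen.b k) (LieGen.b k))
        (.act (Equiv.swap 0 1) (.comp (m := 2) (n := 2) rfl 1 (LieGen.b k) (LieGen.b k))))

/-- The operad of Lie algebras over `k`. -/
abbrev Lie (k : Type u) [CommRing k] : ℕ → Type u := Presented k LieGen (LieRel k)

/-- The generators of the Poisson operad: the unit `1₀`, the product `1₂` and the bracket `𝔟`. -/
inductive PoisGen : ℕ → Type
  | unit : PoisGen 0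
  | product : PoisGen 2
  | bracket : PoisGen 2

/-- The unit `1₀` as a formal expression. -/
def PoisGen.e (k : Type u) : Expr k PoisGen 0 := .gen .unit

/-- The product `1₂` as a formal expression. -/
def PoisGen.m (k : Type u) : Expr k PoisGen 2 := .gen .product

/-- The bracket `𝔟` as a formal expression. -/
def PoisGen.b (k : Type u) : Expr k PoisGen 2 := .gen .bracket

open PoisGen in
/-- The relations of the operad of unital commutative Poisson algebras. -/
inductive PoisRel (k : Type u) [CommRing k] :
    (n : ℕ) → Expr k PoisGen n → Expr k PoisGen n → Prop
  /-- `1₂ ∘₁ 1₀ = 1` -/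
  | unit_left : PoisRel k 1 (.comp (m := 2) (n := 0) rfl 0 (m k) (e k)) .one
  /-- `1₂ ∘₂ 1₀ = 1` -/
  | unit_right : PoisRel k 1 (.comp (m := 2) (n := 0) rfl 1 (m k) (e k)) .one
  /-- `𝔟 ∘₁ 1₀ = 0` -/
  | bracket_unit_left : PoisRel k 1 (.comp (m := 2) (n := 0) rfl 0 (b k) (e k)) .zero
  /-- `𝔟 ∘₂ 1₀ = 0` -/
  | bracket_unit_right : PoisRel k 1 (.comp (m := 2) (n := 0) rfl 1 (b k) (e k)) .zero
  /-- `1₂ ∗ (12) = 1₂` -/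
  | comm : PoisRel k 2 (.act (Equiv.swap 0 1) (m k)) (m k)
  /-- `𝔟 ∗ (12) = -𝔟` -/
  | antisymm : PoisRel k 2 (.act (Equiv.swap 0 1) (b k)) (.smul (-1) (b k))
  /-- `1₂ ∘₁ 1₂ = 1₂ ∘₂ 1₂` -/
  | assoc : PoisRel k 3 (.comp (m := 2) (n := 2) rfl 0 (m k) (m k))
      (.comp (m := 2) (n := 2) rfl 1 (m k) (m k))
  /-- `𝔟 ∘₁ 1₂ = 1₂ ∘₂ 𝔟 + (1₂ ∘₂ 𝔟) ∗ (12)` -/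
  | leibniz : PoisRel k 3 (.comp (m := 2) (n := 2) rfl 0 (b k) (m k))
      (.add (.comp (m := 2) (n := 2) rfl 1 (m k) (b k))
        (.act (Equiv.swap 0 1) (.comp (m := 2) (n := 2) rfl 1 (m k) (b k))))
  /-- `𝔟 ∘₂ 𝔟 = 𝔟 ∘₁ 𝔟 + (𝔟 ∘₂ 𝔟) ∗ (12)` -/
  | jacobi : PoisRel k 3 (.comp (m := 2) (n := 2) rfl 1 (b k) (b k))
      (.add (.comp (m := 2) (n := 2) rfl 0 (b k) (b k))
        (.act (Equiv.swap 0 1) (.comp (m := 2) (n := 2) rfl 1 (b k) (b k))))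

/-- The operad of unital commutative Poisson algebras over `k`. -/
abbrev Pois (k : Type u) [CommRing k] : ℕ → Type u := Presented k PoisGen (PoisRel k)

end Opd

/-!
A 2-cocycle `(℘, ς)` of an operad `P` is the same as a deformation of `P` over `k[ε]/(ε²)`: it
turns `P ⊕ εP` into an operad `Ext c` with compositions `μ ∘ᵢ ν + ε℘ᵢ(μ, ν)` and actions `μ ∗ σ +
ες(μ, σ)`.  The cocycle is a coboundary as soon as the projection `Ext c → P` has a section that is
an operad map (`Ext.mem_B2star_of_section`).  For an operad given by generators and relations this
means that the generators can be lifted to `Ext c` so that the relations still hold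
(`Presented.mem_B2star_of_lift`).  Each part of the theorem is a computation of the obstruction to
such a lift, and the obstruction lives in small arity.

*Associative and commutative algebras.*  The associator of a lift of the product is `εz` with `z`
in arity three, and the pentagon identity (`pentagon`) is a linear equation for `z`.  Over `Com` it
forces `z = 0`; over `As` it leaves multiples of the associator's change under `x₁x₂ ↦ x₁x₂ +
εx₂x₁` (`As.pentagon_solution`), so that the lift can be corrected to be associative.  Then the
unit lifts as well (`Ext.exists_unit`), and iterated products define the section.

*Lie algebras.*  A skew-symmetric lift of the bracket exists if `ς = 0`, or if `2` is invertible.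
Its Jacobiator `εz` changes sign under every transposition, and in `Lie 3`, which is spanned by two
double brackets, this implies `z = 0` (`Lie.mem_B2star_of_skew_lift`).

*Poisson algebras.*  Calculations in `Pois` need linear independence.  It comes from the operad
`Mat` of functions on matrices, which abstracts the products of exponentials `exp ⟨ξₐ, x⟩` with `W
= (⟨ξₐ, ξᵦ⟩)`: the product becomes the constant `1` and the bracket becomes the pairing `ω(W) = W₀₁
- W₁₀`.  The representation is faithful (`Pois.toMat_injective`), because in every element of
`Pois` the last variable can be made a factor or be bracketed with a single other variable
(`Pois.assemble_surjective`), and matrices with one additional row and column tell these terms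
apart.

In characteristic zero the product and the unit lift to a commutative product with a unit.  Its
associator does not depend on the lift to first order, so it defines a linear map `associatorMap`
on cocycles that vanishes on coboundaries.  Since the associator vanishes on the unit and is
antisymmetric in its outer variables, its values are multiples of one element `lieAssociator`
(`Pois.associatorMap_mem_span`).  If the associator vanishes, then the failure of the Leibniz rule
is a Harrison cocycle, symmetric in two variables, and hence zero, the bracket vanishes on the
unit, and the Jacobi identity follows as for `Lie`; so the cocycle is a coboundary
(`Pois.mem_B2star_of_associatorMap`).  Hence `H²_*(Pois)` embeds into `k`.  A cocycle with nonzero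
associator arises from the Moyal star product: replacing the product `1` by `1 + 3εω²` and the
bracket `ω` by `ω + εω³` preserves all relations but associativity, and the associator is `ε` times
an element of `Pois`.  Consequently the failure of multiplicativity of this deformed representation
takes values in `Pois`, and is a cocycle `starCocycle` with associator `6 · lieAssociator`.

The map `H² → H²_*` is injective for every operad, and in characteristic zero it is surjective by
averaging over the symmetric groups (`toH2star_surjective`).
-/

namespace Opd

open SymOperad

/-! ### The square-zero extension given by a 2-cocycle -/

section Ext

variable {k : Type u} [CommRing k] {P : ℕ → Type v}
  [∀ n, AddCommGroup (P n)] [∀ n, Module k (P n)] [SymOperad k P]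

namespace IsTwoCocycle

variable {c : Collection k P} (hc : IsTwoCocycle c)
include hc

theorem vs_one {n : ℕ} (μ : P n) : c.vs 1 μ = 0 := by
  have h := hc.mul 1 1 μ
  rw [mul_one, act_one, act_one] at h
  exact left_eq_add.mp h

theorem wp_one_right {n : ℕ} (i : Fin n) (θ : P n) :
    c.wp (rfl : n + 1 = n + 1) i θ (one (k := k)) =
      comp (k := k) (rfl : n + 1 = n + 1) i θ
        (c.wp (rfl : 1 + 1 = 1 + 1) 0 (one (k := k)) (one (k := k))) := by
  have h := hc.inner (rfl : n + 1 = n + 1) (rfl : n + 1 = n + 1) (rfl : 1 + 1 = 1 + 1)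
    (rfl : n + 1 = n + 1) i 0 θ (one (k := k)) (one (k := k))
  have hi : innerPos (rfl : n + 1 = n + 1) i (0 : Fin 1) = i := Fin.ext rfl
  rw [hi, comp_one, comp_one, comp_one] at h
  exact add_left_cancel h

theorem wp_one_left {n : ℕ} (θ : P n) :
    c.wp (Nat.add_comm 1 n) 0 (one (k := k)) θ =
      comp (k := k) (Nat.add_comm 1 n) 0
        (c.wp (rfl : 1 + 1 = 1 + 1) 0 (one (k := k)) (one (k := k))) θ := by
  have h := hc.inner (rfl : 1 + 1 = 1 + 1) (Nat.add_comm 1 n) (Nat.add_comm 1 n)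
    (Nat.add_comm 1 n) 0 0 (one (k := k)) (one (k := k)) θ
  have hi : innerPos (rfl : 1 + 1 = 1 + 1) (0 : Fin 1) (0 : Fin 1) = 0 := Fin.ext rfl
  rw [hi, one_comp, one_comp, one_comp] at h
  exact (add_left_cancel h).symm

end IsTwoCocycle

/-- The extension of `P` by the square-zero ideal `εP` that a 2-cocycle `(℘, ς)` defines.  The pair
`(μ, a)` stands for `μ + εa`, and `μ ∘ᵢ ν` is deformed to `μ ∘ᵢ ν + ε℘ᵢ(μ, ν)`, while `μ ∗ σ` is
deformed to `μ ∗ σ + ες(μ, σ)`. -/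
def Ext (_c : Z2star k P) (n : ℕ) : Type v := P n × P n

namespace Ext

variable {c : Z2star k P}

instance (n : ℕ) : AddCommGroup (Ext c n) := inferInstanceAs (AddCommGroup (P n × P n))

instance (n : ℕ) : Module k (Ext c n) := inferInstanceAs (Module k (P n × P n))

/-- The projection `μ + εa ↦ μ`. -/
def fst {n : ℕ} : Ext c n →ₗ[k] P n := LinearMap.fst k (P n) (P n)

/-- The coordinate `μ + εa ↦ a`. -/
def snd {n : ℕ} : Ext c n →ₗ[k] P n := LinearMap.snd k (P n) (P n)

/-- The inclusion `a ↦ εa` of the square-zero ideal. -/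
def eps {n : ℕ} : P n →ₗ[k] Ext c n := LinearMap.inr k (P n) (P n)

/-- The element `μ + εa`. -/
def mk (c : Z2star k P) {n : ℕ} (μ a : P n) : Ext c n := (μ, a)

@[simp] theorem fst_mk {n : ℕ} (μ a : P n) : fst (mk c μ a) = μ := rfl
@[simp] theorem snd_mk {n : ℕ} (μ a : P n) : snd (mk c μ a) = a := rfl
@[simp] theorem fst_eps {n : ℕ} (a : P n) : fst (eps a : Ext c n) = 0 := rfl
@[simp] theorem snd_eps {n : ℕ} (a : P n) : snd (eps a : Ext c n) = a := rfl

theorem hext {n : ℕ} {x y : Ext c n} (h1 : fst x = fst y) (h2 : snd x = snd y) : x = y :=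
  Prod.ext h1 h2

theorem eq_eps {n : ℕ} {x : Ext c n} (h : fst x = 0) : x = eps (snd x) := hext h rfl

theorem eps_injective {n : ℕ} {a b : P n} (h : (eps a : Ext c n) = eps b) : a = b :=
  congrArg snd h

instance : SymOperad k (Ext c) where
  one := mk c (one (k := k)) (-c.1.wp (rfl : 1 + 1 = 1 + 1) 0 (one (k := k)) (one (k := k)))
  act σ := LinearMap.prod (act σ ∘ₗ fst) (act σ ∘ₗ snd + c.1.vs σ ∘ₗ fst)
  comp h i :=
    LinearMap.mk₂ k
      (fun x y => mk c (comp (k := k) h i (fst x) (fst y)) (c.1.wp h i (fst x) (fst y)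
        + comp (k := k) h i (snd x) (fst y) + comp (k := k) h i (fst x) (snd y)))
      (fun x x' y => hext (by simp) (by simp; abel))
      (fun a x y => hext (by simp) (by simp))
      (fun x y y' => hext (by simp) (by simp; abel))
      (fun a x y => hext (by simp) (by simp))
  act_one μ := Prod.ext (act_one (fst μ)) (by
    change act (k := k) 1 (snd μ) + c.1.vs 1 (fst μ) = snd μ
    rw [act_one, c.2.vs_one, add_zero])
  act_mul σ τ μ := Prod.ext (act_mul σ τ (fst μ)) (by
    change act (k := k) (σ * τ) (snd μ) + c.1.vs (σ * τ) (fst μ) =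
      act (k := k) τ (act (k := k) σ (snd μ) + c.1.vs σ (fst μ)) +
        c.1.vs τ (act (k := k) σ (fst μ))
    rw [act_mul, c.2.mul, map_add]; abel)
  comp_one i θ := Prod.ext (comp_one i (fst θ)) (by
    change c.1.wp rfl i (fst θ) (one (k := k)) + comp (k := k) rfl i (snd θ) (one (k := k))
      + comp (k := k) rfl i (fst θ) (-c.1.wp rfl 0 (one (k := k)) (one (k := k))) = snd θ
    rw [c.2.wp_one_right, comp_one, map_neg]; abel)
  one_comp θ := Prod.ext (one_comp (fst θ)) (by
    change c.1.wp _ 0 (one (k := k)) (fst θ)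
      + comp (k := k) _ 0 (-c.1.wp rfl 0 (one (k := k)) (one (k := k))) (fst θ)
      + comp (k := k) _ 0 (one (k := k)) (snd θ) = snd θ
    rw [c.2.wp_one_left, one_comp, map_neg, LinearMap.neg_apply]; abel)
  assoc_inner hr ht hs ht' i j x y z := Prod.ext
    (assoc_inner hr ht hs ht' i j (fst x) (fst y) (fst z)) (by
      have h := c.2.inner hr ht hs ht' i j (fst x) (fst y) (fst z)
      change c.1.wp ht _ (comp (k := k) hr i (fst x) (fst y)) (fst z)
        + comp (k := k) ht _ (c.1.wp hr i (fst x) (fst y)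
        + comp (k := k) hr i (snd x) (fst y) + comp (k := k) hr i (fst x) (snd y)) (fst z)
        + comp (k := k) ht _ (comp (k := k) hr i (fst x) (fst y)) (snd z) =
        c.1.wp ht' i (fst x) (comp (k := k) hs j (fst y) (fst z))
        + comp (k := k) ht' i (snd x) (comp (k := k) hs j (fst y) (fst z))
        + comp (k := k) ht' i (fst x) (c.1.wp hs j (fst y) (fst z)
        + comp (k := k) hs j (snd y) (fst z) + comp (k := k) hs j (fst y) (snd z))
      simp only [map_add, LinearMap.add_apply, assoc_inner hr ht hs ht'] at h ⊢
      rw [← sub_eq_zero] at h ⊢; rw [← h]; abel)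
  assoc_outer hr ht hs ht' i p hip x y z := Prod.ext
    (assoc_outer hr ht hs ht' i p hip (fst x) (fst y) (fst z)) (by
      have h := c.2.outer hr ht hs ht' i p hip (fst x) (fst y) (fst z)
      change c.1.wp ht _ (comp (k := k) hr i (fst x) (fst y)) (fst z)
        + comp (k := k) ht _ (c.1.wp hr i (fst x) (fst y)
        + comp (k := k) hr i (snd x) (fst y) + comp (k := k) hr i (fst x) (snd y)) (fst z)
        + comp (k := k) ht _ (comp (k := k) hr i (fst x) (fst y)) (snd z) =
        c.1.wp ht' _ (comp (k := k) hs p (fst x) (fst z)) (fst y)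
        + comp (k := k) ht' _ (c.1.wp hs p (fst x) (fst z)
        + comp (k := k) hs p (snd x) (fst z) + comp (k := k) hs p (fst x) (snd z)) (fst y)
        + comp (k := k) ht' _ (comp (k := k) hs p (fst x) (fst z)) (snd y)
      simp only [map_add, LinearMap.add_apply, assoc_outer hr ht hs ht' i p hip] at h ⊢
      rw [← sub_eq_zero] at h ⊢; rw [← h]; abel)
  comp_act h i σ x y := Prod.ext (comp_act h i σ (fst x) (fst y)) (by
      have e := c.2.right_equivariant h i σ (fst x) (fst y)
      change c.1.wp h i (fst x) (act (k := k) σ (fst y))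
        + comp (k := k) h i (snd x) (act (k := k) σ (fst y))
        + comp (k := k) h i (fst x) (act (k := k) σ (snd y) + c.1.vs σ (fst y)) =
        act (k := k) _ (c.1.wp h i (fst x) (fst y) + comp (k := k) h i (snd x) (fst y)
          + comp (k := k) h i (fst x) (snd y)) + c.1.vs _ (comp (k := k) h i (fst x) (fst y))
      simp only [map_add, comp_act] at e ⊢
      rw [← sub_eq_zero] at e ⊢; rw [← e]; abel)
  act_comp h i φ x y := Prod.ext (act_comp h i φ (fst x) (fst y)) (by
      have e := c.2.left_equivariant h i φ (fst x) (fst y)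
      change c.1.wp h i (act (k := k) φ (fst x)) (fst y)
        + comp (k := k) h i (act (k := k) φ (snd x) + c.1.vs φ (fst x)) (fst y)
        + comp (k := k) h i (act (k := k) φ (fst x)) (snd y) =
        act (k := k) _ (c.1.wp h (φ i) (fst x) (fst y) + comp (k := k) h (φ i) (snd x) (fst y)
          + comp (k := k) h (φ i) (fst x) (snd y))
          + c.1.vs _ (comp (k := k) h (φ i) (fst x) (fst y))
      simp only [map_add, LinearMap.add_apply, act_comp] at e ⊢
      rw [← sub_eq_zero] at e ⊢; rw [← e]; abel)

@[simp] theorem fst_one : fst (one (k := k) : Ext c 1) = one (k := k) := rfl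

@[simp] theorem fst_act {n : ℕ} (σ : Equiv.Perm (Fin n)) (x : Ext c n) :
    fst (act (k := k) σ x) = act (k := k) σ (fst x) := rfl

theorem snd_act {n : ℕ} (σ : Equiv.Perm (Fin n)) (x : Ext c n) :
    snd (act (k := k) σ x) = act (k := k) σ (snd x) + c.1.vs σ (fst x) := rfl

@[simp] theorem fst_comp {m n r : ℕ} (h : m + n = r + 1) (i : Fin m) (x : Ext c m) (y : Ext c n) :
    fst (comp (k := k) h i x y) = comp (k := k) h i (fst x) (fst y) := rfl

theorem snd_comp {m n r : ℕ} (h : m + n = r + 1) (i : Fin m) (x : Ext c m) (y : Ext c n) :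
    snd (comp (k := k) h i x y) = c.1.wp h i (fst x) (fst y)
        + comp (k := k) h i (snd x) (fst y) + comp (k := k) h i (fst x) (snd y) := rfl

theorem act_eps {n : ℕ} (σ : Equiv.Perm (Fin n)) (a : P n) :
    act (k := k) σ (eps a : Ext c n) = eps (act (k := k) σ a) :=
  hext (by simp) (by simp [snd_act])

theorem comp_eps {m n r : ℕ} (h : m + n = r + 1) (i : Fin m) (x : Ext c m) (b : P n) :
    comp (k := k) h i x (eps b) = eps (comp (k := k) h i (fst x) b) :=
  hext (by simp) (by simp [snd_comp])

theorem eps_comp {m n r : ℕ} (h : m + n = r + 1) (i : Fin m) (a : P m) (y : Ext c n) :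
    comp (k := k) h i (eps a) y = eps (comp (k := k) h i a (fst y)) :=
  hext (by simp) (by simp [snd_comp])

/-- An extension that splits as an operad comes from a coboundary. -/
theorem mem_B2star_of_section (s : (n : ℕ) → P n →ₗ[k] Ext c n)
    (hs : ∀ {n : ℕ} (μ : P n), fst (s n μ) = μ)
    (hact : ∀ {n : ℕ} (σ : Equiv.Perm (Fin n)) (μ : P n),
      s n (act (k := k) σ μ) = act (k := k) σ (s n μ))
    (hcomp : ∀ {m n r : ℕ} (h : m + n = r + 1) (i : Fin m) (μ : P m) (ν : P n),
      s r (comp (k := k) h i μ ν) = comp (k := k) h i (s m μ) (s n ν)) :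
    c.1 ∈ B2star k P := by
  let d : (n : ℕ) → P n →ₗ[k] P n := fun n => snd ∘ₗ s n
  have hd : ∀ (n : ℕ) (μ : P n), d n μ = snd (s n μ) := fun _ _ => rfl
  have e : coboundaryFun k P d = c.1 := by
    refine Collection.ext (fun h i μ ν => ?_) (fun σ μ => ?_)
    · rw [coboundaryFun_wp, hd, hd, hd, hcomp, snd_comp, hs, hs]
      abel
    · rw [coboundaryFun_vs, hd, hd, hact, snd_act, hs]
      abel
  exact ⟨d, e⟩

end Ext

end Ext

/-! ### Operad maps out of a presented operad -/

section Eval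

variable {k : Type u} [CommRing k] {G : ℕ → Type}
  {R : (n : ℕ) → Expr k G n → Expr k G n → Prop} {N : ℕ → Type v}
  [∀ n, AddCommGroup (N n)] [∀ n, Module k (N n)]

namespace Presented

/-- Operad maps out of a presented operad that agree on the generators are equal. -/
theorem hom_ext (f f' : (n : ℕ) → Presented k G R n →ₗ[k] N n)
    (hgen : ∀ {n : ℕ} (a : G n), f n (mk k G R (.gen a)) = f' n (mk k G R (.gen a)))
    (h1 : f 1 (one (k := k)) = f' 1 (one (k := k)))
    (hact : ∀ {n : ℕ} (σ : Equiv.Perm (Fin n)) (x), f n x = f' n x →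
      f n (act (k := k) σ x) = f' n (act (k := k) σ x))
    (hcomp : ∀ {m n r : ℕ} (h : m + n = r + 1) (i : Fin m) (x y), f m x = f' m x →
      f n y = f' n y → f r (comp (k := k) h i x y) = f' r (comp (k := k) h i x y))
    {n : ℕ} (x : Presented k G R n) : f n x = f' n x := by
  induction x using ind with
  | h x =>
    induction x with
    | gen a => exact hgen a
    | one => exact h1
    | act σ x ih => exact hact σ _ ih
    | comp h i x y ih ih' => exact hcomp h i _ _ ih ih'
    | zero => exact (map_zero (f _)).trans (map_zero (f' _)).symm
    | add x y ih ih' =>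
      exact (map_add (f _) _ _).trans ((congrArg₂ _ ih ih').trans (map_add (f' _) _ _).symm)
    | smul a x ih =>
      exact (map_smul (f _) _ _).trans ((congrArg _ ih).trans (map_smul (f' _) _ _).symm)

end Presented

variable [SymOperad k N]

/-- The value of a formal expression in an operad in which the generators are interpreted by `g`. -/
def Expr.eval (g : ∀ {n : ℕ}, G n → N n) : {n : ℕ} → Expr k G n → N n
  | _, .gen a => g a
  | _, .one => SymOperad.one (k := k)
  | _, .act σ x => SymOperad.act (k := k) σ (x.eval g)
  | _, .comp h i x y => SymOperad.comp (k := k) h i (x.eval g) (y.eval g)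
  | _, .zero => 0
  | _, .add x y => x.eval g + y.eval g
  | _, .smul a x => a • x.eval g

/-- If the relations hold modulo a family `I` of submodules that absorbs compositions with values of
expressions, then congruent expressions have congruent values modulo `I`. -/
theorem Congr.eval_sub_mem (g : ∀ {n : ℕ}, G n → N n) (I : (n : ℕ) → Submodule k (N n))
    (hact : ∀ {n : ℕ} (σ : Equiv.Perm (Fin n)) (a : N n), a ∈ I n → act (k := k) σ a ∈ I n)
    (hleft : ∀ {m n r : ℕ} (h : m + n = r + 1) (i : Fin m) (a : N m) (y : Expr k G n), a ∈ I m →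
      comp (k := k) h i a (y.eval g) ∈ I r)
    (hright : ∀ {m n r : ℕ} (h : m + n = r + 1) (i : Fin m) (x : Expr k G m) (b : N n), b ∈ I n →
      comp (k := k) h i (x.eval g) b ∈ I r)
    (hrel : ∀ {n : ℕ} (x y : Expr k G n), R n x y → x.eval g - y.eval g ∈ I n)
    {n : ℕ} {x y : Expr k G n} (h : Congr k G R n x y) : x.eval g - y.eval g ∈ I n := by
  have key : ∀ {n : ℕ} {x y : N n}, x = y → x - y ∈ I n := fun e => by
    rw [e, sub_self]; exact zero_mem _
  induction h with
  | rel h => exact hrel _ _ h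
  | refl x => exact key rfl
  | symm _ ih => rw [← neg_sub]; exact neg_mem ih
  | trans _ _ ih ih' => rw [← sub_add_sub_cancel]; exact add_mem ih ih'
  | act_congr σ _ ih => simpa only [Expr.eval, map_sub] using hact σ _ ih
  | @comp_congr m n r h i x x' y y' _ _ ih ih' =>
    have e : comp (k := k) h i (x.eval g) (y.eval g) - comp (k := k) h i (x'.eval g) (y'.eval g) =
        comp (k := k) h i (x.eval g - x'.eval g) (y.eval g) +
          comp (k := k) h i (x'.eval g) (y.eval g - y'.eval g) := by
      simp only [map_sub, LinearMap.sub_apply]; abel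
    simpa only [Expr.eval, e] using add_mem (hleft h i _ y ih) (hright h i x' _ ih')
  | add_congr _ _ ih ih' =>
    simpa only [Expr.eval, add_sub_add_comm] using add_mem ih ih'
  | smul_congr a _ ih => simpa only [Expr.eval, smul_sub] using (I _).smul_mem a ih
  | add_assoc x y z => exact key (_root_.add_assoc _ _ _)
  | add_comm x y => exact key (_root_.add_comm _ _)
  | zero_add x => exact key (_root_.zero_add _)
  | neg_add x => exact key (by simp [Expr.eval])
  | one_smul x => exact key (_root_.one_smul _ _)
  | mul_smul a b x => exact key (SemigroupAction.mul_smul _ _ _)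
  | smul_add a x y => exact key (_root_.smul_add _ _ _)
  | add_smul a b x => exact key (_root_.add_smul _ _ _)
  | act_add σ x y => exact key (map_add _ _ _)
  | act_smul σ a x => exact key (map_smul _ _ _)
  | add_comp h i x x' y => exact key (by simp [Expr.eval])
  | smul_comp h i a x y => exact key (by simp [Expr.eval])
  | comp_add h i x y y' => exact key (by simp [Expr.eval])
  | comp_smul h i a x y => exact key (by simp [Expr.eval])
  | act_one x => exact key (SymOperad.act_one _)
  | act_mul σ τ x => exact key (SymOperad.act_mul _ _ _)
  | comp_one i x => exact key (SymOperad.comp_one _ _)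
  | one_comp x => exact key (SymOperad.one_comp _)
  | assoc_inner hr ht hs ht' i j x y z => exact key (SymOperad.assoc_inner hr ht hs ht' i j _ _ _)
  | assoc_outer hr ht hs ht' i p hip x y z =>
    exact key (SymOperad.assoc_outer hr ht hs ht' i p hip _ _ _)
  | comp_act h i σ x y => exact key (SymOperad.comp_act h i σ _ _)
  | act_comp h i φ x y => exact key (SymOperad.act_comp h i φ _ _)

namespace Presented

/-- The linear map induced on a presented operad by an interpretation of the generators for which
congruent expressions have congruent values modulo `I`. -/
def liftQ (g : ∀ {n : ℕ}, G n → N n) (I : (n : ℕ) → Submodule k (N n))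
    (hI : ∀ {n : ℕ} {x y : Expr k G n}, Congr k G R n x y → x.eval g - y.eval g ∈ I n) (n : ℕ) :
    Presented k G R n →ₗ[k] N n ⧸ I n where
  toFun := Quotient.lift (fun x : Expr k G n => (I n).mkQ (x.eval g)) fun _ _ h =>
    (Submodule.Quotient.eq _).2 (hI h)
  map_add' x y := by
    induction x using ind; induction y using ind
    exact map_add _ _ _
  map_smul' a x := by
    induction x using ind
    exact map_smul _ _ _

theorem eval_eq (g : ∀ {n : ℕ}, G n → N n)
    (hrel : ∀ {n : ℕ} (x y : Expr k G n), R n x y → x.eval g = y.eval g)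
    {n : ℕ} {x y : Expr k G n} (h : Congr k G R n x y) : x.eval g = y.eval g := by
  refine sub_eq_zero.1 ((Submodule.mem_bot k).1
    (Congr.eval_sub_mem g (fun _ => ⊥) ?_ ?_ ?_ ?_ h))
  · rintro n σ a rfl; simp
  · rintro m n r h i a y rfl; simp
  · rintro m n r h i a y rfl; simp
  · intro n x y h; rw [hrel x y h, sub_self]; exact zero_mem _

/-- The universal property of a presented operad. -/
def lift (g : ∀ {n : ℕ}, G n → N n)
    (hrel : ∀ {n : ℕ} (x y : Expr k G n), R n x y → x.eval g = y.eval g) (n : ℕ) :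
    Presented k G R n →ₗ[k] N n where
  toFun := Quotient.lift (fun x : Expr k G n => x.eval g) fun _ _ h => eval_eq g hrel h
  map_add' x y := by
    induction x using ind; induction y using ind
    rfl
  map_smul' a x := by
    induction x using ind
    rfl

section

variable (g : ∀ {n : ℕ}, G n → N n)
    (hrel : ∀ {n : ℕ} (x y : Expr k G n), R n x y → x.eval g = y.eval g)

theorem lift_act {n : ℕ} (σ : Equiv.Perm (Fin n)) (x : Presented k G R n) :
    lift g hrel n (act (k := k) σ x) = act (k := k) σ (lift g hrel n x) := by
  induction x using ind
  rfl

theorem lift_comp {m n r : ℕ} (h : m + n = r + 1) (i : Fin m) (x : Presented k G R m)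
    (y : Presented k G R n) : lift g hrel r (comp (k := k) h i x y) =
      comp (k := k) h i (lift g hrel m x) (lift g hrel n y) := by
  induction x using ind; induction y using ind
  rfl

end

/-- A 2-cocycle of a presented operad is a coboundary if the generators lift to the extension in
such a way that the relations hold. -/
theorem mem_B2star_of_lift (c : Z2star k (Presented k G R)) (g : ∀ {n : ℕ}, G n → Ext c n)
    (hg : ∀ {n : ℕ} (a : G n), Ext.fst (g a) = mk k G R (.gen a))
    (hrel : ∀ {n : ℕ} (x y : Expr k G n), R n x y → x.eval g = y.eval g) :
    c.1 ∈ B2star k (Presented k G R) := by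
  refine Ext.mem_B2star_of_section (fun n => lift g hrel n) (fun {n} μ => ?_) (lift_act g hrel)
    (lift_comp g hrel)
  refine hom_ext (fun n => Ext.fst ∘ₗ lift g hrel n) (fun n => LinearMap.id) hg rfl
    (fun σ x hx => ?_) (fun h i x y hx hy => ?_) μ
  · rw [LinearMap.comp_apply, LinearMap.id_apply] at hx ⊢
    rw [lift_act, Ext.fst_act, hx]
  · rw [LinearMap.comp_apply, LinearMap.id_apply] at hx hy ⊢
    rw [lift_comp, Ext.fst_comp, hx, hy]

end Presented

end Eval

/-! ### Comparison of the two cohomology groups -/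

section Comparison

variable {k : Type u} [CommRing k] {P : ℕ → Type v}
  [∀ n, AddCommGroup (P n)] [∀ n, Module k (P n)] [SymOperad k P]

theorem subsingleton_H2star (h : ∀ c : Z2star k P, c.1 ∈ B2star k P) :
    Subsingleton (H2star k P) := by
  rw [Submodule.Quotient.subsingleton_iff, eq_top_iff]
  exact fun c _ => h c

theorem subsingleton_H2 (h : ∀ c : Z2star k P, c.1 ∈ Z2 k P → c.1 ∈ B2star k P) :
    Subsingleton (H2 k P) := by
  rw [Submodule.Quotient.subsingleton_iff, eq_top_iff]
  exact fun c _ => ⟨h ⟨c.1, c.2.1⟩ c.2, c.2.2⟩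

theorem toH2star_injective : Function.Injective (H2.toH2star k P) := by
  rw [← LinearMap.ker_eq_bot, LinearMap.ker_eq_bot']
  intro x
  induction x using Submodule.Quotient.induction_on with
  | H c =>
    intro h
    have h' : (Submodule.Quotient.mk (⟨c.1, c.2.1⟩ : Z2star k P) : H2star k P) = 0 := h
    have h3 := (Submodule.Quotient.mk_eq_zero _).1 h'
    exact (Submodule.Quotient.mk_eq_zero _).2 ⟨h3, c.2.2⟩

/-- The degree-preserving map with which averaging over the symmetric groups turns a 2-cocycle into
an equivariant one. -/
noncomputable def averageMap {k : Type u} [Field k] {P : ℕ → Type v}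
    [∀ n, AddCommGroup (P n)] [∀ n, Module k (P n)] [SymOperad k P] (c : Collection k P) (n : ℕ) :
    P n →ₗ[k] P n :=
  -((Fintype.card (Equiv.Perm (Fin n)) : k)⁻¹ •
    ∑ τ : Equiv.Perm (Fin n), act (k := k) τ⁻¹ ∘ₗ c.vs τ)

/-- In characteristic zero `ς` can be averaged away: up to sign, `ς` is the coboundary of the mean
of `μ ↦ ς(μ, τ) ∗ τ⁻¹` over all `τ`. -/
theorem toH2star_surjective {k : Type u} [Field k] [CharZero k] {P : ℕ → Type v}
    [∀ n, AddCommGroup (P n)] [∀ n, Module k (P n)] [SymOperad k P] :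
    Function.Surjective (H2.toH2star k P) := by
  intro x
  induction x using Submodule.Quotient.induction_on with
  | H c =>
    have hb := B2star_le_Z2star k P ⟨averageMap c.1, rfl⟩
    have h0 : c.1 - coboundary k P (averageMap c.1) ∈ equivariantCollections k P := by
      intro n σ
      ext μ
      have hN : (Fintype.card (Equiv.Perm (Fin n)) : k) ≠ 0 :=
        Nat.cast_ne_zero.2 Fintype.card_ne_zero
      change c.1.vs σ μ - (coboundaryFun k P (averageMap c.1)).vs σ μ = 0
      rw [coboundaryFun_vs]
      simp only [averageMap, LinearMap.neg_apply, LinearMap.smul_apply, LinearMap.sum_apply,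
        LinearMap.comp_apply, map_neg, map_smul, map_sum]
      have e1 : ∀ τ : Equiv.Perm (Fin n), act (k := k) τ⁻¹ (c.1.vs τ (act (k := k) σ μ)) =
          act (k := k) σ (act (k := k) (σ * τ)⁻¹ (c.1.vs (σ * τ) μ)) - c.1.vs σ μ := by
        intro τ
        have h := c.2.mul σ τ μ
        rw [h, ← act_mul, mul_inv_rev, inv_mul_cancel_right, map_add, ← act_mul, mul_inv_cancel,
          act_one, add_sub_cancel_right]
      have e2 : ∑ τ : Equiv.Perm (Fin n),
          act (k := k) σ (act (k := k) (σ * τ)⁻¹ (c.1.vs (σ * τ) μ)) =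
          ∑ τ : Equiv.Perm (Fin n), act (k := k) σ (act (k := k) τ⁻¹ (c.1.vs τ μ)) :=
        Fintype.sum_equiv (Equiv.mulLeft σ) _ _ fun _ => rfl
      rw [Finset.sum_congr rfl fun τ _ => e1 τ, Finset.sum_sub_distrib, e2, Finset.sum_const,
        Finset.card_univ, ← Nat.cast_smul_eq_nsmul k, smul_sub, inv_smul_smul₀ hN]
      abel
    refine ⟨Submodule.Quotient.mk ⟨c.1 - coboundary k P (averageMap c.1),
      sub_mem c.2 hb, h0⟩, ?_⟩
    refine (Submodule.Quotient.eq _).2 ?_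
    change c.1 - coboundary k P (averageMap c.1) - c.1 ∈ B2star k P
    rw [sub_sub_cancel_left]
    exact neg_mem ⟨_, rfl⟩

end Comparison

/-! ### Unital associative products in an operad -/

theorem permComp_one_swap {m n r : ℕ} (h : m + n = r + 1) (i : Fin m) (a b : Fin n) :
    permComp h i 1 (Equiv.swap a b) = Equiv.swap (innerPos h i a) (innerPos h i b) := by
  have inj : ∀ x y : Fin n, innerPos h i x = innerPos h i y ↔ x = y := fun x y => by
    simp [innerPos, Fin.ext_iff]
  have ne : ∀ (x : Fin n) (y : Fin m) (hy : y ≠ i), outerPos h i y hy ≠ innerPos h i x :=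
    fun x y hy e => Sum.inl_ne_inr ((slots h i).injective (a₁ := Sum.inl ⟨y, hy⟩)
      (a₂ := Sum.inr x) e)
  ext1 x
  rcases slot_cases h i x with ⟨j, rfl⟩ | ⟨j, hj, rfl⟩
  · rw [permComp_innerPos, Equiv.Perm.one_apply, Equiv.swap_apply_def, Equiv.swap_apply_def]
    simp only [inj]
    split_ifs <;> rfl
  · rw [permComp_outerPos, Equiv.swap_apply_of_ne_of_ne (ne a j hj) (ne b j hj)]
    rfl

section UnitalAssociative

variable {k : Type u} [CommRing k] {E : ℕ → Type v}
  [∀ n, AddCommGroup (E n)] [∀ n, Module k (E n)] [SymOperad k E]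

variable (k) in
/-- The iterated product `(⋯(x₁x₂)⋯)xₙ` built from a binary operation `m` and a constant `e`. -/
def iterProd (m : E 2) (e : E 0) : (n : ℕ) → E n
  | 0 => e
  | n + 1 => comp (k := k) (by omega : 2 + n = (n + 1) + 1) 0 m (iterProd m e n)

variable {m : E 2} {e : E 0}

theorem iterProd_one (hl : comp (k := k) (rfl : 2 + 0 = 1 + 1) 0 m e = one (k := k)) :
    iterProd k m e 1 = one (k := k) := hl

theorem iterProd_two (hl : comp (k := k) (rfl : 2 + 0 = 1 + 1) 0 m e = one (k := k)) :
    iterProd k m e 2 = m := by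
  change comp (k := k) _ 0 m (iterProd k m e 1) = m
  rw [iterProd_one hl]
  exact comp_one 0 m

theorem product_iterProd
    (hr : comp (k := k) (rfl : 2 + 0 = 1 + 1) 1 m e = one (k := k))
    (ha : comp (k := k) (rfl : 2 + 2 = 3 + 1) 0 m m = comp (k := k) (rfl : 2 + 2 = 3 + 1) 1 m m)
    (n p : ℕ) {t : ℕ} (hs : 2 + n = (n + 1) + 1) (ht : (n + 1) + p = t + 1) :
    comp (k := k) ht 0 (comp (k := k) hs 1 m (iterProd k m e n)) (iterProd k m e p) =
      iterProd k m e t := by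
  induction n generalizing t with
  | zero =>
    obtain rfl : t = p := by omega
    change comp (k := k) ht 0 (comp (k := k) hs 1 m e) (iterProd k m e t) = _
    rw [hr]
    exact one_comp _
  | succ n ih =>
    obtain ⟨t, rfl⟩ : ∃ t', t = t' + 1 := ⟨t - 1, by omega⟩
    have e1 : comp (k := k) hs 1 m (iterProd k m e (n + 1)) =
        comp (k := k) (by omega : 2 + (n + 1) = (n + 1 + 1) + 1) 0 m
          (comp (k := k) (by omega : 2 + n = (n + 1) + 1) 1 m (iterProd k m e n)) := by
      have a1 := assoc_inner (k := k) (rfl : 2 + 2 = 3 + 1) (by omega : 3 + n = (n + 1 + 1) + 1)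
        (by omega : 2 + n = (n + 1) + 1) (by omega : 2 + (n + 1) = (n + 1 + 1) + 1) 1 0 m m
        (iterProd k m e n)
      have a2 := assoc_inner (k := k) (rfl : 2 + 2 = 3 + 1) (by omega : 3 + n = (n + 1 + 1) + 1)
        (by omega : 2 + n = (n + 1) + 1) (by omega : 2 + (n + 1) = (n + 1 + 1) + 1) 0 1 m m
        (iterProd k m e n)
      rw [ha] at a2
      exact a1.symm.trans a2
    have a3 := assoc_inner (k := k) (by omega : 2 + (n + 1) = (n + 1 + 1) + 1) ht
      (by omega : (n + 1) + p = t + 1) (by omega : 2 + t = t + 1 + 1) 0 0 m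
      (comp (k := k) (by omega : 2 + n = (n + 1) + 1) 1 m (iterProd k m e n)) (iterProd k m e p)
    rw [e1]
    refine Eq.trans a3 ?_
    rw [ih]
    rfl

theorem iterProd_comp
    (hr : comp (k := k) (rfl : 2 + 0 = 1 + 1) 1 m e = one (k := k))
    (ha : comp (k := k) (rfl : 2 + 2 = 3 + 1) 0 m m = comp (k := k) (rfl : 2 + 2 = 3 + 1) 1 m m)
    {p n r : ℕ} (h : p + n = r + 1) (i : Fin p) :
    comp (k := k) h i (iterProd k m e p) (iterProd k m e n) = iterProd k m e r := by
  induction p generalizing r with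
  | zero => exact i.elim0
  | succ p ih =>
    by_cases hi : i.1 < p
    · obtain ⟨r, rfl⟩ : ∃ r', r = r' + 1 := ⟨r - 1, by omega⟩
      have a := assoc_inner (k := k) (by omega : 2 + p = (p + 1) + 1) h
        (by omega : p + n = r + 1) (by omega : 2 + r = r + 1 + 1) 0 ⟨i.1, hi⟩ m
        (iterProd k m e p) (iterProd k m e n)
      have hpos : innerPos (by omega : 2 + p = (p + 1) + 1) (0 : Fin 2) ⟨i.1, hi⟩ = i := by
        simp [innerPos]
      rw [hpos, ih] at a
      exact a
    · have a := assoc_outer (k := k) (by omega : 2 + p = (p + 1) + 1) h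
        (by omega : 2 + n = (n + 1) + 1) (by omega : (n + 1) + p = r + 1) 0 1 Fin.zero_lt_one m
        (iterProd k m e p) (iterProd k m e n)
      have hpos : outerPos (by omega : 2 + p = (p + 1) + 1) (0 : Fin 2) 1 Fin.zero_lt_one.ne' =
          i := by
        simp only [outerPos, Fin.ext_iff]
        have := i.2
        simp
        omega
      rw [hpos] at a
      exact a.trans (product_iterProd hr ha n p _ _)

theorem act_iterProd (hl : comp (k := k) (rfl : 2 + 0 = 1 + 1) 0 m e = one (k := k))
    (hr : comp (k := k) (rfl : 2 + 0 = 1 + 1) 1 m e = one (k := k))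
    (ha : comp (k := k) (rfl : 2 + 2 = 3 + 1) 0 m m = comp (k := k) (rfl : 2 + 2 = 3 + 1) 1 m m)
    (hs : act (k := k) (Equiv.swap 0 1) m = m) {n : ℕ} (σ : Equiv.Perm (Fin n)) :
    act (k := k) σ (iterProd k m e n) = iterProd k m e n := by
  cases n with
  | zero => rw [Subsingleton.elim σ 1, act_one]
  | succ n =>
    have hσ : σ ∈ Submonoid.closure
        (Set.range fun i : Fin n => Equiv.swap i.castSucc i.succ) := by
      rw [Equiv.Perm.mclosure_swap_castSucc_succ]; trivial
    induction hσ using Submonoid.closure_induction with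
    | mem x hx =>
      obtain ⟨i, rfl⟩ := hx
      have e1 := comp_act (k := k) (rfl : n + 2 = (n + 1) + 1) i (Equiv.swap 0 1)
        (iterProd k m e n) m
      have e2 := iterProd_comp hr ha (rfl : n + 2 = (n + 1) + 1) i
      rw [iterProd_two hl] at e2
      rw [hs, permComp_one_swap, e2] at e1
      exact e1.symm
    | one => exact act_one _
    | mul x y _ _ hx hy => rw [act_mul, hx, hy]

variable (k) in
/-- The associator `(x₁x₂)x₃ - x₁(x₂x₃)` of a binary operation. -/
def associator (m : E 2) : E 3 :=
  comp (k := k) (rfl : 2 + 2 = 3 + 1) 0 m m - comp (k := k) (rfl : 2 + 2 = 3 + 1) 1 m m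

/-- The associator is a cocycle, whatever the binary operation: the five terms of the pentagon of
bracketings of four factors cancel. -/
theorem pentagon (m : E 2) :
    comp (k := k) (rfl : 2 + 3 = 4 + 1) 1 m (associator k m)
      - comp (k := k) (rfl : 3 + 2 = 4 + 1) 0 (associator k m) m
      + comp (k := k) (rfl : 3 + 2 = 4 + 1) 1 (associator k m) m
      - comp (k := k) (rfl : 3 + 2 = 4 + 1) 2 (associator k m) m
      + comp (k := k) (rfl : 2 + 3 = 4 + 1) 0 m (associator k m) = 0 := by
  have h2 : 2 + 2 = 3 + 1 := rfl
  have h3 : 3 + 2 = 4 + 1 := rfl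
  have h3' : 2 + 3 = 4 + 1 := rfl
  have a1 : comp (k := k) h3 1 (comp (k := k) h2 1 m m) m =
    comp (k := k) h3' 1 m (comp (k := k) h2 0 m m) := assoc_inner h2 h3 h2 h3' 1 0 m m m
  have a2 : comp (k := k) h3 2 (comp (k := k) h2 1 m m) m =
    comp (k := k) h3' 1 m (comp (k := k) h2 1 m m) := assoc_inner h2 h3 h2 h3' 1 1 m m m
  have a3 : comp (k := k) h3 0 (comp (k := k) h2 0 m m) m =
    comp (k := k) h3' 0 m (comp (k := k) h2 0 m m) := assoc_inner h2 h3 h2 h3' 0 0 m m m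
  have a4 : comp (k := k) h3 1 (comp (k := k) h2 0 m m) m =
    comp (k := k) h3' 0 m (comp (k := k) h2 1 m m) := assoc_inner h2 h3 h2 h3' 0 1 m m m
  have a5 : comp (k := k) h3 2 (comp (k := k) h2 0 m m) m =
    comp (k := k) h3 0 (comp (k := k) h2 1 m m) m :=
    assoc_outer h2 h3 h2 h3 0 1 Fin.zero_lt_one m m m
  simp only [associator, map_sub, LinearMap.sub_apply, a1, a2, a3, a4, a5]
  abel

end UnitalAssociative

namespace Ext

variable {k : Type u} [CommRing k] {P : ℕ → Type v}
  [∀ n, AddCommGroup (P n)] [∀ n, Module k (P n)] [SymOperad k P] {c : Z2star k P}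

theorem eq_add_eps {n : ℕ} {x : Ext c n} {y : Ext c n} (h : fst x = fst y) :
    x = y + eps (snd (x - y)) := by
  rw [← eq_eps (by rw [map_sub, h, sub_self])]; abel

theorem fst_iterProd (m : Ext c 2) (e : Ext c 0) (n : ℕ) :
    fst (iterProd k m e n) = iterProd k (fst m) (fst e) n := by
  induction n with
  | zero => rfl
  | succ n ih => simp only [iterProd, fst_comp, ih]

theorem associator_eq_eps {m : Ext c 2} (h : associator k (fst m) = 0) :
    associator k m = eps (snd (associator k m)) :=
  eq_eps (by rw [← h]; simp [associator])

/-- A unit lifts along the extension if the product lifts to an associative one. -/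
theorem exists_unit {m : Ext c 2} {e₀ : P 0}
    (hl : comp (k := k) (rfl : 2 + 0 = 1 + 1) 0 (fst m) e₀ = one (k := k))
    (hr : comp (k := k) (rfl : 2 + 0 = 1 + 1) 1 (fst m) e₀ = one (k := k))
    (ha : comp (k := k) (rfl : 2 + 2 = 3 + 1) 0 m m = comp (k := k) (rfl : 2 + 2 = 3 + 1) 1 m m)
    (h1 : ∀ x : P 1, ∃ a : k, x = a • one (k := k))
    (hm : ∀ a b : k, a • fst m = b • fst m → a = b) :
    ∃ e : Ext c 0, fst e = e₀ ∧
      comp (k := k) (rfl : 2 + 0 = 1 + 1) 0 m e = one (k := k) ∧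
      comp (k := k) (rfl : 2 + 0 = 1 + 1) 1 m e = one (k := k) := by
  set e : Ext c 0 := mk c e₀ 0 with he
  obtain ⟨a, ha'⟩ := h1 (snd (comp (k := k) (rfl : 2 + 0 = 1 + 1) 0 m e - one (k := k)))
  obtain ⟨b, hb'⟩ := h1 (snd (comp (k := k) (rfl : 2 + 0 = 1 + 1) 1 m e - one (k := k)))
  have el : comp (k := k) (rfl : 2 + 0 = 1 + 1) 0 m e = one (k := k) + eps (a • one (k := k)) :=
    ha' ▸ eq_add_eps (by simpa [he] using hl)
  have er : comp (k := k) (rfl : 2 + 0 = 1 + 1) 1 m e = one (k := k) + eps (b • one (k := k)) :=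
    hb' ▸ eq_add_eps (by simpa [he] using hr)
  -- Inserting the unit in the middle slot of the associativity law shows `a = b`.
  have hab : a = b := by
    have a1 : comp (k := k) (rfl : 3 + 0 = 2 + 1) 1 (comp (k := k) (rfl : 2 + 2 = 3 + 1) 0 m m) e =
      comp (k := k) (rfl : 2 + 1 = 2 + 1) 0 m (comp (k := k) (rfl : 2 + 0 = 1 + 1) 1 m e) :=
      assoc_inner _ _ _ _ 0 1 m m e
    have a2 : comp (k := k) (rfl : 3 + 0 = 2 + 1) 1 (comp (k := k) (rfl : 2 + 2 = 3 + 1) 1 m m) e =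
      comp (k := k) (rfl : 2 + 1 = 2 + 1) 1 m (comp (k := k) (rfl : 2 + 0 = 1 + 1) 0 m e) :=
      assoc_inner _ _ _ _ 1 0 m m e
    rw [ha, a2, el, er] at a1
    simp only [map_add, comp_one, comp_eps, map_smul, add_right_inj] at a1
    refine hm a b (eps_injective (c := c) ?_)
    simpa only [map_smul] using a1
  subst hab
  refine ⟨e - eps (a • e₀), by simp [he], ?_, ?_⟩
  · rw [map_sub, el, comp_eps, map_smul (comp (k := k) _ 0 (fst m)), hl]; abel
  · rw [map_sub, er, comp_eps, map_smul (comp (k := k) _ 1 (fst m)), hr]; abel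

end Ext

/-! ### The commutative operad -/

section Com

variable {k : Type u} [CommRing k]

theorem Com.act_eq {n : ℕ} (σ : Equiv.Perm (Fin n)) (x : Com k n) : act (k := k) σ x = x := rfl

/-- The commutative product of `n` factors. -/
def Com.prod (k : Type u) [CommRing k] (n : ℕ) : Com k n := (1 : k)

theorem Com.eq_smul {n : ℕ} (x : Com k n) : ∃ a : k, x = a • Com.prod k n :=
  ⟨x, (mul_one (M := k) x).symm⟩

theorem Com.smul_prod_injective {n : ℕ} (a b : k) (h : a • Com.prod k n = b • Com.prod k n) :
    a = b := by
  have h' : (a * 1 : k) = b * 1 := h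
  rwa [mul_one, mul_one] at h'

theorem Com.comp_prod {m n r : ℕ} (h : m + n = r + 1) (i : Fin m) :
    comp (k := k) h i (Com.prod k m) (Com.prod k n) = Com.prod k r := mul_one (M := k) 1

theorem Com.iterProd_eq (n : ℕ) : iterProd k (Com.prod k 2) (Com.prod k 0) n = Com.prod k n := by
  induction n with
  | zero => rfl
  | succ n ih => rw [iterProd, ih, Com.comp_prod]

/-- The pentagon makes every lift of the product associative, and the unit makes it commutative. -/
theorem Com.mem_B2star (c : Z2star k (Com k)) : c.1 ∈ B2star k (Com k) := by
  set m : Ext c 2 := Ext.mk c (Com.prod k 2) 0 with hm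
  have hm1 : Ext.fst m = Com.prod k 2 := rfl
  have haz : associator k (Ext.fst m) = 0 := by
    rw [hm1, associator, Com.comp_prod, Com.comp_prod, sub_self]
  have hz := Ext.associator_eq_eps haz
  set z := Ext.snd (associator k m)
  -- All five terms of the pentagon equal `z`, with signs that add up to one.
  have hz0 : z = 0 := by
    have hp := pentagon (k := k) m
    rw [hz] at hp
    simp only [Ext.comp_eps, Ext.eps_comp, ← map_sub, ← map_add] at hp
    obtain ⟨a, ha⟩ := Com.eq_smul z
    have h := congrArg Ext.snd hp
    rw [Ext.snd_eps, map_zero, hm1, ha] at h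
    simp only [map_smul, LinearMap.smul_apply, Com.comp_prod] at h
    have h2 : a • Com.prod k 4 = (0 : k) • Com.prod k 4 := by
      rw [zero_smul, ← h]; abel
    rw [ha, Com.smul_prod_injective _ _ h2, zero_smul]
  rw [hz0, map_zero] at hz
  have ha := sub_eq_zero.1 hz
  obtain ⟨e, he, hl, hr⟩ := Ext.exists_unit (e₀ := Com.prod k 0) (m := m) (Com.comp_prod _ _)
    (Com.comp_prod _ _) ha Com.eq_smul Com.smul_prod_injective
  have hx : act (k := k) (Equiv.swap 0 1) m = m + Ext.eps (Ext.snd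
    (act (k := k) (Equiv.swap 0 1) m - m)) := Ext.eq_add_eps (by simp [Com.act_eq])
  set x := Ext.snd (act (k := k) (Equiv.swap 0 1) m - m)
  have hs : act (k := k) (Equiv.swap 0 1) m = m := by
    have h := act_comp (k := k) (rfl : 2 + 0 = 1 + 1) 0 (Equiv.swap 0 1) m e
    rw [Equiv.swap_apply_left, hr, Subsingleton.elim (permComp _ _ _ _) 1, act_one, hx, map_add,
      LinearMap.add_apply, hl, Ext.eps_comp, add_eq_left, he] at h
    obtain ⟨a, ha⟩ := Com.eq_smul x
    have h1 := congrArg Ext.snd h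
    rw [Ext.snd_eps, map_zero, ha, map_smul, LinearMap.smul_apply, Com.comp_prod] at h1
    have h2 : x = 0 := by
      rw [ha, Com.smul_prod_injective (n := 1) a 0 (by rw [h1, zero_smul]), zero_smul]
    rw [hx, h2, map_zero, add_zero]
  let s : (n : ℕ) → Com k n →ₗ[k] Ext c n := fun n =>
    LinearMap.toSpanSingleton k (Ext c n) (iterProd k m e n)
  have hsec' : ∀ n : ℕ, s n (Com.prod k n) = iterProd k m e n := fun n =>
    one_smul k (iterProd k m e n)
  have hsec : ∀ {n : ℕ} (a : k), s n (a • Com.prod k n) = a • iterProd k m e n := fun a => by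
    rw [map_smul, hsec']
  refine Ext.mem_B2star_of_section s (fun {n} μ => ?_)
    (fun σ μ => ?_) (fun {p n r} h i μ ν => ?_)
  · obtain ⟨a, rfl⟩ := Com.eq_smul μ
    rw [hsec, map_smul, Ext.fst_iterProd, he, hm1, Com.iterProd_eq]
  · obtain ⟨a, rfl⟩ := Com.eq_smul μ
    rw [Com.act_eq, hsec, map_smul, act_iterProd hl hr ha hs]
  · obtain ⟨a, rfl⟩ := Com.eq_smul μ
    obtain ⟨b, rfl⟩ := Com.eq_smul ν
    simp only [map_smul, LinearMap.smul_apply, Com.comp_prod, hsec', iterProd_comp hr ha]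

end Com

/-! ### The associative operad -/

section As

variable {k : Type u} [CommRing k]

theorem As.comp_of' {m n r : ℕ} (h : m + n = r + 1) (i : Fin m)
    (φ : Equiv.Perm (Fin m)) (σ : Equiv.Perm (Fin n)) :
    SymOperad.comp (k := k) h i (As.of k φ) (As.of k σ) = As.of k (permComp h i φ σ) :=
  As.comp_of k h i φ σ

theorem As.act_of' {n : ℕ} (σ τ : Equiv.Perm (Fin n)) :
    SymOperad.act (k := k) σ (As.of k τ) = As.of k (τ * σ) := As.act_of k σ τ

theorem As.of_comp_eq_mapDomain {m n r : ℕ} (h : m + n = r + 1) (i : Fin m)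
    (φ : Equiv.Perm (Fin m)) (z : As k n) :
    SymOperad.comp (k := k) h i (As.of k φ) z = Finsupp.mapDomain (permComp h i φ) z := by
  induction z using As.induction with
  | h0 => rw [map_zero]; exact Finsupp.mapDomain_zero.symm
  | hadd x y hx hy => rw [map_add, hx, hy]; exact Finsupp.mapDomain_add.symm
  | hof a σ =>
    rw [map_smul, As.comp_of']
    exact .trans (congrArg (a • ·) (Finsupp.mapDomain_single (f := permComp h i φ)).symm)
      (Finsupp.mapDomain_smul (f := permComp h i φ) a _).symm

theorem As.comp_of_eq_mapDomain {m n r : ℕ} (h : m + n = r + 1) (i : Fin m)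
    (σ : Equiv.Perm (Fin n)) (z : As k m) :
    SymOperad.comp (k := k) h i z (As.of k σ) = Finsupp.mapDomain (permComp h i · σ) z := by
  induction z using As.induction with
  | h0 => rw [map_zero]; exact Finsupp.mapDomain_zero.symm
  | hadd x y hx hy => rw [map_add, LinearMap.add_apply, hx, hy]; exact Finsupp.mapDomain_add.symm
  | hof a φ =>
    rw [map_smul, LinearMap.smul_apply, As.comp_of']
    exact .trans (congrArg (a • ·) (Finsupp.mapDomain_single (f := (permComp h i · σ))).symm)
      (Finsupp.mapDomain_smul (f := (permComp h i · σ)) a _).symm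

theorem As.iterProd_eq (n : ℕ) :
    iterProd k (As.of k 1) (As.of k 1) n = As.of k (1 : Equiv.Perm (Fin n)) := by
  have h1 : ∀ {m n r : ℕ} (h : m + n = r + 1) (i : Fin m), permComp h i 1 1 = 1 := by
    intro m n r h i
    have := permComp_mul h i 1 1 1 1
    rw [one_mul, one_mul, Equiv.Perm.one_apply] at this
    exact left_eq_mul.1 this
  induction n with
  | zero => rfl
  | succ n ih => rw [iterProd, ih, As.comp_of', h1]

end As

section As

variable {k : Type u} [CommRing k]

theorem permComp_injective_right {m n r : ℕ} (h : m + n = r + 1) (i : Fin m)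
    (φ : Equiv.Perm (Fin m)) : Function.Injective (permComp h i φ) := by
  intro σ τ e
  ext1 j
  have := congrArg (· (innerPos h i j)) e
  simp only [permComp_innerPos] at this
  simpa [innerPos, Fin.ext_iff] using this

/-- The coefficient of a permutation in an element of `As n`. -/
noncomputable def As.coeff {n : ℕ} (σ : Equiv.Perm (Fin n)) : As k n →ₗ[k] k :=
  Finsupp.lapply σ

theorem As.coeff_of {n : ℕ} (σ τ : Equiv.Perm (Fin n)) :
    As.coeff σ (As.of k τ) = if τ = σ then 1 else 0 := Finsupp.single_apply

theorem As.ext_coeff {n : ℕ} {x y : As k n} (h : ∀ σ, As.coeff σ x = As.coeff σ y) : x = y :=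
  Finsupp.ext h

theorem As.of_comp_apply {m n r : ℕ} (h : m + n = r + 1) (i : Fin m)
    (φ : Equiv.Perm (Fin m)) (z : As k n) (π : Equiv.Perm (Fin r)) (σ : Equiv.Perm (Fin n))
    (hσ : permComp h i φ σ = π) :
    As.coeff π (SymOperad.comp (k := k) h i (As.of k φ) z) =
      As.coeff σ z := by
  rw [As.of_comp_eq_mapDomain, ← hσ]
  exact Finsupp.mapDomain_apply (permComp_injective_right h i φ) _ _

theorem As.of_comp_apply_eq_zero {m n r : ℕ} (h : m + n = r + 1) (i : Fin m)
    (φ : Equiv.Perm (Fin m)) (z : As k n) (π : Equiv.Perm (Fin r))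
    (hπ : ∀ σ, permComp h i φ σ ≠ π) :
    As.coeff π (SymOperad.comp (k := k) h i (As.of k φ) z) = 0 := by
  rw [As.of_comp_eq_mapDomain]
  exact Finsupp.mapDomain_of_notMem_range _ _ (by rintro ⟨σ, h'⟩; exact hπ σ h')

theorem As.comp_of_apply {m n r : ℕ} (h : m + n = r + 1) (i : Fin m)
    (τ : Equiv.Perm (Fin n)) (z : As k m) (π : Equiv.Perm (Fin r)) (σ : Equiv.Perm (Fin m))
    (hσ : permComp h i σ τ = π) (hinj : Function.Injective fun φ => permComp h i φ τ) :
    As.coeff π (SymOperad.comp (k := k) h i z (As.of k τ)) =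
      As.coeff σ z := by
  rw [As.comp_of_eq_mapDomain, ← hσ]
  exact Finsupp.mapDomain_apply hinj _ _

theorem As.comp_of_apply_eq_zero {m n r : ℕ} (h : m + n = r + 1) (i : Fin m)
    (τ : Equiv.Perm (Fin n)) (z : As k m) (π : Equiv.Perm (Fin r))
    (hπ : ∀ σ, permComp h i σ τ ≠ π) :
    As.coeff π (SymOperad.comp (k := k) h i z (As.of k τ)) = 0 := by
  rw [As.comp_of_eq_mapDomain]
  exact Finsupp.mapDomain_of_notMem_range _ _ (by rintro ⟨σ, h'⟩; exact hπ σ h')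

open Equiv in
set_option maxRecDepth 10000 in
/-- The multilinear Hochschild 3-cocycles of the free associative algebra: a solution of the
pentagon equation in `k𝕊₃` is a multiple of the coboundary of `x₂x₁`.  The coefficients are read
off from those of the words `x₁x₂x₃x₄`, `x₁x₃x₂x₄`, `x₁x₃x₄x₂`, `x₁x₄x₂x₃`, `x₁x₄x₃x₂`. -/
theorem As.pentagon_solution (z : As k 3)
    (hz : SymOperad.comp (k := k) (r := 4) (rfl : 2 + 3 = 4 + 1) 1 (As.of k 1) z
      - SymOperad.comp (k := k) (r := 4) (rfl : 3 + 2 = 4 + 1) 0 z (As.of k 1)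
      + SymOperad.comp (k := k) (r := 4) (rfl : 3 + 2 = 4 + 1) 1 z (As.of k 1)
      - SymOperad.comp (k := k) (r := 4) (rfl : 3 + 2 = 4 + 1) 2 z (As.of k 1)
      + SymOperad.comp (k := k) (r := 4) (rfl : 2 + 3 = 4 + 1) 0 (As.of k 1) z = 0) :
    ∃ a : k, z = a • (As.of k (swap 1 2) - As.of k (swap 0 1)
      + As.of k (swap 1 2 * swap 0 1) - As.of k (swap 0 1 * swap 1 2)) := by
  have inj : ∀ i : Fin 3, Function.Injective
      fun φ : Perm (Fin 3) => permComp (rfl : 3 + 2 = 4 + 1) i φ 1 := by decide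
  let f : Perm (Fin 3) → k := fun σ => As.coeff σ z
  have ev := fun π : Perm (Fin 4) => congrArg (As.coeff π) hz
  simp only [map_add, map_sub, map_zero] at ev
  have h1 : f 1 = 0 := by
    have h := ev 1
    rw [As.of_comp_apply _ _ _ _ _ 1 (by decide), As.comp_of_apply _ _ _ _ _ 1 (by decide) (inj _),
      As.comp_of_apply _ _ _ _ _ 1 (by decide) (inj _),
      As.comp_of_apply _ _ _ _ _ 1 (by decide) (inj _),
      As.of_comp_apply _ _ _ _ _ 1 (by decide)] at h
    change f 1 - f 1 + f 1 - f 1 + f 1 = 0 at h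
    linear_combination h
  have h2 : f (swap 0 1) = - f (swap 1 2) := by
    have h := ev (swap 1 2)
    rw [As.of_comp_apply _ _ _ _ _ (swap 0 1) (by decide),
      As.comp_of_apply_eq_zero _ _ _ _ _ (by decide),
      As.comp_of_apply_eq_zero _ _ _ _ _ (by decide),
      As.comp_of_apply_eq_zero _ _ _ _ _ (by decide),
      As.of_comp_apply _ _ _ _ _ (swap 1 2) (by decide)] at h
    change f (swap 0 1) - 0 + 0 - 0 + f (swap 1 2) = 0 at h
    linear_combination h
  have h3 : f (swap 1 2 * swap 0 1) = f (swap 1 2) := by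
    have h := ev (swap 2 3 * swap 1 2)
    rw [As.of_comp_apply _ _ _ _ _ (swap 1 2 * swap 0 1) (by decide),
      As.comp_of_apply_eq_zero _ _ _ _ _ (by decide),
      As.comp_of_apply_eq_zero _ _ _ _ _ (by decide),
      As.comp_of_apply _ _ _ _ _ (swap 1 2) (by decide) (inj _),
      As.of_comp_apply_eq_zero _ _ _ _ _ (by decide)] at h
    change f (swap 1 2 * swap 0 1) - 0 + 0 - f (swap 1 2) + 0 = 0 at h
    linear_combination h
  have h4 : f (swap 0 1 * swap 1 2) = - f (swap 1 2) := by
    have h := ev (swap 1 2 * swap 2 3)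
    rw [As.of_comp_apply _ _ _ _ _ (swap 0 1 * swap 1 2) (by decide),
      As.comp_of_apply_eq_zero _ _ _ _ _ (by decide),
      As.comp_of_apply _ _ _ _ _ (swap 1 2) (by decide) (inj _),
      As.comp_of_apply_eq_zero _ _ _ _ _ (by decide),
      As.of_comp_apply_eq_zero _ _ _ _ _ (by decide)] at h
    change f (swap 0 1 * swap 1 2) - 0 + f (swap 1 2) - 0 + 0 = 0 at h
    linear_combination h
  have h5 : f (swap 0 2) = 0 := by
    have h := ev (swap 1 3)
    rw [As.of_comp_apply _ _ _ _ _ (swap 0 2) (by decide),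
      As.comp_of_apply_eq_zero _ _ _ _ _ (by decide),
      As.comp_of_apply_eq_zero _ _ _ _ _ (by decide),
      As.comp_of_apply_eq_zero _ _ _ _ _ (by decide),
      As.of_comp_apply_eq_zero _ _ _ _ _ (by decide)] at h
    change f (swap 0 2) - 0 + 0 - 0 + 0 = 0 at h
    linear_combination h
  have hsix : ∀ σ : Perm (Fin 3), σ = 1 ∨ σ = swap 1 2 ∨ σ = swap 0 1 ∨
      σ = swap 1 2 * swap 0 1 ∨ σ = swap 0 1 * swap 1 2 ∨ σ = swap 0 2 := by decide
  refine ⟨f (swap 1 2), As.ext_coeff fun σ => ?_⟩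
  simp only [map_smul, map_add, map_sub, As.coeff_of, smul_eq_mul]
  change f σ = _
  rcases hsix σ with rfl | rfl | rfl | rfl | rfl | rfl
  · rw [if_neg (by decide), if_neg (by decide), if_neg (by decide), if_neg (by decide), h1]; ring
  · rw [if_pos rfl, if_neg (by decide), if_neg (by decide), if_neg (by decide)]; ring
  · rw [if_neg (by decide), if_pos rfl, if_neg (by decide), if_neg (by decide), h2]; ring
  · rw [if_neg (by decide), if_neg (by decide), if_pos rfl, if_neg (by decide), h3]; ring
  · rw [if_neg (by decide), if_neg (by decide), if_neg (by decide), if_pos rfl, h4]; ring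
  · rw [if_neg (by decide), if_neg (by decide), if_neg (by decide), if_neg (by decide), h5]; ring

theorem As.one_eq : SymOperad.one (k := k) = As.of k (1 : Equiv.Perm (Fin 1)) := rfl

open Equiv in
/-- The product of `As` lifts to an associative product of any extension. -/
theorem As.exists_associative_lift (c : Z2star k (As k)) :
    ∃ m : Ext c 2, Ext.fst m = As.of k 1 ∧ associator k m = 0 := by
  set m : Ext c 2 := Ext.mk c (As.of k 1) 0 with hm
  have hm1 : Ext.fst m = As.of k 1 := rfl
  have haz : associator k (Ext.fst m) = 0 := by
    rw [hm1, associator, As.comp_of', As.comp_of', sub_eq_zero]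
    exact congrArg (As.of k) (by decide)
  have hz := Ext.associator_eq_eps haz
  have hp := pentagon (k := k) m
  rw [hz] at hp
  simp only [Ext.comp_eps, Ext.eps_comp, ← map_sub, ← map_add, hm1] at hp
  have hp' := congrArg Ext.snd hp
  rw [Ext.snd_eps, map_zero] at hp'
  obtain ⟨a, ha⟩ := As.pentagon_solution _ hp'
  refine ⟨m + Ext.eps (a • As.of k (swap 0 1)), by simp [hm1], ?_⟩
  have h0 : ∀ t : As k 2, associator k (m + Ext.eps t) = associator k m + Ext.eps (
      SymOperad.comp (k := k) (rfl : 2 + 2 = 3 + 1) 0 t (As.of k 1)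
      + SymOperad.comp (k := k) (rfl : 2 + 2 = 3 + 1) 0 (As.of k 1) t
      - SymOperad.comp (k := k) (rfl : 2 + 2 = 3 + 1) 1 t (As.of k 1)
      - SymOperad.comp (k := k) (rfl : 2 + 2 = 3 + 1) 1 (As.of k 1) t) := by
    intro t
    simp only [associator, map_add, LinearMap.add_apply, Ext.comp_eps, Ext.eps_comp, hm1,
      Ext.fst_eps, map_zero, map_sub]
    abel
  rw [h0, hz, ha, ← map_add]
  simp only [map_smul, LinearMap.smul_apply, As.comp_of']
  have p1 : permComp (rfl : 2 + 2 = 3 + 1) 0 (swap (0 : Fin 2) 1) (1 : Perm (Fin 2)) =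
    swap 0 1 * swap 1 2 := by decide
  have p2 : permComp (rfl : 2 + 2 = 3 + 1) 0 (1 : Perm (Fin 2)) (swap (0 : Fin 2) 1) =
    swap 0 1 := by decide
  have p3 : permComp (rfl : 2 + 2 = 3 + 1) 1 (swap (0 : Fin 2) 1) (1 : Perm (Fin 2)) =
    swap 1 2 * swap 0 1 := by decide
  have p4 : permComp (rfl : 2 + 2 = 3 + 1) 1 (1 : Perm (Fin 2)) (swap (0 : Fin 2) 1) =
    swap 1 2 := by decide
  rw [p1, p2, p3, p4, ← smul_add, ← smul_sub, ← smul_sub, ← smul_add]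
  refine (congrArg (fun y => Ext.eps (a • y)) (?_ : _ = (0 : As k 3))).trans (by simp)
  abel

/-- The section sends a permutation `σ` to the permuted iterated product of an associative unital
lift. -/
theorem As.mem_B2star (c : Z2star k (As k)) : c.1 ∈ B2star k (As k) := by
  obtain ⟨m, hm1, ha⟩ := As.exists_associative_lift c
  replace ha := sub_eq_zero.1 ha
  have hunit : ∀ i : Fin 2, SymOperad.comp (k := k) (rfl : 2 + 0 = 1 + 1) i (Ext.fst m)
      (As.of k 1) = SymOperad.one (k := k) := fun i => by
    rw [hm1, As.comp_of', As.one_eq, Subsingleton.elim (permComp _ _ _ _) 1]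
  obtain ⟨e, he, hl, hr⟩ := Ext.exists_unit (e₀ := As.of k 1) (m := m) (hunit 0) (hunit 1) ha
    (fun x => ⟨As.coeff 1 x, As.ext_coeff fun σ => by
      rw [Subsingleton.elim σ 1, As.one_eq, map_smul, As.coeff_of, if_pos rfl, smul_eq_mul,
        mul_one]⟩)
    (fun a b h => by
      have h' := congrArg (As.coeff 1) h
      rwa [hm1, map_smul, map_smul, As.coeff_of, if_pos rfl, smul_eq_mul, smul_eq_mul, mul_one,
        mul_one] at h')
  let s : (n : ℕ) → As k n →ₗ[k] Ext c n := fun n =>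
    Finsupp.linearCombination k fun σ : Equiv.Perm (Fin n) =>
      SymOperad.act (k := k) σ (iterProd k m e n)
  have hs : ∀ {n : ℕ} (σ : Equiv.Perm (Fin n)),
      s n (As.of k σ) = SymOperad.act (k := k) σ (iterProd k m e n) := fun σ =>
    (Finsupp.linearCombination_single k (1 : k) σ).trans (one_smul _ _)
  refine Ext.mem_B2star_of_section s (fun {n} μ => ?_) (fun σ μ => ?_) (fun h i μ ν => ?_)
  · induction μ using As.induction with
    | h0 => simp
    | hadd x y hx hy => rw [map_add, map_add, hx, hy]
    | hof a σ =>
      rw [map_smul, map_smul, hs, Ext.fst_act, Ext.fst_iterProd, he, hm1, As.iterProd_eq,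
        As.act_of', one_mul]
  · induction μ using As.induction with
    | h0 => simp
    | hadd x y hx hy => simp only [map_add, hx, hy]
    | hof a τ => simp only [map_smul, As.act_of', hs, act_mul]
  · induction μ using As.induction with
    | h0 => simp
    | hadd x y hx hy => simp only [map_add, LinearMap.add_apply, hx, hy]
    | hof a φ =>
      induction ν using As.induction with
      | h0 => simp
      | hadd x y hx hy => simp only [map_add, hx, hy]
      | hof b σ =>
        have e1 := permComp_mul h i φ 1 1 σ
        rw [one_mul, mul_one, Equiv.Perm.one_apply] at e1
        simp only [map_smul, LinearMap.smul_apply, As.comp_of', hs, act_comp, comp_act,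
          iterProd_comp hr ha, ← act_mul, e1]

end As

/-! ### An operad of functions on matrices -/

section Mat

/-- The slot of `μ` to which a slot of `μ ∘ᵢ ν` belongs: `i` for the slots of `ν`. -/
def block {m n r : ℕ} (h : m + n = r + 1) (i : Fin m) (x : Fin r) : Fin m :=
  Sum.elim (fun j => j.1) (fun _ => i) ((slots h i).symm x)

theorem block_innerPos {m n r : ℕ} (h : m + n = r + 1) (i : Fin m) (j : Fin n) :
    block h i (innerPos h i j) = i := by
  have : (slots h i).symm (innerPos h i j) = Sum.inr j := by
    rw [Equiv.symm_apply_eq]; rfl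
  rw [block, this]; rfl

theorem block_outerPos {m n r : ℕ} (h : m + n = r + 1) (i j : Fin m) (hj : j ≠ i) :
    block h i (outerPos h i j hj) = j := by
  have : (slots h i).symm (outerPos h i j hj) = Sum.inl ⟨j, hj⟩ := by
    rw [Equiv.symm_apply_eq]; rfl
  rw [block, this]; rfl

theorem block_val {m n r : ℕ} (h : m + n = r + 1) (i : Fin m) (x : Fin r) :
    (block h i x).1 = if x.1 < i.1 then x.1 else if x.1 < i.1 + n then i.1 else x.1 + 1 - n := by
  rcases slot_cases h i x with ⟨j, rfl⟩ | ⟨j, hj, rfl⟩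
  · rw [block_innerPos]
    have hv : (innerPos h i j).1 = i.1 + j.1 := rfl
    rw [if_neg (by omega), if_pos (by omega)]
  · rw [block_outerPos]
    have : j.1 ≠ i.1 := fun e => hj (Fin.ext e)
    simp only [outerPos]
    split_ifs <;> omega

variable {k : Type u} [CommRing k]

variable (k) in
/-- The `0/1`-matrix that sums the rows belonging to the inserted block. -/
def collapse {m n r : ℕ} (h : m + n = r + 1) (i : Fin m) : Matrix (Fin m) (Fin r) k :=
  Matrix.of fun a x => if block h i x = a then 1 else 0

variable (k) in
/-- The `0/1`-matrix that selects the rows of the inserted block. -/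
def restrict {m n r : ℕ} (h : m + n = r + 1) (i : Fin m) : Matrix (Fin n) (Fin r) k :=
  Matrix.of fun j x => if innerPos h i j = x then 1 else 0

variable (k) in
/-- The `0/1`-matrix of a permutation. -/
def permMat {n : ℕ} (σ : Equiv.Perm (Fin n)) : Matrix (Fin n) (Fin n) k :=
  Matrix.of fun a x => if σ x = a then 1 else 0

/-- The congruence `W ↦ A W Aᵀ`. -/
def conj {m n : ℕ} (A : Matrix (Fin m) (Fin n) k) (W : Matrix (Fin n) (Fin n) k) :
    Matrix (Fin m) (Fin m) k := A * W * A.transpose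

theorem conj_conj {m n p : ℕ} (A : Matrix (Fin m) (Fin n) k) (B : Matrix (Fin n) (Fin p) k)
    (W : Matrix (Fin p) (Fin p) k) : conj A (conj B W) = conj (A * B) W := by
  simp only [conj, Matrix.transpose_mul, Matrix.mul_assoc]

theorem conj_one {n : ℕ} (W : Matrix (Fin n) (Fin n) k) : conj 1 W = W := by
  simp [conj]

/-- Functions on `n × n`-matrices. -/
def Mat (k : Type u) (n : ℕ) : Type u := Matrix (Fin n) (Fin n) k → k

instance (n : ℕ) : AddCommGroup (Mat k n) :=
  inferInstanceAs (AddCommGroup (Matrix (Fin n) (Fin n) k → k))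

instance (n : ℕ) : Module k (Mat k n) :=
  inferInstanceAs (Module k (Matrix (Fin n) (Fin n) k → k))

theorem mul_collapse {l m n r : ℕ} (h : m + n = r + 1) (i : Fin m) (A : Matrix (Fin l) (Fin m) k)
    (a : Fin l) (x : Fin r) : (A * collapse k h i) a x = A a (block h i x) := by
  simp [Matrix.mul_apply, collapse]

theorem mul_permMat {l n : ℕ} (σ : Equiv.Perm (Fin n)) (A : Matrix (Fin l) (Fin n) k)
    (a : Fin l) (x : Fin n) : (A * permMat k σ) a x = A a (σ x) := by
  simp [Matrix.mul_apply, permMat]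

theorem restrict_mul {m n r l : ℕ} (h : m + n = r + 1) (i : Fin m) (A : Matrix (Fin r) (Fin l) k)
    (j : Fin n) (x : Fin l) : (restrict k h i * A) j x = A (innerPos h i j) x := by
  simp [Matrix.mul_apply, restrict]

section

variable {l m n r s t : ℕ}

theorem collapse_collapse_inner (hr : l + m = r + 1) (ht : r + n = t + 1)
    (ht' : l + s = t + 1) (i : Fin l) (j : Fin m) :
    collapse k hr i * collapse k ht (innerPos hr i j) = collapse k ht' i := by
  ext a x
  rw [mul_collapse]
  simp only [collapse, Matrix.of_apply, Fin.ext_iff, block_val, innerPos]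
  congr 1
  apply propext
  split_ifs <;> omega

theorem restrict_collapse_inner (hr : l + m = r + 1) (ht : r + n = t + 1)
    (hs : m + n = s + 1) (ht' : l + s = t + 1) (i : Fin l) (j : Fin m) :
    restrict k hr i * collapse k ht (innerPos hr i j) = collapse k hs j * restrict k ht' i := by
  ext b x
  rw [restrict_mul]
  simp only [collapse, restrict, Matrix.mul_apply, Matrix.of_apply, mul_ite, mul_one, mul_zero]
  by_cases hx : ∃ y, innerPos ht' i y = x
  · obtain ⟨y, rfl⟩ := hx
    rw [Finset.sum_eq_single y]
    · rw [if_pos rfl]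
      simp only [Fin.ext_iff, block_val, innerPos]
      congr 1
      apply propext
      split_ifs <;> omega
    · intro y' _ hy
      rw [if_neg]
      intro e
      exact hy (Fin.ext (by simpa [innerPos] using e))
    · simp
  · rw [Finset.sum_eq_zero fun y _ => if_neg fun e => hx ⟨y, e⟩, if_neg]
    intro e
    apply hx
    simp only [Fin.ext_iff, block_val, innerPos] at e ⊢
    exact ⟨⟨x.1 - i.1, by split_ifs at e <;> omega⟩, by simp only; split_ifs at e <;> omega⟩

theorem restrict_restrict (hr : l + m = r + 1) (ht : r + n = t + 1)
    (hs : m + n = s + 1) (ht' : l + s = t + 1) (i : Fin l) (j : Fin m) :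
    restrict k hs j * restrict k ht' i = restrict k ht (innerPos hr i j) := by
  ext c x
  rw [restrict_mul]
  simp only [restrict, Matrix.of_apply, inner_inner hr ht hs ht']

theorem collapse_collapse_outer (hr : l + m = r + 1) (ht : r + n = t + 1)
    (hs : l + n = s + 1) (ht' : s + m = t + 1) (i p : Fin l) (hip : i < p) :
    collapse k hr i * collapse k ht (outerPos hr i p hip.ne') =
      collapse k hs p * collapse k ht' (outerPos hs p i hip.ne) := by
  ext a x
  rw [mul_collapse, mul_collapse]
  have : i.1 < p.1 := hip
  simp only [collapse, Matrix.of_apply, Fin.ext_iff, block_val, outerPos]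
  congr 1
  apply propext
  split_ifs <;> omega

theorem restrict_collapse_outer (hr : l + m = r + 1) (ht : r + n = t + 1)
    (hs : l + n = s + 1) (ht' : s + m = t + 1) (i p : Fin l) (hip : p ≠ i) :
    restrict k hr i * collapse k ht (outerPos hr i p hip) =
      restrict k ht' (outerPos hs p i hip.symm) := by
  ext b x
  rw [restrict_mul]
  have : p.1 ≠ i.1 := fun e => hip (Fin.ext e)
  simp only [collapse, restrict, Matrix.of_apply, Fin.ext_iff, block_val, outerPos, innerPos]
  congr 1
  apply propext
  split_ifs <;> omega

theorem collapse_permMat (h : m + n = r + 1) (i : Fin m) (φ : Equiv.Perm (Fin m))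
    (σ : Equiv.Perm (Fin n)) :
    collapse k h (φ i) * permMat k (permComp h i φ σ) = permMat k φ * collapse k h i := by
  ext a x
  rw [mul_permMat, mul_collapse]
  simp only [collapse, permMat, Matrix.of_apply]
  rcases slot_cases h i x with ⟨j, rfl⟩ | ⟨j, hj, rfl⟩
  · rw [permComp_innerPos, block_innerPos, block_innerPos]
  · rw [permComp_outerPos, block_outerPos, block_outerPos]

theorem restrict_permMat (h : m + n = r + 1) (i : Fin m) (φ : Equiv.Perm (Fin m))
    (σ : Equiv.Perm (Fin n)) :
    restrict k h (φ i) * permMat k (permComp h i φ σ) = permMat k σ * restrict k h i := by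
  ext b x
  rw [restrict_mul]
  simp only [restrict, permMat, Matrix.of_apply, Matrix.mul_apply, mul_ite, mul_one, mul_zero]
  rcases slot_cases h i x with ⟨j, rfl⟩ | ⟨j, hj, rfl⟩
  · rw [permComp_innerPos]
    rw [Finset.sum_eq_single j]
    · simp [innerPos, Fin.ext_iff]
    · intro j' _ hj
      exact if_neg fun e => hj (by simpa [innerPos, Fin.ext_iff] using e)
    · simp
  · have ne : ∀ (i' : Fin m) (x : Fin n) (y : Fin m) (hy : y ≠ i'),
        innerPos h i' x ≠ outerPos h i' y hy :=
      fun i' x y hy e => Sum.inr_ne_inl ((slots h i').injective (a₁ := Sum.inr x)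
        (a₂ := Sum.inl ⟨y, hy⟩) e)
    rw [permComp_outerPos, if_neg (ne _ _ _ _).symm, Finset.sum_eq_zero]
    exact fun j' _ => if_neg (ne _ _ _ _)

end

theorem permMat_one (n : ℕ) : permMat k (1 : Equiv.Perm (Fin n)) = 1 := by
  ext a x
  simp [permMat, Matrix.one_apply, eq_comm]

theorem permMat_mul {n : ℕ} (σ τ : Equiv.Perm (Fin n)) :
    permMat k (σ * τ) = permMat k σ * permMat k τ := by
  ext a x
  rw [mul_permMat]
  rfl

theorem collapse_unit {n : ℕ} (i : Fin n) : collapse k (rfl : n + 1 = n + 1) i = 1 := by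
  ext a x
  simp only [collapse, Matrix.of_apply, Matrix.one_apply, Fin.ext_iff, block_val]
  congr 1
  apply propext
  split_ifs <;> omega

theorem restrict_unit (n : ℕ) : restrict k (Nat.add_comm 1 n) (0 : Fin 1) = 1 := by
  ext a x
  simp [restrict, Matrix.one_apply, Fin.ext_iff, innerPos]

/-- The composition `(μ ∘ᵢ ν)(W) = μ(W with the block summed up) ν(W restricted to the block)`.
One should think of `W` as the matrix of all pairings `⟨ξₐ, ξᵦ⟩` of `n` vectors, and of a function
of `W` as an `n`-linear operation on exponential functions, `e^ξ₁, …, e^ξₙ ↦ f(W) e^(ξ₁ + ⋯ + ξₙ)`.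
-/
instance : SymOperad k (Mat k) where
  one := fun _ => (1 : k)
  act σ :=
    { toFun := fun μ W => μ (conj (permMat k σ) W)
      map_add' := fun _ _ => rfl
      map_smul' := fun _ _ => rfl }
  comp {m n r} h i :=
    LinearMap.mk₂ k (fun (μ : Mat k m) (ν : Mat k n) => (fun W =>
        μ (conj (collapse k h i) W) * ν (conj (restrict k h i) W) : Mat k r))
      (fun _ _ _ => funext fun _ => add_mul _ _ _)
      (fun _ _ _ => funext fun _ => mul_assoc _ _ _)
      (fun _ _ _ => funext fun _ => mul_add _ _ _)
      (fun _ _ _ => funext fun _ => mul_left_comm _ _ _)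
  act_one μ := funext fun W => by
    change μ (conj (permMat k 1) W) = μ W
    rw [permMat_one, conj_one]
  act_mul σ τ μ := funext fun W => by
    change μ (conj (permMat k (σ * τ)) W) = μ (conj (permMat k σ) (conj (permMat k τ) W))
    rw [permMat_mul, conj_conj]
  comp_one i θ := funext fun W => by
    change θ (conj (collapse k _ i) W) * 1 = θ W
    rw [collapse_unit, conj_one, mul_one]
  one_comp θ := funext fun W => by
    change 1 * θ (conj (restrict k _ 0) W) = θ W
    rw [restrict_unit, conj_one, one_mul]
  assoc_inner hr ht hs ht' i j lam μ ν := funext fun W => by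
    change lam (conj (collapse k hr i) (conj (collapse k ht _) W))
        * μ (conj (restrict k hr i) (conj (collapse k ht _) W)) * ν (conj (restrict k ht _) W) =
      lam (conj (collapse k ht' i) W)
        * (μ (conj (collapse k hs j) (conj (restrict k ht' i) W))
          * ν (conj (restrict k hs j) (conj (restrict k ht' i) W)))
    rw [conj_conj, conj_conj, conj_conj, conj_conj, collapse_collapse_inner hr ht ht',
      restrict_collapse_inner hr ht hs ht', restrict_restrict hr ht hs ht', mul_assoc]
  assoc_outer hr ht hs ht' i p hip lam μ ν := funext fun W => by
    change lam (conj (collapse k hr i) (conj (collapse k ht _) W))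
        * μ (conj (restrict k hr i) (conj (collapse k ht _) W)) * ν (conj (restrict k ht _) W) =
      lam (conj (collapse k hs p) (conj (collapse k ht' _) W))
        * ν (conj (restrict k hs p) (conj (collapse k ht' _) W)) * μ (conj (restrict k ht' _) W)
    rw [conj_conj, conj_conj, conj_conj, conj_conj, collapse_collapse_outer hr ht hs ht' i p hip,
      restrict_collapse_outer hr ht hs ht' i p hip.ne',
      restrict_collapse_outer hs ht' hr ht p i hip.ne, mul_right_comm]
  comp_act h i σ μ ν := funext fun W => by
    change μ (conj (collapse k h i) W) * ν (conj (permMat k σ) (conj (restrict k h i) W)) =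
      μ (conj (collapse k h i) (conj (permMat k _) W))
        * ν (conj (restrict k h i) (conj (permMat k _) W))
    have e1 := collapse_permMat (k := k) h i 1 σ
    have e2 := restrict_permMat (k := k) h i 1 σ
    rw [Equiv.Perm.one_apply] at e1 e2
    rw [conj_conj, conj_conj, conj_conj, e1, e2, permMat_one, Matrix.one_mul]
  act_comp h i φ μ ν := funext fun W => by
    change μ (conj (permMat k φ) (conj (collapse k h i) W)) * ν (conj (restrict k h i) W) =
      μ (conj (collapse k h (φ i)) (conj (permMat k _) W))
        * ν (conj (restrict k h (φ i)) (conj (permMat k _) W))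
    rw [conj_conj, conj_conj, conj_conj, collapse_permMat, restrict_permMat, permMat_one,
      Matrix.one_mul]

namespace Mat

theorem comp_apply {m n r : ℕ} (h : m + n = r + 1) (i : Fin m) (μ : Mat k m) (ν : Mat k n)
    (W : Matrix (Fin r) (Fin r) k) : (comp (k := k) h i μ ν) W =
      μ (conj (collapse k h i) W) * ν (conj (restrict k h i) W) := rfl

theorem act_apply {n : ℕ} (σ : Equiv.Perm (Fin n)) (μ : Mat k n) (W : Matrix (Fin n) (Fin n) k) :
    (act (k := k) σ μ) W = μ (conj (permMat k σ) W) := rfl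

theorem add_apply {n : ℕ} (μ ν : Mat k n) (W : Matrix (Fin n) (Fin n) k) :
    (μ + ν) W = μ W + ν W := rfl

theorem sub_apply {n : ℕ} (μ ν : Mat k n) (W : Matrix (Fin n) (Fin n) k) :
    (μ - ν) W = μ W - ν W := rfl

theorem neg_apply {n : ℕ} (μ : Mat k n) (W : Matrix (Fin n) (Fin n) k) :
    (-μ) W = -μ W := rfl

theorem smul_apply {n : ℕ} (a : k) (μ : Mat k n) (W : Matrix (Fin n) (Fin n) k) :
    (a • μ) W = a * μ W := rfl

theorem zero_apply {n : ℕ} (W : Matrix (Fin n) (Fin n) k) : (0 : Mat k n) W = 0 := rfl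

end Mat

theorem conj_apply {m n : ℕ} (A : Matrix (Fin m) (Fin n) k) (W : Matrix (Fin n) (Fin n) k)
    (a b : Fin m) : conj A W a b = ∑ x, ∑ y, A a x * W x y * A b y := by
  simp only [conj, Matrix.mul_apply, Matrix.transpose_apply, Finset.sum_mul]
  rw [Finset.sum_comm]

theorem conj_restrict_apply {m n r : ℕ} (h : m + n = r + 1) (i : Fin m)
    (W : Matrix (Fin r) (Fin r) k) (a b : Fin n) :
    conj (restrict k h i) W a b = W (innerPos h i a) (innerPos h i b) := by
  simp [conj_apply, restrict]

theorem conj_permMat_apply {n : ℕ} (σ : Equiv.Perm (Fin n)) (W : Matrix (Fin n) (Fin n) k)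
    (a b : Fin n) : conj (permMat k σ) W a b = W (σ.symm a) (σ.symm b) := by
  simp [conj_apply, permMat, ← Equiv.eq_symm_apply]

theorem conj_collapse_apply {m n r : ℕ} (h : m + n = r + 1) (i : Fin m)
    (W : Matrix (Fin r) (Fin r) k) (a b : Fin m) :
    conj (collapse k h i) W a b =
      ∑ x, ∑ y, if block h i x = a ∧ block h i y = b then W x y else 0 := by
  rw [conj_apply]
  refine Finset.sum_congr rfl fun x _ => Finset.sum_congr rfl fun y _ => ?_
  simp only [collapse, Matrix.of_apply]
  split_ifs <;> simp_all

variable (k) in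
/-- The antisymmetric pairing `W₀₁ - W₁₀`, the value of the bracket. -/
def pairing : Mat k 2 := fun W => W 0 1 - W 1 0

end Mat

/-! ### Operads generated by constants and binary operations -/

section Tree

variable {k : Type u} [CommRing k] {P : ℕ → Type v}
  [∀ n, AddCommGroup (P n)] [∀ n, Module k (P n)] [SymOperad k P]

variable (k) in
/-- The operation `θ(μ, ν)` obtained by plugging `μ` and `ν` into a binary operation `θ`. -/
def plug {p q r : ℕ} (h : p + q = r) (θ : P 2) (μ : P p) (ν : P q) : P r :=
  comp (k := k) (by omega : (q + 1) + p = r + 1) 0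
    (comp (k := k) (by omega : 2 + q = (q + 1) + 1) 1 θ ν) μ

theorem plug_comp_left {p q n s r r' : ℕ} (h' : p + q = r') (θ : P 2) (μ : P p) (ν : P q) (x : P n)
    (h : r' + n = r + 1) (hs : p + n = s + 1) (i : Fin r') (j : Fin p)
    (hij : i.1 = j.1) (hr : s + q = r) :
    comp (k := k) h i (plug k h' θ μ ν) x = plug k hr θ (comp (k := k) hs j μ x) ν := by
  have a := assoc_inner (k := k) (by omega : (q + 1) + p = r' + 1) h hs
    (by omega : (q + 1) + s = r + 1) 0 j
    (comp (k := k) (by omega : 2 + q = (q + 1) + 1) 1 θ ν) μ x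
  have hpos : innerPos (by omega : (q + 1) + p = r' + 1) (0 : Fin (q + 1)) j = i := by
    simp [innerPos, Fin.ext_iff, hij]
  rw [hpos] at a
  exact a

theorem plug_comp_right {p q n s r r' : ℕ} (h' : p + q = r') (θ : P 2) (μ : P p) (ν : P q)
    (x : P n) (h : r' + n = r + 1) (hs : q + n = s + 1) (i : Fin r') (j : Fin q)
    (hij : i.1 = p + j.1) (hr : p + s = r) :
    comp (k := k) h i (plug k h' θ μ ν) x = plug k hr θ μ (comp (k := k) hs j ν x) := by
  have a1 := assoc_outer (k := k) (by omega : (q + 1) + p = r' + 1) h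
    (by omega : (q + 1) + n = (s + 1) + 1) (by omega : (s + 1) + p = r + 1) 0 j.succ
    (Fin.succ_pos j) (comp (k := k) (by omega : 2 + q = (q + 1) + 1) 1 θ ν) μ x
  have a2 := assoc_inner (k := k) (by omega : 2 + q = (q + 1) + 1)
    (by omega : (q + 1) + n = (s + 1) + 1) hs (by omega : 2 + s = (s + 1) + 1) 1 j θ ν x
  have hpos : outerPos (by omega : (q + 1) + p = r' + 1) (0 : Fin (q + 1)) j.succ
      (Fin.succ_pos j).ne' = i := by
    simp [outerPos, Fin.ext_iff, hij]
    omega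
  have hpos' : innerPos (by omega : 2 + q = (q + 1) + 1) (1 : Fin 2) j = j.succ := by
    simp [innerPos, Fin.ext_iff]
    omega
  rw [hpos'] at a2
  rw [hpos, a2] at a1
  exact a1

theorem plug_one_one (θ : P 2) : plug k rfl θ (one (k := k)) (one (k := k)) = θ :=
  (comp_one (k := k) 0 _).trans (comp_one (k := k) 1 θ)

end Tree

namespace Presented

variable {k : Type u} [CommRing k] {G : ℕ → Type}
  {R : (n : ℕ) → Expr k G n → Expr k G n → Prop}

/-- The class of a generator. -/
def gen (k : Type u) [CommRing k] {G : ℕ → Type} (R : (n : ℕ) → Expr k G n → Expr k G n → Prop)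
    {n : ℕ} (g : G n) : Presented k G R n := mk k G R (.gen g)

/-- The elements obtained from the constants and the identity by plugging into binary generators, by
permuting slots and by linear combination. -/
inductive IsTree : (n : ℕ) → Presented k G R n → Prop
  | const (g : G 0) : IsTree 0 (gen k R g)
  | one : IsTree 1 (SymOperad.one (k := k))
  | act {n : ℕ} (σ : Equiv.Perm (Fin n)) (x : Presented k G R n) :
      IsTree n x → IsTree n (SymOperad.act (k := k) σ x)
  | plug {p q : ℕ} (g : G 2) (x : Presented k G R p) (y : Presented k G R q) :
      IsTree p x → IsTree q y → IsTree (p + q) (plug k rfl (gen k R g) x y)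
  | zero (n : ℕ) : IsTree n 0
  | add {n : ℕ} (x y : Presented k G R n) : IsTree n x → IsTree n y → IsTree n (x + y)
  | smul {n : ℕ} (a : k) (x : Presented k G R n) : IsTree n x → IsTree n (a • x)

theorem IsTree.comp {m : ℕ} {x : Presented k G R m} (hx : IsTree m x) {n : ℕ}
    {y : Presented k G R n} (hy : IsTree n y) {r : ℕ} (h : m + n = r + 1) (i : Fin m) :
    IsTree r (SymOperad.comp (k := k) h i x y) := by
  induction hx generalizing r with
  | const g => exact i.elim0
  | one =>
    obtain rfl : r = n := by omega
    rw [Subsingleton.elim i 0, SymOperad.one_comp]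
    exact hy
  | act σ x _ ih =>
    rw [SymOperad.act_comp]
    exact .act _ _ (ih h (σ i))
  | @plug p q g x z hx hz ihx ihz =>
    by_cases hi : i.1 < p
    · obtain ⟨s, hs⟩ : ∃ s, p + n = s + 1 := ⟨p + n - 1, by omega⟩
      obtain rfl : r = s + q := by omega
      rw [plug_comp_left _ _ x z y h hs i ⟨i.1, hi⟩ rfl rfl]
      exact .plug g _ _ (ihx hs _) hz
    · obtain ⟨s, hs⟩ : ∃ s, q + n = s + 1 := ⟨q + n - 1, by omega⟩
      obtain rfl : r = p + s := by omega
      rw [plug_comp_right _ _ x z y h hs i ⟨i.1 - p, by omega⟩ (by simp only; omega) rfl]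
      exact .plug g _ _ hx (ihz hs _)
  | zero n => rw [map_zero, LinearMap.zero_apply]; exact .zero _
  | add x z _ _ ihx ihz =>
    rw [map_add, LinearMap.add_apply]
    exact .add _ _ (ihx h i) (ihz h i)
  | smul a x _ ih =>
    rw [map_smul, LinearMap.smul_apply]
    exact .smul a _ (ih h i)

/-- In an operad generated by constants and binary operations every element is a tree. -/
theorem isTree (hG : ∀ {n : ℕ}, G n → n = 0 ∨ n = 2) {n : ℕ} (x : Presented k G R n) :
    IsTree n x := by
  induction x using ind with
  | h x =>
    induction x with
    | gen g =>
      rcases hG g with rfl | rfl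
      · exact .const g
      · have := IsTree.plug (k := k) (R := R) g _ _ .one .one
        rwa [plug_one_one] at this
    | one => exact .one
    | act σ x ih => exact .act σ _ ih
    | comp h i x y ihx ihy => exact ihx.comp ihy h i
    | zero => exact .zero _
    | add x y ihx ihy => exact .add _ _ ihx ihy
    | smul a x ih => exact .smul a _ ih

end Presented

/-! ### The Lie operad -/

section SkewBracket

variable {k : Type u} [CommRing k] {P : ℕ → Type v}
  [∀ n, AddCommGroup (P n)] [∀ n, Module k (P n)] [SymOperad k P]

variable (k) in
/-- The Jacobiator `[x₁, [x₂, x₃]] - [[x₁, x₂], x₃] - [x₂, [x₁, x₃]]` of a binary operation. -/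
def jacobiator (b : P 2) : P 3 :=
  comp (k := k) (r := 3) (rfl : 2 + 2 = 3 + 1) 1 b b
    - comp (k := k) (r := 3) (rfl : 2 + 2 = 3 + 1) 0 b b
    - act (k := k) (Equiv.swap 0 1) (comp (k := k) (r := 3) (rfl : 2 + 2 = 3 + 1) 1 b b)

theorem comp_zero_act_swap (θ θ' : P 2) :
    comp (k := k) (r := 3) (rfl : 2 + 2 = 3 + 1) 0 (act (k := k) (Equiv.swap 0 1) θ) θ' =
      act (k := k) (Equiv.swap 0 1 * Equiv.swap 1 2)
        (comp (k := k) (r := 3) (rfl : 2 + 2 = 3 + 1) 1 θ θ') := by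
  have e := act_comp (k := k) (r := 3) (rfl : 2 + 2 = 3 + 1) 0 (Equiv.swap 0 1) θ θ'
  have hp : permComp (r := 3) (rfl : 2 + 2 = 3 + 1) 0 (Equiv.swap (0 : Fin 2) 1)
    (1 : Equiv.Perm (Fin 2)) = Equiv.swap 0 1 * Equiv.swap 1 2 := by decide
  rw [hp, Equiv.swap_apply_left] at e
  exact e

variable {b : P 2} (hb : act (k := k) (Equiv.swap 0 1) b = -b)
include hb

theorem act_swap01_inner (θ : P 2) : act (k := k) (Equiv.swap 0 1)
    (comp (k := k) (r := 3) (rfl : 2 + 2 = 3 + 1) 0 θ b) =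
      -comp (k := k) (r := 3) (rfl : 2 + 2 = 3 + 1) 0 θ b := by
  have e := comp_act (k := k) (r := 3) (rfl : 2 + 2 = 3 + 1) 0 (Equiv.swap 0 1) θ b
  have hp : permComp (r := 3) (rfl : 2 + 2 = 3 + 1) 0 (1 : Equiv.Perm (Fin 2))
    (Equiv.swap (0 : Fin 2) 1) = Equiv.swap 0 1 := by decide
  rw [hb, hp, map_neg] at e
  exact e.symm

theorem act_swap12_inner (θ : P 2) : act (k := k) (Equiv.swap 1 2)
    (comp (k := k) (r := 3) (rfl : 2 + 2 = 3 + 1) 1 θ b) =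
      -comp (k := k) (r := 3) (rfl : 2 + 2 = 3 + 1) 1 θ b := by
  have e := comp_act (k := k) (r := 3) (rfl : 2 + 2 = 3 + 1) 1 (Equiv.swap 0 1) θ b
  have hp : permComp (r := 3) (rfl : 2 + 2 = 3 + 1) 1 (1 : Equiv.Perm (Fin 2))
    (Equiv.swap (0 : Fin 2) 1) = Equiv.swap 1 2 := by decide
  rw [hb, hp, map_neg] at e
  exact e.symm

theorem act_rotate_outer (θ : P 2) : act (k := k) (Equiv.swap 0 1 * Equiv.swap 1 2)
    (comp (k := k) (r := 3) (rfl : 2 + 2 = 3 + 1) 1 b θ) =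
      -comp (k := k) (r := 3) (rfl : 2 + 2 = 3 + 1) 0 b θ := by
  rw [← comp_zero_act_swap, hb, map_neg, LinearMap.neg_apply]

theorem act_swap12_outer (θ : P 2) : act (k := k) (Equiv.swap 1 2)
    (comp (k := k) (r := 3) (rfl : 2 + 2 = 3 + 1) 0 b θ) =
      -act (k := k) (Equiv.swap 0 1) (comp (k := k) (r := 3) (rfl : 2 + 2 = 3 + 1) 1 b θ) := by
  rw [← neg_eq_iff_eq_neg.2 (act_rotate_outer hb θ), map_neg, ← act_mul, mul_assoc,
    Equiv.swap_mul_self, mul_one]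

theorem act_swap01_jacobiator :
    act (k := k) (Equiv.swap 0 1) (jacobiator k b) = -jacobiator k b := by
  simp only [jacobiator, map_sub, act_swap01_inner hb, ← act_mul, Equiv.swap_mul_self, act_one]
  abel

theorem act_swap12_jacobiator :
    act (k := k) (Equiv.swap 1 2) (jacobiator k b) = -jacobiator k b := by
  simp only [jacobiator, map_sub, act_swap12_inner hb, act_swap12_outer hb]
  rw [← act_mul, act_rotate_outer hb]
  abel

end SkewBracket

section MatBracket

variable {k : Type u} [CommRing k]

theorem Mat.act_swap_pairing : act (k := k) (Equiv.swap 0 1) (pairing k) = -pairing k := by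
  funext W
  rw [Mat.act_apply, Mat.neg_apply]
  simp only [pairing, conj_permMat_apply, Equiv.symm_swap, Equiv.swap_apply_left,
    Equiv.swap_apply_right]
  ring

theorem pairing_collapse_zero (W : Matrix (Fin 3) (Fin 3) k) :
    pairing k (conj (collapse k (rfl : 2 + 2 = 3 + 1) 0) W) =
      (W 0 2 - W 2 0) + (W 1 2 - W 2 1) := by
  have hb : block (r := 3) (rfl : 2 + 2 = 3 + 1) (0 : Fin 2) = ![0, 0, 1] := by decide
  simp [pairing, conj_collapse_apply, Fin.sum_univ_three, hb]
  ring

theorem pairing_collapse_one (W : Matrix (Fin 3) (Fin 3) k) :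
    pairing k (conj (collapse k (rfl : 2 + 2 = 3 + 1) 1) W) =
      (W 0 1 - W 1 0) + (W 0 2 - W 2 0) := by
  have hb : block (r := 3) (rfl : 2 + 2 = 3 + 1) (1 : Fin 2) = ![0, 1, 1] := by decide
  simp [pairing, conj_collapse_apply, Fin.sum_univ_three, hb]
  ring

theorem pairing_restrict_zero (W : Matrix (Fin 3) (Fin 3) k) :
    pairing k (conj (restrict k (rfl : 2 + 2 = 3 + 1) 0) W) = W 0 1 - W 1 0 := by
  simp only [pairing, conj_restrict_apply]; rfl

theorem pairing_restrict_one (W : Matrix (Fin 3) (Fin 3) k) :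
    pairing k (conj (restrict k (rfl : 2 + 2 = 3 + 1) 1) W) = W 1 2 - W 2 1 := by
  simp only [pairing, conj_restrict_apply]; rfl

theorem Mat.jacobiator_pairing : jacobiator k (pairing k) = 0 := by
  funext W
  simp only [jacobiator, Mat.sub_apply, Mat.act_apply, Mat.comp_apply]
  rw [pairing_collapse_one, pairing_collapse_one, pairing_collapse_zero, pairing_restrict_zero,
    pairing_restrict_one, pairing_restrict_one]
  simp only [conj_permMat_apply, Equiv.symm_swap, Mat.zero_apply]
  have e0 : Equiv.swap (0 : Fin 3) 1 0 = 1 := by decide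
  have e1 : Equiv.swap (0 : Fin 3) 1 1 = 0 := by decide
  have e2 : Equiv.swap (0 : Fin 3) 1 2 = 2 := by decide
  rw [e0, e1, e2]
  ring

end MatBracket

namespace Lie

variable (k : Type u) [CommRing k]

/-- The bracket of the Lie operad. -/
def b : Lie k 2 := Presented.gen k (LieRel k) .bracket

variable {k}

theorem act_b : act (k := k) (Equiv.swap 0 1) (b k) = -b k :=
  (Presented.sound (.rel .antisymm)).trans (neg_one_smul k (b k))

theorem jacobiator_b : jacobiator k (b k) = 0 := by
  have h : comp (k := k) (r := 3) (rfl : 2 + 2 = 3 + 1) 1 (b k) (b k) =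
      comp (k := k) (r := 3) (rfl : 2 + 2 = 3 + 1) 0 (b k) (b k) + act (k := k) (Equiv.swap 0 1)
        (comp (k := k) (r := 3) (rfl : 2 + 2 = 3 + 1) 1 (b k) (b k)) :=
    Presented.sound (.rel .jacobi)
  rw [jacobiator, sub_sub, sub_eq_zero]
  exact h

/-- The elements of `Lie n` that are visibly there for `n ≤ 3`: none in arity `0`, multiples of the
identity in arity `1`, of `𝔟` in arity `2`, and combinations of two double brackets in arity `3`. -/
def lowArity (k : Type u) [CommRing k] : (n : ℕ) → Submodule k (Lie k n)
  | 0 => ⊥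
  | 1 => Submodule.span k {one (k := k)}
  | 2 => Submodule.span k {b k}
  | 3 => Submodule.span k {comp (k := k) (r := 3) (rfl : 2 + 2 = 3 + 1) 0 (b k) (b k),
      comp (k := k) (r := 3) (rfl : 2 + 2 = 3 + 1) 1 (b k) (b k)}
  | _ + 4 => ⊤

theorem act_lowArity {n : ℕ} (σ : Equiv.Perm (Fin n)) (x : Lie k n) (hx : x ∈ lowArity k n) :
    act (k := k) σ x ∈ lowArity k n := by
  have hclosure : ∀ {n : ℕ} (σ : Equiv.Perm (Fin (n + 1))) (S : Submodule k (Lie k (n + 1))),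
      (∀ i : Fin n, ∀ x ∈ S, act (k := k) (Equiv.swap i.castSucc i.succ) x ∈ S) →
      ∀ x ∈ S, act (k := k) σ x ∈ S := by
    intro n σ S hS
    have hσ : σ ∈ Submonoid.closure
        (Set.range fun i : Fin n => Equiv.swap i.castSucc i.succ) := by
      rw [Equiv.Perm.mclosure_swap_castSucc_succ]; trivial
    induction hσ using Submonoid.closure_induction with
    | mem y hy =>
      obtain ⟨i, rfl⟩ := hy
      exact hS i
    | one => intro x hx; rwa [act_one]
    | mul σ τ _ _ hσ hτ => intro x hx; rw [act_mul]; exact hτ _ (hσ _ hx)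
  match n, σ, x, hx with
  | 0, σ, x, hx => rw [Subsingleton.elim σ 1, act_one]; exact hx
  | 1, σ, x, hx => rw [Subsingleton.elim σ 1, act_one]; exact hx
  | 2, σ, x, hx =>
    refine hclosure σ _ (fun i y hy => ?_) x hx
    obtain ⟨a, rfl⟩ := Submodule.mem_span_singleton.1 hy
    obtain rfl := Subsingleton.elim i 0
    refine Submodule.mem_span_singleton.2 ⟨-a, ?_⟩
    rw [map_smul, neg_smul, ← smul_neg, ← act_b]
    rfl
  | 3, σ, x, hx =>
    refine hclosure σ _ (fun i y hy => ?_) x hx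
    obtain ⟨α, β, rfl⟩ := Submodule.mem_span_pair.1 hy
    have hJ := jacobiator_b (k := k)
    rw [jacobiator, sub_eq_zero] at hJ
    refine Submodule.mem_span_pair.2 ?_
    fin_cases i
    · refine ⟨-α - β, β, ?_⟩
      change _ = act (k := k) (Equiv.swap 0 1) _
      rw [map_add, map_smul, map_smul, ← hJ, act_swap01_inner act_b]
      module
    · refine ⟨α, -α - β, ?_⟩
      change _ = act (k := k) (Equiv.swap 1 2) _
      rw [map_add, map_smul, map_smul, act_swap12_inner act_b, act_swap12_outer act_b, ← hJ]
      module
  | n + 4, σ, x, hx => trivial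

theorem mem_lowArity {n : ℕ} (x : Lie k n) : x ∈ lowArity k n := by
  have h := Presented.isTree (fun {n} (g : LieGen n) => by cases g; exact Or.inr rfl) x
  induction h with
  | const g => cases g
  | one => exact Submodule.mem_span_singleton_self _
  | act σ x _ ih => exact act_lowArity σ x ih
  | @plug p q g x y _ _ ihx ihy =>
    cases g
    change plug k rfl (b k) x y ∈ _
    match p, q, x, y, ihx, ihy with
    | 0, q, x, y, ihx, _ =>
      rw [(Submodule.mem_bot k).1 ihx, plug, map_zero]
      exact zero_mem _
    | p + 1, 0, x, y, _, ihy =>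
      rw [(Submodule.mem_bot k).1 ihy, plug, map_zero, map_zero, LinearMap.zero_apply]
      exact zero_mem _
    | 1, 1, x, y, ihx, ihy =>
      obtain ⟨α, rfl⟩ := Submodule.mem_span_singleton.1 ihx
      obtain ⟨β, rfl⟩ := Submodule.mem_span_singleton.1 ihy
      have e : plug k rfl (b k) (α • one (k := k)) (β • one (k := k)) = (α * β) • b k := by
        conv_rhs => rw [← plug_one_one (k := k) (b k)]
        simp only [plug, map_smul, LinearMap.smul_apply, smul_smul]
      rw [e]
      exact Submodule.smul_mem _ _ (Submodule.mem_span_singleton_self _)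
    | 1, 2, x, y, ihx, ihy =>
      obtain ⟨α, rfl⟩ := Submodule.mem_span_singleton.1 ihx
      obtain ⟨β, rfl⟩ := Submodule.mem_span_singleton.1 ihy
      have e : plug k rfl (b k) (α • one (k := k)) (β • b k) =
          (α * β) • comp (k := k) (r := 3) (rfl : 2 + 2 = 3 + 1) 1 (b k) (b k) := by
        simp only [plug, map_smul, LinearMap.smul_apply, smul_smul]
        exact congrArg _ (comp_one (k := k) 0 _)
      rw [e]
      exact Submodule.smul_mem _ _ (Submodule.subset_span (by simp))
    | 2, 1, x, y, ihx, ihy =>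
      obtain ⟨α, rfl⟩ := Submodule.mem_span_singleton.1 ihx
      obtain ⟨β, rfl⟩ := Submodule.mem_span_singleton.1 ihy
      have e : plug k rfl (b k) (α • b k) (β • one (k := k)) =
          (α * β) • comp (k := k) (r := 3) (rfl : 2 + 2 = 3 + 1) 0 (b k) (b k) := by
        simp only [plug, map_smul, LinearMap.smul_apply, smul_smul]
        exact congrArg (fun z => (α * β) • comp (k := k) (r := 3) (rfl : 2 + 2 = 3 + 1) 0 z (b k))
          (comp_one (k := k) 1 _)
      rw [e]
      exact Submodule.smul_mem _ _ (Submodule.subset_span (by simp))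
    | p + 2, q + 2, x, y, _, _ =>
      obtain ⟨t, ht⟩ : ∃ t, p + 2 + (q + 2) = t + 4 := ⟨p + q, by omega⟩
      have : ∀ {s : ℕ} (z : Lie k s), s = t + 4 → z ∈ lowArity k s := by
        rintro s z rfl; trivial
      exact this _ ht
    | 1, q + 3, x, y, _, _ =>
      obtain ⟨t, ht⟩ : ∃ t, 1 + (q + 3) = t + 4 := ⟨q, by omega⟩
      have : ∀ {s : ℕ} (z : Lie k s), s = t + 4 → z ∈ lowArity k s := by
        rintro s z rfl; trivial
      exact this _ ht
    | p + 3, 1, x, y, _, _ => trivial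
  | zero n => exact zero_mem _
  | add x y _ _ hx hy => exact add_mem hx hy
  | smul a x _ ih => exact Submodule.smul_mem _ a ih

/-- The interpretation of the bracket as the antisymmetric pairing. -/
def matGen (k : Type u) [CommRing k] : {n : ℕ} → LieGen n → Mat k n
  | _, .bracket => pairing k

theorem matGen_rel {n : ℕ} (x y : Expr k LieGen n) (h : LieRel k n x y) :
    x.eval (matGen k) = y.eval (matGen k) := by
  cases h with
  | antisymm => exact Mat.act_swap_pairing.trans (neg_one_smul k _).symm
  | jacobi =>
    have h := Mat.jacobiator_pairing (k := k)
    rw [jacobiator, sub_sub, sub_eq_zero] at h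
    exact h

/-- The operad map from `Lie` to functions on matrices. -/
def toMat (k : Type u) [CommRing k] (n : ℕ) : Lie k n →ₗ[k] Mat k n :=
  Presented.lift (matGen k) matGen_rel n

/-- A skew-symmetric lift of the bracket to an extension satisfies the Jacobi identity, because its
Jacobiator changes sign under transpositions and no nonzero element of `Lie 3` does so. -/
theorem mem_B2star_of_skew_lift (c : Z2star k (Lie k)) (b' : Ext c 2) (hfst : Ext.fst b' = b k)
    (hskew : act (k := k) (Equiv.swap 0 1) b' = -b') : c.1 ∈ B2star k (Lie k) := by
  have hz : jacobiator k b' = Ext.eps (Ext.snd (jacobiator k b')) := by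
    refine Ext.eq_eps ?_
    rw [← jacobiator_b, jacobiator, jacobiator]
    simp [hfst]
  set z := Ext.snd (jacobiator k b')
  have h01 := act_swap01_jacobiator hskew
  have h12 := act_swap12_jacobiator hskew
  rw [hz, Ext.act_eps, ← map_neg] at h01 h12
  replace h01 := Ext.eps_injective h01
  replace h12 := Ext.eps_injective h12
  obtain ⟨α, β, hαβ⟩ := Submodule.mem_span_pair.1 (mem_lowArity z)
  have hJ := jacobiator_b (k := k)
  rw [jacobiator, sub_eq_zero] at hJ
  rw [← hαβ, map_add, map_smul, map_smul] at h01 h12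
  rw [act_swap01_inner act_b, ← hJ] at h01
  rw [act_swap12_inner act_b, act_swap12_outer act_b, ← hJ] at h12
  replace h01 := congrArg (toMat k 3) h01
  replace h12 := congrArg (toMat k 3) h12
  simp only [map_add, map_sub, map_neg, map_smul, toMat, Presented.lift_comp] at h01 h12
  change α • -comp (k := k) (r := 3) (rfl : 2 + 2 = 3 + 1) 0 (pairing k) (pairing k)
    + β • (comp (k := k) (r := 3) (rfl : 2 + 2 = 3 + 1) 1 (pairing k) (pairing k)
    - comp (k := k) (r := 3) (rfl : 2 + 2 = 3 + 1) 0 (pairing k) (pairing k)) =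
    -(α • comp (k := k) (r := 3) (rfl : 2 + 2 = 3 + 1) 0 (pairing k) (pairing k)
      + β • comp (k := k) (r := 3) (rfl : 2 + 2 = 3 + 1) 1 (pairing k) (pairing k)) at h01
  change α • -(comp (k := k) (r := 3) (rfl : 2 + 2 = 3 + 1) 1 (pairing k) (pairing k)
    - comp (k := k) (r := 3) (rfl : 2 + 2 = 3 + 1) 0 (pairing k) (pairing k))
    + β • -comp (k := k) (r := 3) (rfl : 2 + 2 = 3 + 1) 1 (pairing k) (pairing k) =
    -(α • comp (k := k) (r := 3) (rfl : 2 + 2 = 3 + 1) 0 (pairing k) (pairing k)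
      + β • comp (k := k) (r := 3) (rfl : 2 + 2 = 3 + 1) 1 (pairing k) (pairing k)) at h12
  have hβ : β = 0 := by
    have h := congrFun h01 !![0, 1, 1; 0, 0, 0; 0, 0, 0]
    simp only [Mat.add_apply, Mat.smul_apply, Mat.neg_apply, Mat.sub_apply, Mat.comp_apply,
      pairing_collapse_one, pairing_collapse_zero, pairing_restrict_one,
      pairing_restrict_zero] at h
    simpa using h
  have hα : α = 0 := by
    have h := congrFun h12 !![0, 0, 1; 0, 0, 1; 0, 0, 0]
    simp only [Mat.add_apply, Mat.smul_apply, Mat.neg_apply, Mat.sub_apply, Mat.comp_apply,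
      pairing_collapse_one, pairing_collapse_zero, pairing_restrict_one,
      pairing_restrict_zero] at h
    simpa using h
  have hz0 : jacobiator k b' = 0 := by
    rw [hz, ← hαβ, hα, hβ, zero_smul, zero_smul, add_zero, map_zero]
  let g : {n : ℕ} → LieGen n → Ext c n := fun a => match a with
    | .bracket => b'
  refine Presented.mem_B2star_of_lift c g (fun a => by cases a; exact hfst) (fun x y h => ?_)
  cases h with
  | antisymm => exact hskew.trans (neg_one_smul k _).symm
  | jacobi =>
    rw [jacobiator, sub_sub, sub_eq_zero] at hz0
    exact hz0

/-- If `ς = 0` the obvious lift of the bracket is skew-symmetric in every characteristic. -/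
theorem mem_B2star_of_equivariant (c : Z2star k (Lie k)) (hc : c.1 ∈ Z2 k (Lie k)) :
    c.1 ∈ B2star k (Lie k) := by
  refine mem_B2star_of_skew_lift c (Ext.mk c (b k) 0) rfl (Ext.hext act_b ?_)
  have hvs : c.1.vs (Equiv.swap (0 : Fin 2) 1) = 0 := hc.2 2 _
  rw [Ext.snd_act, hvs]
  simp

/-- Away from characteristic two a lift of the bracket can be antisymmetrised. -/
theorem mem_B2star {k : Type u} [Field k] (h2 : (2 : k) ≠ 0) (c : Z2star k (Lie k)) :
    c.1 ∈ B2star k (Lie k) := by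
  let b₀ : Ext c 2 := Ext.mk c (b k) 0
  refine mem_B2star_of_skew_lift c ((2 : k)⁻¹ • (b₀ - act (k := k) (Equiv.swap 0 1) b₀)) ?_ ?_
  · rw [map_smul, map_sub, Ext.fst_act]
    change (2 : k)⁻¹ • (b k - act (k := k) _ (b k)) = b k
    rw [act_b, sub_neg_eq_add, ← two_smul k (b k), inv_smul_smul₀ h2]
  · rw [map_smul, map_sub, ← act_mul, Equiv.swap_mul_self, act_one, ← smul_neg, neg_sub]

end Lie

/-! ### Permuting the slots of plugged operations -/

section PlugAct

variable {k : Type u} [CommRing k] {P : ℕ → Type v}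
  [∀ n, AddCommGroup (P n)] [∀ n, Module k (P n)] [SymOperad k P]

theorem plug_act_right {p q r : ℕ} (h : p + q = r) (θ : P 2) (μ : P p) (ν : P q)
    (σ : Equiv.Perm (Fin q)) : ∃ ρ : Equiv.Perm (Fin r),
      (∀ j : Fin q, ρ ⟨p + j.1, by omega⟩ = ⟨p + (σ j).1, by omega⟩) ∧
      plug k h θ μ (act (k := k) σ ν) = act (k := k) ρ (plug k h θ μ ν) := by
  have h2 : 2 + q = (q + 1) + 1 := by omega
  have h3 : (q + 1) + p = r + 1 := by omega
  set φ := permComp h2 1 1 σ with hφ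
  have hφ0 : φ 0 = 0 := by
    have e := permComp_outerPos h2 1 1 σ 0 Fin.zero_ne_one
    have h0 : outerPos h2 1 0 Fin.zero_ne_one = 0 := by simp [outerPos]
    rw [h0] at e
    exact e.trans h0
  have hφs : ∀ j : Fin q, φ j.succ = (σ j).succ := fun j => by
    have hpos : ∀ j : Fin q, innerPos h2 (1 : Fin 2) j = j.succ := fun j => by
      simp [innerPos, Fin.ext_iff]; omega
    have e := permComp_innerPos h2 1 1 σ j
    rw [Equiv.Perm.one_apply, hpos, hpos] at e
    exact e
  refine ⟨permComp h3 0 φ 1, fun j => ?_, ?_⟩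
  · have hpos : ∀ (j : Fin q), outerPos h3 0 j.succ (Fin.succ_ne_zero j) = ⟨p + j.1, by omega⟩ :=
      fun j => by simp [outerPos, Fin.ext_iff]; omega
    have e := permComp_outerPos h3 0 φ 1 j.succ (Fin.succ_ne_zero j)
    simp only [hφ0, hφs, hpos] at e
    exact e
  · rw [plug, comp_act, ← hφ, act_comp, hφ0]
    rfl

theorem plug_act_swap {p q r : ℕ} (h : p + q = r) (h' : q + p = r) (θ : P 2) (μ : P p) (ν : P q) :
    ∃ ρ : Equiv.Perm (Fin r), (∀ i : Fin p, ρ ⟨i.1, by omega⟩ = ⟨q + i.1, by omega⟩) ∧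
      (∀ j : Fin q, ρ ⟨p + j.1, by omega⟩ = ⟨j.1, by omega⟩) ∧
      plug k h (act (k := k) (Equiv.swap 0 1) θ) μ ν = act (k := k) ρ (plug k h' θ ν μ) := by
  have h2 : 2 + q = (q + 1) + 1 := by omega
  have h3 : (q + 1) + p = r + 1 := by omega
  set φ := permComp h2 1 (Equiv.swap 0 1) (1 : Equiv.Perm (Fin q)) with hφ
  have hφ0 : φ 0 = Fin.last q := by
    have e := permComp_outerPos h2 1 (Equiv.swap 0 1) (1 : Equiv.Perm (Fin q)) 0 Fin.zero_ne_one
    have h0 : outerPos h2 1 0 Fin.zero_ne_one = 0 := by simp [outerPos]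
    rw [h0] at e
    refine e.trans ?_
    simp [outerPos, Fin.ext_iff]
  have hφs : ∀ j : Fin q, φ j.succ = j.castSucc := fun j => by
    have hpos : innerPos h2 (1 : Fin 2) j = j.succ := by
      simp [innerPos, Fin.ext_iff]; omega
    have e := permComp_innerPos h2 1 (Equiv.swap 0 1) (1 : Equiv.Perm (Fin q)) j
    rw [hpos] at e
    refine e.trans ?_
    simp [innerPos, Fin.ext_iff]
  refine ⟨permComp h3 0 φ 1, fun i => ?_, fun j => ?_, ?_⟩
  · have e := permComp_innerPos h3 0 φ 1 i
    have hpos : innerPos h3 0 i = ⟨i.1, by omega⟩ := by simp [innerPos]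
    rw [hpos] at e
    refine e.trans ?_
    simp [innerPos, hφ0]
  · have hpos : outerPos h3 0 j.succ (Fin.succ_ne_zero j) = ⟨p + j.1, by omega⟩ := by
      simp [outerPos, Fin.ext_iff]; omega
    have e := permComp_outerPos h3 0 φ 1 j.succ (Fin.succ_ne_zero j)
    rw [hpos] at e
    refine e.trans ?_
    simp [outerPos, hφ0, hφs]
  · have hpos : (outerPos (by omega : 2 + p = (p + 1) + 1) (0 : Fin 2) 1 Fin.zero_ne_one.symm) =
        Fin.last p := by
      simp [outerPos, Fin.ext_iff]
    have a := assoc_outer (k := k) (by omega : 2 + q = (q + 1) + 1) h3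
      (by omega : 2 + p = (p + 1) + 1) (by omega : (p + 1) + q = r + 1) 0 1 Fin.zero_lt_one θ ν μ
    have e1 : outerPos h2 (0 : Fin 2) 1 Fin.zero_lt_one.ne' = Fin.last q := by
      simp [outerPos, Fin.ext_iff]
    have e2 : outerPos (by omega : 2 + p = (p + 1) + 1) (1 : Fin 2) 0 Fin.zero_lt_one.ne = 0 := by
      simp [outerPos]
    rw [e1, e2] at a
    rw [plug, act_comp, ← hφ, act_comp, hφ0, Equiv.swap_apply_right, a]
    rfl

variable (k) in
/-- The operation `θ(μ, ν, x)` obtained by plugging `μ` and `ν` into the first two slots of a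
ternary operation `θ`. -/
def plug₃ {p q r : ℕ} (h : p + q + 1 = r) (θ : P 3) (μ : P p) (ν : P q) : P r :=
  comp (k := k) (by omega : (q + 2) + p = r + 1) 0
    (comp (k := k) (by omega : 3 + q = (q + 2) + 1) 1 θ ν) μ

theorem plug₃_comp_one {p q r : ℕ} (h : p + q + 1 = r) (θ θ' : P 2) (μ : P p) (ν : P q) :
    plug₃ k h (comp (k := k) (rfl : 2 + 2 = 3 + 1) 1 θ θ') μ ν =
      plug k (by omega : p + (q + 1) = r) θ μ
        (comp (k := k) (by omega : 2 + q = (q + 1) + 1) 0 θ' ν) := by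
  have a : comp (k := k) (by omega : 3 + q = (q + 2) + 1) 1
      (comp (k := k) (rfl : 2 + 2 = 3 + 1) 1 θ θ') ν = _ :=
    assoc_inner (k := k) (rfl : 2 + 2 = 3 + 1) (by omega : 3 + q = (q + 2) + 1)
      (by omega : 2 + q = (q + 1) + 1) (by omega : 2 + (q + 1) = (q + 2) + 1) 1 0 θ θ' ν
  rw [plug₃, a]
  rfl

theorem plug₃_comp_zero {p q r s : ℕ} (h : p + q + 1 = r) (hs : p + q = s) (θ θ' : P 2) (μ : P p)
    (ν : P q) : plug₃ k h (comp (k := k) (rfl : 2 + 2 = 3 + 1) 0 θ θ') μ ν =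
      comp (k := k) (by omega : 2 + s = r + 1) 0 θ (plug k hs θ' μ ν) := by
  have a : comp (k := k) (by omega : 3 + q = (q + 2) + 1) 1
      (comp (k := k) (rfl : 2 + 2 = 3 + 1) 0 θ θ') ν = _ :=
    assoc_inner (k := k) (rfl : 2 + 2 = 3 + 1) (by omega : 3 + q = (q + 2) + 1)
      (by omega : 2 + q = (q + 1) + 1) (by omega : 2 + (q + 1) = (q + 2) + 1) 0 1 θ θ' ν
  have a2 := assoc_inner (k := k) (by omega : 2 + (q + 1) = (q + 2) + 1)
    (by omega : (q + 2) + p = r + 1) (by omega : (q + 1) + p = s + 1) (by omega : 2 + s = r + 1)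
    0 0 θ (comp (k := k) (by omega : 2 + q = (q + 1) + 1) 1 θ' ν) μ
  rw [plug₃, a]
  exact a2

theorem plug₃_add {p q r : ℕ} (h : p + q + 1 = r) (θ θ' : P 3) (μ : P p) (ν : P q) :
    plug₃ k h (θ + θ') μ ν = plug₃ k h θ μ ν + plug₃ k h θ' μ ν := by
  simp only [plug₃, map_add, LinearMap.add_apply]

theorem plug₃_sub {p q r : ℕ} (h : p + q + 1 = r) (θ θ' : P 3) (μ : P p) (ν : P q) :
    plug₃ k h (θ - θ') μ ν = plug₃ k h θ μ ν - plug₃ k h θ' μ ν := by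
  simp only [plug₃, map_sub, LinearMap.sub_apply]

theorem plug₃_act_swap {p q r : ℕ} (h : p + q + 1 = r) (h' : q + p + 1 = r) (θ : P 3) (μ : P p)
    (ν : P q) : ∃ ρ : Equiv.Perm (Fin r), ρ ⟨p + q, by omega⟩ = ⟨p + q, by omega⟩ ∧
      plug₃ k h (act (k := k) (Equiv.swap 0 1) θ) μ ν = act (k := k) ρ (plug₃ k h' θ ν μ) := by
  have h2 : 3 + q = (q + 2) + 1 := by omega
  have h3 : (q + 2) + p = r + 1 := by omega
  have h2' : 3 + p = (p + 2) + 1 := by omega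
  have h3' : (p + 2) + q = r + 1 := by omega
  set φ := permComp h2 1 (Equiv.swap 0 1) (1 : Equiv.Perm (Fin q)) with hφ
  have hφ0 : (φ 0).1 = q := by
    have e := permComp_outerPos h2 1 (Equiv.swap 0 1) (1 : Equiv.Perm (Fin q)) 0 (by decide)
    have h0 : outerPos h2 1 0 (by decide) = 0 := by simp [outerPos]
    rw [h0] at e
    rw [hφ, e]
    simp [outerPos]
  have hφ2 : φ (Fin.last (q + 1)) = Fin.last (q + 1) := by
    have e := permComp_outerPos h2 1 (Equiv.swap 0 1) (1 : Equiv.Perm (Fin q)) 2 (by decide)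
    have h0 : outerPos h2 1 2 (by decide) = Fin.last (q + 1) := by
      simp [outerPos, Fin.ext_iff]; omega
    have hs : Equiv.swap (0 : Fin 3) 1 2 = 2 := by decide
    rw [h0] at e
    rw [hφ, e]
    simp [outerPos, Fin.ext_iff, hs]
    omega
  have hne : Fin.last (q + 1) ≠ 0 := by simp [Fin.ext_iff]
  refine ⟨permComp h3 0 φ 1, ?_, ?_⟩
  · have hpos : outerPos h3 0 (Fin.last (q + 1)) hne = ⟨p + q, by omega⟩ := by
      simp [outerPos, Fin.ext_iff]; omega
    have e := permComp_outerPos h3 0 φ 1 (Fin.last (q + 1)) hne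
    rw [hpos] at e
    refine e.trans ?_
    simp only [outerPos, hφ2, hφ0, Fin.ext_iff, Fin.val_last]
    split_ifs <;> omega
  · have a := assoc_outer (k := k) h2 h3 h2' h3' 0 1 (by decide) θ ν μ
    have e1 : outerPos h2 (0 : Fin 3) 1 (by decide) = φ 0 := by
      rw [Fin.ext_iff, hφ0]
      simp [outerPos]
    have e2 : outerPos h2' (1 : Fin 3) 0 (by decide) = 0 := by
      simp [outerPos]
    rw [e1, e2] at a
    rw [plug₃, act_comp, ← hφ, act_comp, Equiv.swap_apply_right, a]
    rfl

end PlugAct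

/-! ### The Poisson operad: normal forms -/

namespace Pois

variable (k : Type u) [CommRing k]

/-- The unit of the Poisson operad. -/
def e : Pois k 0 := Presented.gen k (PoisRel k) .unit

/-- The commutative product of the Poisson operad. -/
def m : Pois k 2 := Presented.gen k (PoisRel k) .product

/-- The bracket of the Poisson operad. -/
def b : Pois k 2 := Presented.gen k (PoisRel k) .bracket

variable {k}

theorem m_unit_left : comp (k := k) (rfl : 2 + 0 = 1 + 1) 0 (m k) (e k) = one (k := k) :=
  Presented.sound (.rel .unit_left)

theorem m_unit_right : comp (k := k) (rfl : 2 + 0 = 1 + 1) 1 (m k) (e k) = one (k := k) :=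
  Presented.sound (.rel .unit_right)

theorem b_unit_left : comp (k := k) (rfl : 2 + 0 = 1 + 1) 0 (b k) (e k) = 0 :=
  Presented.sound (.rel .bracket_unit_left)

theorem b_unit_right : comp (k := k) (rfl : 2 + 0 = 1 + 1) 1 (b k) (e k) = 0 :=
  Presented.sound (.rel .bracket_unit_right)

theorem act_m : act (k := k) (Equiv.swap 0 1) (m k) = m k :=
  Presented.sound (.rel .comm)

theorem act_b : act (k := k) (Equiv.swap 0 1) (b k) = -b k :=
  (Presented.sound (.rel .antisymm)).trans (neg_one_smul k (b k))

theorem m_assoc : comp (k := k) (r := 3) (rfl : 2 + 2 = 3 + 1) 0 (m k) (m k) =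
    comp (k := k) (r := 3) (rfl : 2 + 2 = 3 + 1) 1 (m k) (m k) :=
  Presented.sound (.rel .assoc)

theorem leibniz : comp (k := k) (r := 3) (rfl : 2 + 2 = 3 + 1) 0 (b k) (m k) =
    comp (k := k) (r := 3) (rfl : 2 + 2 = 3 + 1) 1 (m k) (b k) + act (k := k) (Equiv.swap 0 1)
      (comp (k := k) (r := 3) (rfl : 2 + 2 = 3 + 1) 1 (m k) (b k)) :=
  Presented.sound (.rel .leibniz)

theorem jacobi : comp (k := k) (r := 3) (rfl : 2 + 2 = 3 + 1) 1 (b k) (b k) =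
    comp (k := k) (r := 3) (rfl : 2 + 2 = 3 + 1) 0 (b k) (b k) + act (k := k) (Equiv.swap 0 1)
      (comp (k := k) (r := 3) (rfl : 2 + 2 = 3 + 1) 1 (b k) (b k)) :=
  Presented.sound (.rel .jacobi)

/-- The Leibniz rule in the second argument, `[x₁, x₂x₃] = [x₁, x₂]x₃ + x₂[x₁, x₃]`. -/
theorem leibniz_right : comp (k := k) (r := 3) (rfl : 2 + 2 = 3 + 1) 1 (b k) (m k) =
    comp (k := k) (r := 3) (rfl : 2 + 2 = 3 + 1) 0 (m k) (b k) + act (k := k) (Equiv.swap 0 1)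
      (comp (k := k) (r := 3) (rfl : 2 + 2 = 3 + 1) 1 (m k) (b k)) := by
  have h1 := act_rotate_outer act_b (m k)
  have h2 := comp_zero_act_swap (k := k) (m k) (b k)
  rw [act_m] at h2
  have h3 := act_swap12_inner act_b (m k)
  rw [leibniz] at h1
  have h4 := congrArg (act (k := k) (Equiv.swap 1 2 * Equiv.swap 0 1)) h1
  have p1 : (Equiv.swap 0 1 * Equiv.swap 1 2 * (Equiv.swap 1 2 * Equiv.swap 0 1) :
    Equiv.Perm (Fin 3)) = 1 := by decide
  have p2 : (Equiv.swap 0 1 * (Equiv.swap 1 2 * Equiv.swap 0 1) :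
    Equiv.Perm (Fin 3)) = Equiv.swap 1 2 * (Equiv.swap 0 1 * Equiv.swap 1 2) := by decide
  rw [← act_mul, p1, act_one, map_neg, map_add, ← act_mul, p2, act_mul, act_mul, h3, map_neg,
    map_neg, ← h2] at h4
  rw [h4]
  abel

/-- The elements of `Pois n` in which the variable in the slot `t` appears either as a factor of the
whole or in a bracket with another variable. -/
def splitOff (k : Type u) [CommRing k] (n : ℕ) (t : Fin n) : Submodule k (Pois k n) :=
  Submodule.span k (
    {x | ∃ (q : ℕ) (h : 2 + q = n + 1) (p : Pois k q) (σ : Equiv.Perm (Fin n)),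
      (σ t).1 + 1 = n ∧ x = act (k := k) σ (comp (k := k) h 0 (m k) p)} ∪
    {x | ∃ (q : ℕ) (h : q + 2 = n + 1) (p : Pois k q) (j : Fin q) (σ : Equiv.Perm (Fin n)),
      j.1 + 1 = q ∧ (σ t).1 + 1 = n ∧ x = act (k := k) σ (comp (k := k) h j p (b k))})

theorem mul_mem_splitOff {n q : ℕ} (h : 2 + q = n + 1) (p : Pois k q) (t : Fin n)
    (ht : t.1 + 1 = n) : comp (k := k) h 0 (m k) p ∈ splitOff k n t :=
  Submodule.subset_span (Or.inl ⟨q, h, p, 1, ht, (act_one _).symm⟩)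

theorem bracket_mem_splitOff {n q : ℕ} (h : q + 2 = n + 1) (p : Pois k q) (j : Fin q)
    (hj : j.1 + 1 = q) (t : Fin n) (ht : t.1 + 1 = n) :
    comp (k := k) h j p (b k) ∈ splitOff k n t :=
  Submodule.subset_span (Or.inr ⟨q, h, p, j, 1, hj, ht, (act_one _).symm⟩)

theorem act_mem_splitOff {n : ℕ} (σ : Equiv.Perm (Fin n)) (t : Fin n) (x : Pois k n)
    (hx : x ∈ splitOff k n (σ t)) : act (k := k) σ x ∈ splitOff k n t := by
  change x ∈ (splitOff k n t).comap (act (k := k) σ)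
  refine Submodule.span_le.2 ?_ hx
  rintro _ (⟨q, h, p, τ, hτ, rfl⟩ | ⟨q, h, p, j, τ, hj, hτ, rfl⟩)
  · exact Submodule.subset_span (Or.inl ⟨q, h, p, τ * σ, hτ, (act_mul _ _ _).symm⟩)
  · exact Submodule.subset_span (Or.inr ⟨q, h, p, j, τ * σ, hj, hτ, (act_mul _ _ _).symm⟩)

/-- To plug elements with split-off variable into the second slot of `θ` it is enough to treat the
two kinds of generators. -/
theorem plug_mem_splitOff {p q r : ℕ} (h : p + q = r) (θ : Pois k 2) (μ : Pois k p)
    (h1 : ∀ (s : ℕ) (hs : 2 + s = q + 1) (y : Pois k s) (t : Fin r), t.1 + 1 = r →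
      plug k h θ μ (comp (k := k) hs 0 (m k) y) ∈ splitOff k r t)
    (ν : Pois k q) (j : Fin q) (hν : ν ∈ splitOff k q j) (t : Fin r) (ht : t.1 = p + j.1) :
    plug k h θ μ ν ∈ splitOff k r t := by
  have key : ∀ (σ : Equiv.Perm (Fin q)) (y : Pois k q), (σ j).1 + 1 = q →
      (∀ t : Fin r, t.1 + 1 = r → plug k h θ μ y ∈ splitOff k r t) →
      plug k h θ μ (act (k := k) σ y) ∈ splitOff k r t := by
    intro σ y hσ hy
    obtain ⟨ρ, hρ, e⟩ := plug_act_right (k := k) h θ μ y σ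
    rw [e]
    refine act_mem_splitOff ρ t _ (hy _ ?_)
    have : t = ⟨p + j.1, by omega⟩ := Fin.ext ht
    rw [this, hρ]
    simp only
    omega
  let L : Pois k q →ₗ[k] Pois k r :=
    { toFun := fun ν => plug k h θ μ ν
      map_add' := fun x y => by simp only [plug, map_add, LinearMap.add_apply]
      map_smul' := fun a x => by simp only [plug, map_smul, LinearMap.smul_apply,
        RingHom.id_apply] }
  change ν ∈ (splitOff k r t).comap L
  refine Submodule.span_le.2 ?_ hν
  rintro _ (⟨s, hs, y, σ, hσ, rfl⟩ | ⟨s, hs, y, i, σ, hi, hσ, rfl⟩)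
  · exact key σ _ hσ fun t ht => h1 s hs y t ht
  · refine key σ _ hσ fun t ht => ?_
    rw [← plug_comp_right (k := k) (rfl : p + s = p + s) θ μ y (b k)
      (by omega : (p + s) + 2 = r + 1) hs ⟨p + i.1, by omega⟩ i rfl h]
    exact bracket_mem_splitOff _ _ _ (by simp only; omega) t ht

theorem plug_m_mem_splitOff {p q r : ℕ} (h : p + q = r) (μ : Pois k p) (ν : Pois k q) (j : Fin q)
    (hν : ν ∈ splitOff k q j) (t : Fin r) (ht : t.1 = p + j.1) :
    plug k h (m k) μ ν ∈ splitOff k r t := by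
  refine plug_mem_splitOff h (m k) μ (fun s hs y t' ht' => ?_) ν j hν t ht
  obtain rfl : q = s + 1 := by omega
  have e := plug₃_comp_one (k := k) (by omega : p + s + 1 = r) (m k) (m k) μ y
  rw [← m_assoc, plug₃_comp_zero _ rfl] at e
  rw [← e]
  exact mul_mem_splitOff _ _ t' ht'

theorem plug_b_mem_splitOff {p q r : ℕ} (h : p + q = r) (μ : Pois k p)
    (hμ : ∀ (s : ℕ) (hs : 2 + p = s + 1) (t : Fin s), t.1 + 1 = s →
      comp (k := k) hs 0 (b k) μ ∈ splitOff k s t)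
    (ν : Pois k q) (j : Fin q) (hν : ν ∈ splitOff k q j) (t : Fin r) (ht : t.1 = p + j.1) :
    plug k h (b k) μ ν ∈ splitOff k r t := by
  refine plug_mem_splitOff h (b k) μ (fun s hs y t' ht' => ?_) ν j hν t ht
  obtain rfl : q = s + 1 := by omega
  have e := plug₃_comp_one (k := k) (by omega : p + s + 1 = r) (b k) (m k) μ y
  obtain ⟨ρ, hρ, e'⟩ := plug₃_act_swap (k := k) (by omega : p + s + 1 = r)
    (by omega : s + p + 1 = r)
    (comp (k := k) (r := 3) (rfl : 2 + 2 = 3 + 1) 1 (m k) (b k)) μ y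
  rw [leibniz_right, plug₃_add, plug₃_comp_zero _ rfl, e', plug₃_comp_one] at e
  rw [← e]
  refine add_mem (mul_mem_splitOff _ _ t' ht') (act_mem_splitOff _ _ _ ?_)
  have : t' = ⟨p + s, by omega⟩ := Fin.ext (by simp only; omega)
  rw [this, hρ]
  exact plug_m_mem_splitOff _ y _ (Fin.last p) (hμ _ _ _ rfl) _ (by simp; omega)

/-- The bracket with a new variable can be moved inside. -/
theorem bracket_new_mem_splitOff {p : ℕ} (μ : Pois k p) {s : ℕ} (hs : 2 + p = s + 1) (t : Fin s)
    (ht : t.1 + 1 = s) : comp (k := k) hs 0 (b k) μ ∈ splitOff k s t := by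
  have hμ := Presented.isTree (fun {n} (g : PoisGen n) => by cases g <;> simp) μ
  induction hμ generalizing s with
  | const g =>
    cases g
    obtain rfl : s = 1 := by omega
    have := b_unit_left (k := k)
    change comp (k := k) hs 0 (b k) (e k) ∈ _
    rw [this]
    exact zero_mem _
  | one =>
    obtain rfl : s = 2 := by omega
    rw [comp_one]
    have e := bracket_mem_splitOff (by omega : 1 + 2 = 2 + 1) (one (k := k) : Pois k 1) 0 rfl t ht
    rwa [one_comp] at e
  | @act n σ x _ ih =>
    rw [comp_act]
    refine act_mem_splitOff _ _ _ (ih hs _ ?_)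
    have hpos : outerPos hs 0 1 (by decide) = t := by
      simp [outerPos, Fin.ext_iff]; omega
    rw [← hpos, permComp_outerPos]
    simp [outerPos]
    omega
  | @plug p q g x y _ _ ihx ihy =>
    have hC : ∀ θ : Pois k 2, comp (k := k) hs 0 (b k) (plug k rfl θ x y) =
        plug₃ k (by omega) (comp (k := k) (r := 3) (rfl : 2 + 2 = 3 + 1) 0 (b k) θ) x y := fun θ =>
      (plug₃_comp_zero (by omega) rfl (b k) θ x y).symm
    have ht' : t = ⟨p + q, by omega⟩ := Fin.ext (by simp only; omega)
    cases g with
    | product =>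
      change comp (k := k) hs 0 (b k) (plug k rfl (m k) x y) ∈ _
      obtain ⟨ρ, hρ, e'⟩ := plug₃_act_swap (k := k) (by omega : p + q + 1 = s)
        (by omega : q + p + 1 = s)
        (comp (k := k) (r := 3) (rfl : 2 + 2 = 3 + 1) 1 (m k) (b k)) x y
      rw [hC, leibniz, plug₃_add, e', plug₃_comp_one, plug₃_comp_one]
      refine add_mem ?_ (act_mem_splitOff _ _ _ ?_)
      · exact plug_m_mem_splitOff _ x _ (Fin.last q) (ihy _ _ rfl) _ (by simp; omega)
      · rw [ht', hρ]
        exact plug_m_mem_splitOff _ y _ (Fin.last p) (ihx _ _ rfl) _ (by simp; omega)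
    | bracket =>
      change comp (k := k) hs 0 (b k) (plug k rfl (b k) x y) ∈ _
      obtain ⟨ρ, hρ, e'⟩ := plug₃_act_swap (k := k) (by omega : p + q + 1 = s)
        (by omega : q + p + 1 = s)
        (comp (k := k) (r := 3) (rfl : 2 + 2 = 3 + 1) 1 (b k) (b k)) x y
      rw [hC, ← sub_eq_of_eq_add jacobi, plug₃_sub, e', plug₃_comp_one, plug₃_comp_one]
      refine sub_mem ?_ (act_mem_splitOff _ _ _ ?_)
      · exact plug_b_mem_splitOff _ x (fun s hs t ht => ihx hs t ht) _ (Fin.last q)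
          (ihy _ _ rfl) _ (by simp; omega)
      · rw [ht', hρ]
        exact plug_b_mem_splitOff _ y (fun s hs t ht => ihy hs t ht) _ (Fin.last p)
          (ihx _ _ rfl) _ (by simp; omega)
  | zero n => rw [map_zero]; exact zero_mem _
  | add x y _ _ hx hy => rw [map_add]; exact add_mem (hx hs t ht) (hy hs t ht)
  | smul a x _ ih => rw [map_smul]; exact Submodule.smul_mem _ a (ih hs t ht)

/-- Every variable can be split off. -/
theorem mem_splitOff {n : ℕ} (x : Pois k n) (t : Fin n) : x ∈ splitOff k n t := by
  have hx := Presented.isTree (fun {n} (g : PoisGen n) => by cases g <;> simp) x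
  induction hx with
  | const g => exact t.elim0
  | one =>
    rw [← m_unit_left]
    exact mul_mem_splitOff _ _ t (by omega)
  | act σ x _ ih => exact act_mem_splitOff σ t _ (ih _)
  | @plug p q g x y _ _ ihx ihy =>
    have hright : ∀ {p q r : ℕ} (h : p + q = r) (x : Pois k p) (y : Pois k q) (j : Fin q)
        (t : Fin r), t.1 = p + j.1 → y ∈ splitOff k q j →
        plug k h (Presented.gen k (PoisRel k) g) x y ∈ splitOff k r t := by
      intro p q r h x y j t ht hy
      cases g with
      | product => exact plug_m_mem_splitOff h x y j hy t ht
      | bracket =>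
        exact plug_b_mem_splitOff h x (fun s hs t ht => bracket_new_mem_splitOff x hs t ht) y j hy
          t ht
    have hg : ∃ ε : k, Presented.gen k (PoisRel k) g = ε •
        act (k := k) (Equiv.swap 0 1) (Presented.gen k (PoisRel k) g) := by
      cases g with
      | product => exact ⟨1, by rw [one_smul]; exact act_m.symm⟩
      | bracket =>
        refine ⟨-1, ?_⟩
        rw [neg_one_smul, eq_neg_iff_add_eq_zero]
        change b k + act (k := k) _ (b k) = 0
        rw [act_b, add_neg_cancel]
    by_cases hi : t.1 < p
    · obtain ⟨ε, hε⟩ := hg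
      have hlin : ∀ θ : Pois k 2, plug k rfl (ε • θ) x y = ε • plug k rfl θ x y := fun θ => by
        simp only [plug, map_smul, LinearMap.smul_apply]
      obtain ⟨ρ, hρ, _, e⟩ := plug_act_swap (k := k) (rfl : p + q = p + q) (Nat.add_comm q p)
        (Presented.gen k (PoisRel k) g) x y
      rw [hε, hlin, e]
      refine Submodule.smul_mem _ _ (act_mem_splitOff ρ t _ ?_)
      refine hright _ y x ⟨t.1, hi⟩ _ ?_ (ihx _)
      have := hρ ⟨t.1, hi⟩
      exact congrArg Fin.val this
    · exact hright rfl x y ⟨t.1 - p, by omega⟩ t (by simp only; omega) (ihy _)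
  | zero n => exact zero_mem _
  | add x y _ _ hx hy => exact add_mem (hx t) (hy t)
  | smul a x _ ih => exact Submodule.smul_mem _ a (ih t)

end Pois

/-! ### The Poisson operad: faithful representation by functions on matrices -/

/-- A permutation that fixes the last slot comes from a permutation of the other slots. -/
theorem exists_perm_castSucc {n : ℕ} (σ : Equiv.Perm (Fin (n + 1)))
    (h : σ (Fin.last n) = Fin.last n) :
    ∃ φ : Equiv.Perm (Fin n), ∀ j, σ j.castSucc = (φ j).castSucc := by
  have h1 : ∀ j : Fin n, σ j.castSucc ≠ Fin.last n := fun j e =>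
    (Fin.castSucc_lt_last j).ne (σ.injective (e.trans h.symm))
  refine ⟨Equiv.ofBijective (fun j => (σ j.castSucc).castPred (h1 j))
    (Finite.injective_iff_bijective.1 fun i j e => ?_), fun j => by simp⟩
  exact Fin.castSucc_injective n (σ.injective (Fin.castPred_inj.1 e))

/-- The last slot of a nonempty list of slots, which contains `i`. -/
def lastSlot {n : ℕ} (i : Fin n) : Fin n := ⟨n - 1, Nat.sub_one_lt_of_lt i.2⟩

/-- The transposition that moves the slot `i` next to the last slot. -/
def nextToLast {n : ℕ} (i : Fin n) : Equiv.Perm (Fin (n + 1)) :=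
  Equiv.swap i.castSucc (lastSlot i).castSucc

theorem nextToLast_last {n : ℕ} (i : Fin n) : nextToLast i (Fin.last n) = Fin.last n := by
  refine Equiv.swap_apply_of_ne_of_ne (Fin.castSucc_lt_last i).ne' ?_
  exact (Fin.castSucc_lt_last _).ne'

namespace Pois

variable {k : Type u} [CommRing k]

/-- The linear map whose value at `(p, (pᵢ))` is `p(x₁, …, xₙ) xₙ₊₁ + ∑ pᵢ(x₁, …, [xᵢ, xₙ₊₁], …)`,
up to the order of the variables in the `pᵢ`. -/
def assemble (k : Type u) [CommRing k] (n : ℕ) :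
    (Pois k n × (Fin n → Pois k n)) →ₗ[k] Pois k (n + 1) :=
  (comp (k := k) (by omega : 2 + n = n + 1 + 1) 0 (m k)).coprod
    (LinearMap.lsum k (fun _ : Fin n => Pois k n) k fun i => act (k := k) (nextToLast i) ∘ₗ
      (comp (k := k) (rfl : n + 2 = n + 1 + 1) (lastSlot i)).flip (b k))

theorem assemble_apply {n : ℕ} (p : Pois k n) (q : Fin n → Pois k n) :
    assemble k n (p, q) = comp (k := k) (by omega : 2 + n = n + 1 + 1) 0 (m k) p +
      ∑ i, act (k := k) (nextToLast i)
        (comp (k := k) (rfl : n + 2 = n + 1 + 1) (lastSlot i) (q i) (b k)) := by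
  simp [assemble, LinearMap.lsum_apply]

theorem assemble_single {n : ℕ} (i : Fin n) (p : Pois k n) :
    assemble k n (0, Pi.single i p) = act (k := k) (nextToLast i)
        (comp (k := k) (rfl : n + 2 = n + 1 + 1) (lastSlot i) p (b k)) := by
  rw [assemble_apply, map_zero, zero_add, Finset.sum_eq_single i]
  · rw [Pi.single_eq_same]
  · intro j _ hj
    rw [Pi.single_eq_of_ne hj, map_zero, LinearMap.zero_apply, map_zero]
  · simp

/-- The normal form of the elements of the Poisson operad: the last variable is either a factor or
bracketed with one other variable. -/
theorem assemble_surjective (n : ℕ) : Function.Surjective (assemble k n) := by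
  rw [← LinearMap.range_eq_top, eq_top_iff]
  intro x _
  refine Submodule.span_le.2 ?_ (mem_splitOff x (Fin.last n))
  rintro _ (⟨q, h, p, σ, hσ, rfl⟩ | ⟨q, h, p, j, σ, hj, hσ, rfl⟩)
  · obtain rfl : q = n := by omega
    obtain ⟨φ, hφ⟩ := exists_perm_castSucc σ (Fin.ext (by simpa using hσ))
    have hinner : ∀ j : Fin q, innerPos h (0 : Fin 2) j = j.castSucc := fun j =>
      Fin.ext (Nat.zero_add _)
    have houter : outerPos h (0 : Fin 2) 1 (by decide) = Fin.last q := by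
      simp [outerPos, Fin.ext_iff]
    have hσ' : σ = permComp h 0 1 φ := by
      ext1 y
      rcases slot_cases h 0 y with ⟨j, rfl⟩ | ⟨j, hj, rfl⟩
      · rw [permComp_innerPos, Equiv.Perm.one_apply, hinner, hinner, hφ]
      · rw [permComp_outerPos]
        obtain rfl : j = 1 := by omega
        simp only [Equiv.Perm.one_apply]
        rw [houter]
        exact Fin.ext (by simpa using hσ)
    refine ⟨(act (k := k) φ p, 0), ?_⟩
    rw [assemble_apply, comp_act, ← hσ']
    simp
  · obtain rfl : q = n := by omega
    have hlast : σ (Fin.last q) = Fin.last q := Fin.ext (by simpa using hσ)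
    obtain ⟨i, hi⟩ : ∃ i : Fin q, σ i.castSucc = j.castSucc := by
      have h1 : σ.symm j.castSucc ≠ Fin.last q := fun e => by
        rw [Equiv.symm_apply_eq, hlast] at e
        exact (Fin.castSucc_lt_last j).ne e
      exact ⟨(σ.symm j.castSucc).castPred h1, by simp⟩
    have hji : lastSlot i = j := Fin.ext (by simp only [lastSlot]; omega)
    set ρ := σ * (nextToLast i)⁻¹ with hρ
    have hρ1 : ρ (Fin.last q) = Fin.last q := by
      rw [hρ, Equiv.Perm.mul_apply, Equiv.Perm.inv_eq_iff_eq.2 (nextToLast_last i).symm, hlast]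
    have hρ2 : ρ j.castSucc = j.castSucc := by
      have : nextToLast i i.castSucc = j.castSucc := by
        rw [← hji]; exact Equiv.swap_apply_left _ _
      rw [hρ, Equiv.Perm.mul_apply, Equiv.Perm.inv_eq_iff_eq.2 this.symm, hi]
    obtain ⟨φ, hφ⟩ := exists_perm_castSucc ρ hρ1
    have hφ1 : φ j = j := Fin.castSucc_injective q ((hφ _).symm.trans hρ2)
    have hρ' : ρ = permComp h j φ 1 := by
      ext1 y
      rcases slot_cases h j y with ⟨l, rfl⟩ | ⟨l, hl, rfl⟩
      · rw [permComp_innerPos, hφ1, Equiv.Perm.one_apply]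
        obtain rfl | rfl : l = 0 ∨ l = 1 := by omega
        · exact hρ2
        · have : innerPos h j (1 : Fin 2) = Fin.last q :=
            Fin.ext (by simp only [innerPos, Fin.val_last, Fin.val_one]; omega)
          rw [this, hρ1]
      · have houter : ∀ (l : Fin q) (hl : l ≠ j), outerPos h j l hl = l.castSucc := fun l hl => by
          have : l.1 ≠ j.1 := fun e => hl (Fin.ext e)
          have := l.2
          simp only [outerPos, Fin.ext_iff, Fin.val_castSucc]
          rw [if_pos (by omega)]
        rw [permComp_outerPos, houter, hφ]
        simp only [hφ1]
        rw [houter]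
    refine ⟨(0, Pi.single i (act (k := k) φ p)), ?_⟩
    have : σ = ρ * nextToLast i := by rw [hρ, inv_mul_cancel_right]
    rw [assemble_single, hji, act_comp, ← hρ', hφ1, ← act_mul, ← this]

theorem eq_smul_e (x : Pois k 0) : ∃ a : k, x = a • e k := by
  have key : ∀ (n : ℕ) (x : Pois k n), n = 0 → ∃ a : k, HEq x (a • e k) := by
    intro n x hn
    have hx := Presented.isTree (fun {n} (g : PoisGen n) => by cases g <;> simp) x
    induction hx with
    | const g => cases g; exact ⟨1, heq_of_eq (one_smul k _).symm⟩
    | one => omega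
    | @act n σ x _ ih =>
      subst hn
      rw [Subsingleton.elim σ 1, act_one]
      exact ih rfl
    | @plug p q g x y _ _ ihx ihy =>
      obtain rfl : p = 0 := by omega
      obtain rfl : q = 0 := by omega
      obtain ⟨α, hα⟩ := ihx rfl
      obtain ⟨β, hβ⟩ := ihy rfl
      rw [eq_of_heq hα, eq_of_heq hβ]
      have hlin : ∀ θ : Pois k 2, plug k rfl θ (α • e k) (β • e k) =
          (α * β) • plug k (rfl : 0 + 0 = 0) θ (e k) (e k) := fun θ => by
        simp only [plug, map_smul, LinearMap.smul_apply, smul_smul]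
      rw [hlin]
      cases g with
      | product =>
        refine ⟨α * β, heq_of_eq (congrArg _ ?_)⟩
        change comp (k := k) _ 0 (comp (k := k) _ 1 (m k) (e k)) (e k) = e k
        rw [m_unit_right]
        exact one_comp (k := k) (e k)
      | bracket =>
        refine ⟨0, heq_of_eq ?_⟩
        change _ • comp (k := k) _ 0 (comp (k := k) _ 1 (b k) (e k)) (e k) = _
        rw [b_unit_right, map_zero, LinearMap.zero_apply, smul_zero, zero_smul]
    | zero n => subst hn; exact ⟨0, heq_of_eq (zero_smul k _).symm⟩
    | add x y _ _ hx hy =>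
      subst hn
      obtain ⟨α, hα⟩ := hx rfl
      obtain ⟨β, hβ⟩ := hy rfl
      exact ⟨α + β, heq_of_eq (by rw [eq_of_heq hα, eq_of_heq hβ, add_smul])⟩
    | smul a x _ ih =>
      subst hn
      obtain ⟨α, hα⟩ := ih rfl
      exact ⟨a * α, heq_of_eq (by rw [eq_of_heq hα, mul_smul])⟩
  obtain ⟨a, ha⟩ := key 0 x rfl
  exact ⟨a, eq_of_heq ha⟩

/-- The interpretation of the product as the constant `1` and of the bracket as the antisymmetric
pairing. -/
def matGen (k : Type u) [CommRing k] : {n : ℕ} → PoisGen n → Mat k n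
  | _, .unit => fun _ => 1
  | _, .product => fun _ => 1
  | _, .bracket => pairing k

theorem pairing_collapse_unit (i : Fin 2) (W : Matrix (Fin 1) (Fin 1) k) :
    pairing k (conj (collapse k (rfl : 2 + 0 = 1 + 1) i) W) = 0 := by
  have h0 : block (r := 1) (rfl : 2 + 0 = 1 + 1) (0 : Fin 2) = ![1] := by decide
  have h1 : block (r := 1) (rfl : 2 + 0 = 1 + 1) (1 : Fin 2) = ![0] := by decide
  fin_cases i <;> simp [pairing, conj_collapse_apply, h0, h1]

theorem matGen_rel {n : ℕ} (x y : Expr k PoisGen n) (h : PoisRel k n x y) :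
    x.eval (matGen k) = y.eval (matGen k) := by
  cases h with
  | unit_left => funext W; exact mul_one (1 : k)
  | unit_right => funext W; exact mul_one (1 : k)
  | bracket_unit_left => funext W; exact (mul_one _).trans (pairing_collapse_unit 0 W)
  | bracket_unit_right => funext W; exact (mul_one _).trans (pairing_collapse_unit 1 W)
  | comm => rfl
  | antisymm => exact Mat.act_swap_pairing.trans (neg_one_smul k _).symm
  | assoc => rfl
  | leibniz =>
    funext W
    change pairing k (conj (collapse k (rfl : 2 + 2 = 3 + 1) 0) W) * 1 =
      1 * pairing k (conj (restrict k (rfl : 2 + 2 = 3 + 1) 1) W) +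
      1 * pairing k (conj (restrict k (rfl : 2 + 2 = 3 + 1) 1) (conj (permMat k _) W))
    rw [pairing_collapse_zero, pairing_restrict_one, pairing_restrict_one]
    simp only [conj_permMat_apply, Equiv.symm_swap]
    have e1 : Equiv.swap (0 : Fin 3) 1 1 = 0 := by decide
    have e2 : Equiv.swap (0 : Fin 3) 1 2 = 2 := by decide
    rw [e1, e2]
    ring
  | jacobi =>
    have h := Mat.jacobiator_pairing (k := k)
    rw [jacobiator, sub_sub, sub_eq_zero] at h
    exact h

/-- The operad map from `Pois` to functions on matrices. -/
def toMat (k : Type u) [CommRing k] (n : ℕ) : Pois k n →ₗ[k] Mat k n :=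
  Presented.lift (matGen k) matGen_rel n

theorem toMat_act {n : ℕ} (σ : Equiv.Perm (Fin n)) (x : Pois k n) :
    toMat k n (act (k := k) σ x) = act (k := k) σ (toMat k n x) := Presented.lift_act _ _ σ x

theorem toMat_comp {m n r : ℕ} (h : m + n = r + 1) (i : Fin m) (x : Pois k m) (y : Pois k n) :
    toMat k r (comp (k := k) h i x y) = comp (k := k) h i (toMat k m x) (toMat k n y) :=
  Presented.lift_comp _ _ h i x y

theorem toMat_e : toMat k 0 (e k) = fun _ => 1 := rfl

theorem toMat_m : toMat k 2 (m k) = fun _ => 1 := rfl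

theorem toMat_b : toMat k 2 (b k) = pairing k := rfl

/-- The extension of a matrix by one row and one column. -/
def border {n : ℕ} (W : Matrix (Fin n) (Fin n) k) (u : Fin n → k) (c : k) :
    Matrix (Fin (n + 1)) (Fin (n + 1)) k :=
  Matrix.of (Fin.snoc (fun a => Fin.snoc (fun b => W a b) (u a)) (Fin.snoc (fun _ => 0) c))

theorem border_castSucc_castSucc {n : ℕ} (W : Matrix (Fin n) (Fin n) k) (u : Fin n → k) (c : k)
    (i j : Fin n) : border W u c i.castSucc j.castSucc = W i j := by simp [border]

theorem border_castSucc_last {n : ℕ} (W : Matrix (Fin n) (Fin n) k) (u : Fin n → k) (c : k)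
    (i : Fin n) : border W u c i.castSucc (Fin.last n) = u i := by simp [border]

theorem border_last_castSucc {n : ℕ} (W : Matrix (Fin n) (Fin n) k) (u : Fin n → k) (c : k)
    (j : Fin n) : border W u c (Fin.last n) j.castSucc = 0 := by simp [border]

theorem border_last_last {n : ℕ} (W : Matrix (Fin n) (Fin n) k) (u : Fin n → k) (c : k) :
    border W u c (Fin.last n) (Fin.last n) = c := by simp [border]

theorem toMat_mul_border {n : ℕ} (p : Pois k n) (W : Matrix (Fin n) (Fin n) k) (u : Fin n → k)
    (c : k) : toMat k (n + 1) (comp (k := k) (by omega : 2 + n = n + 1 + 1) 0 (m k) p)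
      (border W u c) = toMat k n p W := by
  rw [toMat_comp, Mat.comp_apply, toMat_m, one_mul]
  refine congrArg (toMat k n p) (Matrix.ext fun i j => ?_)
  have hinner : ∀ j : Fin n, innerPos (by omega : 2 + n = n + 1 + 1) (0 : Fin 2) j = j.castSucc :=
    fun j => Fin.ext (Nat.zero_add _)
  rw [conj_restrict_apply, hinner, hinner, border_castSucc_castSucc]

/-- The value of a term `pᵢ(…, [xᵢ, xₙ₊₁], …)` at a bordered matrix has the border entry `uᵢ` as a
factor.  If `u` is the `i`-th unit vector and the corner entry is `-1`, the border cancels in the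
other factor, which then only depends on the matrix `W`. -/
theorem toMat_bracket_border {n : ℕ} (i : Fin n) (p : Pois k n)
    (W : Matrix (Fin n) (Fin n) k) (u : Fin n → k) (c : k) :
    ∃ W', toMat k (n + 1) (act (k := k) (nextToLast i) (comp (k := k) (rfl : n + 2 = n + 1 + 1)
      (lastSlot i) p (b k))) (border W u c) = toMat k n p W' * u i ∧
      (u i = 1 → c = -1 → (∀ j, j ≠ i → u j = 0) →
        W' = conj (permMat k (Equiv.swap i (lastSlot i))) W) := by
  have hn := i.2
  refine ⟨conj (collapse k (rfl : n + 2 = n + 1 + 1) (lastSlot i))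
    (conj (permMat k (nextToLast i)) (border W u c)), ?_, fun hu hc h0 => ?_⟩
  · rw [toMat_act, Mat.act_apply, toMat_comp, Mat.comp_apply, toMat_b]
    congr 1
    have e0 : innerPos (rfl : n + 2 = n + 1 + 1) (lastSlot i) (0 : Fin 2) =
        nextToLast i i.castSucc :=
      (Fin.ext rfl : _ = (lastSlot i).castSucc).trans (Equiv.swap_apply_left _ _).symm
    have e1 : innerPos (rfl : n + 2 = n + 1 + 1) (lastSlot i) (1 : Fin 2) =
        nextToLast i (Fin.last n) := by
      rw [nextToLast_last]
      exact Fin.ext (by simp only [innerPos, lastSlot, Fin.val_last, Fin.val_one]; omega)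
    rw [pairing, conj_restrict_apply, conj_restrict_apply, e0, e1, conj_permMat_apply,
      conj_permMat_apply, Equiv.symm_apply_apply, Equiv.symm_apply_apply, border_castSucc_last,
      border_last_castSucc, sub_zero]
  · rw [conj_conj]
    -- Collapsing the last two slots after the transposition adds the last row and column to those
    -- of the slot `i`, where the entries `1` and `-1` cancel.
    have hL : ∀ (a : Fin n) (x : Fin (n + 1)),
        (collapse k (rfl : n + 2 = n + 1 + 1) (lastSlot i) * permMat k (nextToLast i)) a x =
          if (Fin.snoc (fun y => y) i : Fin (n + 1) → Fin n) x =
            (Equiv.swap i (lastSlot i)).symm a then 1 else 0 := by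
      intro a x
      rw [mul_permMat]
      simp only [collapse, Matrix.of_apply, Equiv.eq_symm_apply]
      refine Fin.lastCases ?_ (fun y => ?_) x
      · rw [nextToLast_last, Fin.snoc_last, Equiv.swap_apply_left]
        have : block (rfl : n + 2 = n + 1 + 1) (lastSlot i) (Fin.last n) =
            ((lastSlot i) : Fin n) := by
          refine Fin.ext ?_
          rw [block_val, Fin.val_last, if_neg (by simp only [lastSlot]; omega),
            if_pos (by simp only [lastSlot]; omega)]
        rw [this]
      · rw [Fin.snoc_castSucc]
        have hc : nextToLast i y.castSucc = (Equiv.swap i (lastSlot i) y).castSucc :=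
          ((Fin.castSucc_injective n).swap_apply i (lastSlot i) y)
        have hb : ∀ y : Fin n, block (rfl : n + 2 = n + 1 + 1) (lastSlot i) y.castSucc = y :=
          fun y => by
            have := y.2
            refine Fin.ext ?_
            rw [block_val, Fin.val_castSucc]
            have hl : (lastSlot i).1 = n - 1 := rfl
            by_cases hy : y.1 < (lastSlot i).1
            · rw [if_pos hy]
            · rw [if_neg hy, if_pos (by omega)]
              omega
        rw [hc, hb]
    ext a a'
    rw [conj_permMat_apply, conj_apply]
    simp only [hL]
    set α := (Equiv.swap i (lastSlot i)).symm a
    set α' := (Equiv.swap i (lastSlot i)).symm a'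
    simp only [Fin.sum_univ_castSucc, Fin.snoc_castSucc, Fin.snoc_last, border_castSucc_castSucc,
      border_castSucc_last, border_last_castSucc, border_last_last, ite_mul, one_mul, zero_mul,
      mul_ite, mul_one, mul_zero, ite_self, Finset.sum_add_distrib,
      Finset.sum_ite_eq', Finset.mem_univ, if_true, hc]
    by_cases h1 : i = α <;> by_cases h2 : i = α'
    · simp [← h1, ← h2, hu]
    · have h3 : α ≠ α' := fun e => h2 (h1.trans e)
      simp [h1, h3]
    · simp [← h2, h1, h0 α (Ne.symm h1)]
    · simp [h2]

/-- The representation by functions on matrices is faithful.  Bordering a matrix by the zero row and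
column isolates `p` in `assemble (p, q)`, and bordering it by the `i`-th unit vector and the corner
entry `-1` isolates `qᵢ`, so that the claim follows by induction from the normal form. -/
theorem toMat_injective (n : ℕ) : Function.Injective (toMat k n) := by
  rw [← LinearMap.ker_eq_bot, LinearMap.ker_eq_bot']
  induction n with
  | zero =>
    intro x hx
    obtain ⟨a, rfl⟩ := eq_smul_e x
    have := congrFun hx 0
    rw [map_smul, Mat.smul_apply, toMat_e, mul_one, Mat.zero_apply] at this
    rw [this, zero_smul]
  | succ n ih =>
    intro x hx
    obtain ⟨⟨p, q⟩, rfl⟩ := assemble_surjective n x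
    have hx' : ∀ (W : Matrix (Fin n) (Fin n) k) (u : Fin n → k) (c : k), toMat k n p W +
        ∑ i, toMat k (n + 1) (act (k := k) (nextToLast i) (comp (k := k) (rfl : n + 2 = n + 1 + 1)
      (lastSlot i) (q i) (b k))) (border W u c) = 0 := fun W u c => by
      have h := congrFun hx (border W u c)
      rw [assemble_apply, map_add, Mat.add_apply, toMat_mul_border, map_sum] at h
      refine Eq.trans ?_ h
      congr 1
      exact (Finset.sum_apply (border W u c) Finset.univ fun i => (toMat k (n + 1) (act (k := k)
        (nextToLast i) (comp (k := k) (rfl : n + 2 = n + 1 + 1) (lastSlot i) (q i) (b k))) :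
          Matrix (Fin (n + 1)) (Fin (n + 1)) k → k)).symm
    have hp : p = 0 := by
      refine ih p (funext fun W => ?_)
      have h := hx' W 0 0
      rw [Finset.sum_eq_zero, add_zero] at h
      · exact h
      · intro i _
        obtain ⟨W', hW, -⟩ := toMat_bracket_border i (q i) W 0 0
        rw [hW, Pi.zero_apply, mul_zero]
    have hq : q = 0 := by
      funext i
      set φ : Equiv.Perm (Fin n) := Equiv.swap i (lastSlot i) with hφ
      have h0 : act (k := k) φ (q i) = 0 := by
        refine ih _ (funext fun W => ?_)
        have h := hx' W (Pi.single i 1) (-1)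
        rw [hp, map_zero, Mat.zero_apply, zero_add, Finset.sum_eq_single i] at h
        · obtain ⟨W', hW, hW'⟩ := toMat_bracket_border i (q i) W (Pi.single i 1) (-1)
          rw [hW, Pi.single_eq_same, mul_one, hW' (Pi.single_eq_same i 1) rfl fun j hj =>
            Pi.single_eq_of_ne hj 1] at h
          rw [toMat_act]
          exact h
        · intro j _ hj
          obtain ⟨W', hW, -⟩ := toMat_bracket_border j (q j) W (Pi.single i 1) (-1)
          rw [hW, Pi.single_eq_of_ne hj, mul_zero]
        · simp
      have h1 := congrArg (act (k := k) φ) h0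
      rwa [← act_mul, hφ, Equiv.swap_mul_self, act_one, map_zero] at h1
    rw [hp, hq]
    exact map_zero _

end Pois

namespace Pois

variable {k : Type u} [CommRing k]

/-! ### The Poisson operad in low arities -/

theorem eq_smul_one (x : Pois k 1) : ∃ a : k, x = a • one (k := k) := by
  obtain ⟨⟨p, q⟩, rfl⟩ := assemble_surjective 0 x
  obtain ⟨a, rfl⟩ := eq_smul_e p
  refine ⟨a, ?_⟩
  rw [assemble_apply, Finset.univ_eq_empty, Finset.sum_empty, add_zero, map_smul]
  exact congrArg (a • ·) m_unit_left

theorem eq_smul_add_smul (x : Pois k 2) : ∃ α β : k, x = α • m k + β • b k := by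
  obtain ⟨⟨p, q⟩, rfl⟩ := assemble_surjective 1 x
  obtain ⟨α, rfl⟩ := eq_smul_one p
  obtain ⟨β, hβ⟩ := eq_smul_one (q 0)
  refine ⟨α, β, ?_⟩
  have h1 : nextToLast (0 : Fin 1) = 1 := by decide
  rw [assemble_apply, Fin.sum_univ_one, hβ, map_smul, map_smul, LinearMap.smul_apply, map_smul, h1,
    act_one, comp_one]
  congr 2
  exact one_comp (k := k) (b k)

theorem toMat_smul_add_smul (α β : k) (V : Matrix (Fin 2) (Fin 2) k) :
    toMat k 2 (α • m k + β • b k) V = α + β * pairing k V := by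
  rw [map_add, map_smul, map_smul, Mat.add_apply, Mat.smul_apply, Mat.smul_apply, toMat_m, toMat_b,
    mul_one]

theorem toMat_apply_two (x : Pois k 2) :
    ∃ α β : k, ∀ V, toMat k 2 x V = α + β * pairing k V := by
  obtain ⟨α, β, rfl⟩ := eq_smul_add_smul x
  exact ⟨α, β, toMat_smul_add_smul α β⟩

theorem toMat_apply_three (x : Pois k 3) : ∃ α β₀₁ β₀₂ β₁₂ γ δ : k, ∀ V, toMat k 3 x V =
    α + β₀₁ * (V 0 1 - V 1 0) + β₀₂ * (V 0 2 - V 2 0) + β₁₂ * (V 1 2 - V 2 1) +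
      γ * ((V 0 1 - V 1 0) * ((V 0 2 - V 2 0) + (V 1 2 - V 2 1))) +
      δ * ((V 1 2 - V 2 1) * ((V 0 1 - V 1 0) + (V 0 2 - V 2 0))) := by
  obtain ⟨⟨p, q⟩, rfl⟩ := assemble_surjective 2 x
  obtain ⟨α, β, hp⟩ := toMat_apply_two p
  obtain ⟨α₀, β₀, h0⟩ := toMat_apply_two (q 0)
  obtain ⟨α₁, β₁, h1⟩ := toMat_apply_two (q 1)
  have e0 : nextToLast (0 : Fin 2) = Equiv.swap 0 1 := by decide
  have e1 : nextToLast (1 : Fin 2) = 1 := by decide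
  have l0 : lastSlot (0 : Fin 2) = 1 := rfl
  have l1 : lastSlot (1 : Fin 2) = 1 := rfl
  refine ⟨α, β, α₀, α₁, -β₀, β₀ + β₁, fun V => ?_⟩
  rw [assemble_apply, Fin.sum_univ_two, e0, e1, l0, l1, map_add, map_add, act_one, toMat_act,
    toMat_comp, toMat_comp, toMat_comp, Mat.add_apply, Mat.add_apply, Mat.act_apply,
    Mat.comp_apply, Mat.comp_apply, Mat.comp_apply, hp, h0, h1, toMat_m, toMat_b]
  rw [pairing_collapse_one, pairing_collapse_one, pairing_restrict_zero, pairing_restrict_one,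
    pairing_restrict_one]
  simp only [conj_permMat_apply, Equiv.symm_swap]
  have s0 : Equiv.swap (0 : Fin 3) 1 0 = 1 := by decide
  have s1 : Equiv.swap (0 : Fin 3) 1 1 = 0 := by decide
  have s2 : Equiv.swap (0 : Fin 3) 1 2 = 2 := by decide
  rw [s0, s1, s2]
  ring

/-- The element `[[x₁, x₂], x₃] - [x₁, [x₂, x₃]]`, whose multiples are the possible associators of
deformed products. -/
def lieAssociator (k : Type u) [CommRing k] : Pois k 3 :=
  comp (k := k) (r := 3) (rfl : 2 + 2 = 3 + 1) 0 (b k) (b k)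
    - comp (k := k) (r := 3) (rfl : 2 + 2 = 3 + 1) 1 (b k) (b k)

theorem toMat_lieAssociator (V : Matrix (Fin 3) (Fin 3) k) : toMat k 3 (lieAssociator k) V =
    (V 0 2 - V 2 0) * ((V 0 1 - V 1 0) - (V 1 2 - V 2 1)) := by
  rw [lieAssociator, map_sub, toMat_comp, toMat_comp, Mat.sub_apply, Mat.comp_apply, Mat.comp_apply,
    toMat_b, pairing_collapse_one, pairing_collapse_zero, pairing_restrict_zero,
    pairing_restrict_one]
  ring

/-- The infinitesimal change of the associator of the product `m` under a change of the product. -/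
def associatorChange (a : Pois k 2) : Pois k 3 :=
  (comp (k := k) (r := 3) (rfl : 2 + 2 = 3 + 1) 0 a (m k)
    + comp (k := k) (r := 3) (rfl : 2 + 2 = 3 + 1) 0 (m k) a)
    - (comp (k := k) (r := 3) (rfl : 2 + 2 = 3 + 1) 1 a (m k)
    + comp (k := k) (r := 3) (rfl : 2 + 2 = 3 + 1) 1 (m k) a)

/-- To first order the associator of the product does not depend on its lift: the first variation of
the associator of `m` vanishes in every direction, because a direction is a combination of `m` and
`b`. -/
theorem associatorChange_eq_zero (a : Pois k 2) : associatorChange a = 0 := by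
  obtain ⟨α, β, ha⟩ := toMat_apply_two a
  refine toMat_injective 3 (funext fun V => ?_)
  rw [associatorChange, map_sub, map_add, map_add, toMat_comp, toMat_comp, toMat_comp, toMat_comp,
    Mat.sub_apply, Mat.add_apply, Mat.add_apply, Mat.comp_apply, Mat.comp_apply, Mat.comp_apply,
    Mat.comp_apply, ha, ha, ha, ha, toMat_m, pairing_collapse_one, pairing_collapse_zero,
    pairing_restrict_zero, pairing_restrict_one, map_zero, Mat.zero_apply]
  ring

/-! ### A nontrivial cocycle of the Poisson operad -/

/-- The generators of the infinitesimal deformation `m + 3εω²`, `ω + εω³` of the representation of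
the Poisson operad by functions on matrices.  Here `ω` is the antisymmetric pairing.  The Moyal
product `exp(tω)` is associative; its symmetrisation and its commutator, divided by `2` and by
`2t`, are `1 + t²ω²/2 + ⋯` and `ω + t²ω³/6 + ⋯`, and `ε = t²/6` gives these formulas. -/
def starGen (k : Type u) [CommRing k] : {n : ℕ} → PoisGen n → Ext (0 : Z2star k (Mat k)) n
  | _, .unit => Ext.mk 0 (fun _ => (1 : k)) 0
  | _, .product => Ext.mk 0 (fun _ => (1 : k)) (fun V => 3 * pairing k V ^ 2)
  | _, .bracket => Ext.mk 0 (pairing k) (fun V => pairing k V ^ 3)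

theorem fst_eval_starGen {n : ℕ} (x : Expr k PoisGen n) :
    Ext.fst (x.eval (starGen k)) = toMat k n (Presented.mk k PoisGen (PoisRel k) x) := by
  change _ = x.eval (matGen k)
  induction x with
  | gen g => cases g <;> rfl
  | one => rfl
  | act σ x ih => exact congrArg (act (k := k) σ) ih
  | comp h i x y ihx ihy => exact congrArg₂ (fun a b => comp (k := k) h i a b) ihx ihy
  | zero => rfl
  | add x y ihx ihy => exact congrArg₂ (· + ·) ihx ihy
  | smul a x ih => exact congrArg (a • ·) ih

/-- The infinitesimal elements `εa` with `a` in the image of the Poisson operad. -/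
def starIdeal (k : Type u) [CommRing k] (n : ℕ) : Submodule k (Ext (0 : Z2star k (Mat k)) n) :=
  (LinearMap.range (toMat k n)).map Ext.eps

theorem eps_toMat_mem {n : ℕ} (x : Pois k n) : Ext.eps (toMat k n x) ∈ starIdeal k n :=
  ⟨_, ⟨x, rfl⟩, rfl⟩

theorem fst_eq_zero_of_mem {n : ℕ} {x : Ext (0 : Z2star k (Mat k)) n} (hx : x ∈ starIdeal k n) :
    Ext.fst x = 0 := by
  obtain ⟨_, ⟨y, rfl⟩, rfl⟩ := hx
  rfl

theorem snd_mem_range_of_mem {n : ℕ} {x : Ext (0 : Z2star k (Mat k)) n} (hx : x ∈ starIdeal k n) :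
    Ext.snd x ∈ LinearMap.range (toMat k n) := by
  obtain ⟨_, ⟨y, rfl⟩, rfl⟩ := hx
  exact ⟨y, rfl⟩

theorem act_mem_starIdeal {n : ℕ} (σ : Equiv.Perm (Fin n)) {x : Ext (0 : Z2star k (Mat k)) n}
    (hx : x ∈ starIdeal k n) : act (k := k) σ x ∈ starIdeal k n := by
  obtain ⟨_, ⟨y, rfl⟩, rfl⟩ := hx
  rw [Ext.act_eps, ← toMat_act]
  exact eps_toMat_mem _

theorem comp_mem_starIdeal_left {m n r : ℕ} (h : m + n = r + 1) (i : Fin m)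
    {x : Ext (0 : Z2star k (Mat k)) m} (hx : x ∈ starIdeal k m)
    {y : Ext (0 : Z2star k (Mat k)) n} (hy : Ext.fst y ∈ LinearMap.range (toMat k n)) :
    comp (k := k) h i x y ∈ starIdeal k r := by
  obtain ⟨_, ⟨x, rfl⟩, rfl⟩ := hx
  obtain ⟨y', hy⟩ := hy
  rw [Ext.eps_comp, ← hy, ← toMat_comp]
  exact eps_toMat_mem _

theorem comp_mem_starIdeal_right {m n r : ℕ} (h : m + n = r + 1) (i : Fin m)
    {x : Ext (0 : Z2star k (Mat k)) m} (hx : Ext.fst x ∈ LinearMap.range (toMat k m))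
    {y : Ext (0 : Z2star k (Mat k)) n} (hy : y ∈ starIdeal k n) :
    comp (k := k) h i x y ∈ starIdeal k r := by
  obtain ⟨_, ⟨y, rfl⟩, rfl⟩ := hy
  obtain ⟨x', hx⟩ := hx
  rw [Ext.comp_eps, ← hx, ← toMat_comp]
  exact eps_toMat_mem _

theorem snd_comp_zero {m n r : ℕ} (h : m + n = r + 1) (i : Fin m)
    (x : Ext (0 : Z2star k (Mat k)) m) (y : Ext (0 : Z2star k (Mat k)) n) :
    Ext.snd (comp (k := k) h i x y) = comp (k := k) h i (Ext.snd x) (Ext.fst y)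
      + comp (k := k) h i (Ext.fst x) (Ext.snd y) := by
  rw [Ext.snd_comp]
  exact congrArg (· + _) (zero_add _)

theorem snd_act_zero {n : ℕ} (σ : Equiv.Perm (Fin n)) (x : Ext (0 : Z2star k (Mat k)) n) :
    Ext.snd (act (k := k) σ x) = act (k := k) σ (Ext.snd x) := by
  rw [Ext.snd_act]
  exact add_zero _

/-- The deformed generators satisfy all relations of the Poisson operad except for
associativity, and the associator `-6ε · lieAssociator` is infinitesimal and in the image of the
Poisson operad. -/
theorem starGen_rel {n : ℕ} (x y : Expr k PoisGen n) (h : PoisRel k n x y) :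
    x.eval (starGen k) - y.eval (starGen k) ∈ starIdeal k n := by
  have key : Ext.fst (x.eval (starGen k)) = Ext.fst (y.eval (starGen k)) := by
    rw [fst_eval_starGen, fst_eval_starGen, Presented.sound (.rel h)]
  have hsnd : ∀ z : Pois k n,
      Ext.snd (x.eval (starGen k)) - Ext.snd (y.eval (starGen k)) = toMat k n z →
      x.eval (starGen k) - y.eval (starGen k) ∈ starIdeal k n := fun z hz => by
    rw [Ext.eq_eps (x := x.eval (starGen k) - y.eval (starGen k))
      (by rw [map_sub, key, sub_self]), map_sub, hz]
    exact eps_toMat_mem z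
  have e1 : Equiv.swap (0 : Fin 3) 1 0 = 1 := by decide
  have e2 : Equiv.swap (0 : Fin 3) 1 1 = 0 := by decide
  have e3 : Equiv.swap (0 : Fin 3) 1 2 = 2 := by decide
  cases h with
  | unit_left =>
    refine hsnd 0 (funext fun W => ?_)
    change (0 + 3 * pairing k (conj (collapse k _ 0) W) ^ 2 * 1 + 1 * 0) - -0 = 0
    rw [pairing_collapse_unit]
    ring
  | unit_right =>
    refine hsnd 0 (funext fun W => ?_)
    change (0 + 3 * pairing k (conj (collapse k _ 1) W) ^ 2 * 1 + 1 * 0) - -0 = 0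
    rw [pairing_collapse_unit]
    ring
  | bracket_unit_left =>
    refine hsnd 0 (funext fun W => ?_)
    change (0 + pairing k (conj (collapse k _ 0) W) ^ 3 * 1
      + pairing k (conj (collapse k _ 0) W) * 0) - 0 = 0
    rw [pairing_collapse_unit]
    ring
  | bracket_unit_right =>
    refine hsnd 0 (funext fun W => ?_)
    change (0 + pairing k (conj (collapse k _ 1) W) ^ 3 * 1
      + pairing k (conj (collapse k _ 1) W) * 0) - 0 = 0
    rw [pairing_collapse_unit]
    ring
  | comm =>
    refine hsnd 0 (funext fun W => ?_)
    have hs := congrFun (Mat.act_swap_pairing (k := k)) W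
    rw [Mat.act_apply, Mat.neg_apply] at hs
    change (3 * pairing k (conj (permMat k _) W) ^ 2 + 0) - 3 * pairing k W ^ 2 = 0
    rw [hs]
    ring
  | antisymm =>
    refine hsnd 0 (funext fun W => ?_)
    have hs := congrFun (Mat.act_swap_pairing (k := k)) W
    rw [Mat.act_apply, Mat.neg_apply] at hs
    change (pairing k (conj (permMat k _) W) ^ 3 + 0) - (-1) * pairing k W ^ 3 = 0
    rw [hs]
    ring
  | assoc =>
    refine hsnd ((-6 : k) • lieAssociator k) (funext fun W => ?_)
    rw [map_smul, Mat.smul_apply, toMat_lieAssociator]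
    change (0 + 3 * pairing k (conj (collapse k (rfl : 2 + 2 = 3 + 1) 0) W) ^ 2 * 1 +
      1 * (3 * pairing k (conj (restrict k (rfl : 2 + 2 = 3 + 1) 0) W) ^ 2)) -
      (0 + 3 * pairing k (conj (collapse k (rfl : 2 + 2 = 3 + 1) 1) W) ^ 2 * 1 +
      1 * (3 * pairing k (conj (restrict k (rfl : 2 + 2 = 3 + 1) 1) W) ^ 2)) = _
    rw [pairing_collapse_zero, pairing_collapse_one, pairing_restrict_zero, pairing_restrict_one]
    ring
  | leibniz =>
    refine hsnd 0 (funext fun W => ?_)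
    have hR : ∀ W : Matrix (Fin 3) (Fin 3) k,
        Ext.snd (comp (k := k) (r := 3) (rfl : 2 + 2 = 3 + 1) 1 (starGen k .product)
          (starGen k .bracket)) W =
        3 * ((W 0 1 - W 1 0) + (W 0 2 - W 2 0)) ^ 2 * (W 1 2 - W 2 1) + (W 1 2 - W 2 1) ^ 3 := by
      intro W
      rw [snd_comp_zero, Mat.add_apply, Mat.comp_apply, Mat.comp_apply]
      change 3 * pairing k _ ^ 2 * pairing k _ + 1 * pairing k _ ^ 3 = _
      rw [pairing_collapse_one, pairing_restrict_one, one_mul]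
    change (0 + pairing k (conj (collapse k (rfl : 2 + 2 = 3 + 1) 0) W) ^ 3 * 1 +
      pairing k (conj (collapse k (rfl : 2 + 2 = 3 + 1) 0) W) *
        (3 * pairing k (conj (restrict k (rfl : 2 + 2 = 3 + 1) 0) W) ^ 2)) -
      (Ext.snd (comp (k := k) (r := 3) (rfl : 2 + 2 = 3 + 1) 1 (starGen k .product)
          (starGen k .bracket)) W + (Ext.snd (comp (k := k) (r := 3) (rfl : 2 + 2 = 3 + 1) 1
          (starGen k .product) (starGen k .bracket)) (conj (permMat k _) W) + 0)) = 0
    rw [hR, hR, pairing_collapse_zero, pairing_restrict_zero]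
    simp only [conj_permMat_apply, Equiv.symm_swap]
    rw [e1, e2, e3]
    ring
  | jacobi =>
    refine hsnd 0 (funext fun W => ?_)
    have hR : ∀ W : Matrix (Fin 3) (Fin 3) k,
        Ext.snd (comp (k := k) (r := 3) (rfl : 2 + 2 = 3 + 1) 1 (starGen k .bracket)
          (starGen k .bracket)) W =
        ((W 0 1 - W 1 0) + (W 0 2 - W 2 0)) ^ 3 * (W 1 2 - W 2 1) +
          ((W 0 1 - W 1 0) + (W 0 2 - W 2 0)) * (W 1 2 - W 2 1) ^ 3 := by
      intro W
      rw [snd_comp_zero, Mat.add_apply, Mat.comp_apply, Mat.comp_apply]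
      change pairing k _ ^ 3 * pairing k _ + pairing k _ * pairing k _ ^ 3 = _
      rw [pairing_collapse_one, pairing_restrict_one]
    change Ext.snd (comp (k := k) (r := 3) (rfl : 2 + 2 = 3 + 1) 1 (starGen k .bracket)
          (starGen k .bracket)) W -
      ((0 + pairing k (conj (collapse k (rfl : 2 + 2 = 3 + 1) 0) W) ^ 3 *
        pairing k (conj (restrict k (rfl : 2 + 2 = 3 + 1) 0) W) +
      pairing k (conj (collapse k (rfl : 2 + 2 = 3 + 1) 0) W) *
        pairing k (conj (restrict k (rfl : 2 + 2 = 3 + 1) 0) W) ^ 3) +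
      (Ext.snd (comp (k := k) (r := 3) (rfl : 2 + 2 = 3 + 1) 1 (starGen k .bracket)
          (starGen k .bracket)) (conj (permMat k _) W) + 0)) = 0
    rw [hR, hR, pairing_collapse_zero, pairing_restrict_zero]
    simp only [conj_permMat_apply, Equiv.symm_swap]
    rw [e1, e2, e3]
    ring

/-- Modulo `starIdeal`, the deformed value of an expression only depends on its class in the Poisson
operad. -/
theorem eval_starGen_sub_mem {n : ℕ} {x y : Expr k PoisGen n}
    (h : Congr k PoisGen (PoisRel k) n x y) :
    x.eval (starGen k) - y.eval (starGen k) ∈ starIdeal k n :=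
  Congr.eval_sub_mem (starGen k) (starIdeal k) (fun σ _ => act_mem_starIdeal σ)
    (fun h i _ y ha => comp_mem_starIdeal_left h i ha ⟨_, (fst_eval_starGen y).symm⟩)
    (fun h i x _ hb => comp_mem_starIdeal_right h i ⟨_, (fst_eval_starGen x).symm⟩ hb)
    starGen_rel h

end Pois

namespace Pois

section StarCocycle

variable {k : Type u} [Field k]

/-- The deformation of the generators extends to a linear, but not multiplicative, deformation of
the whole representation of the Poisson operad. -/
theorem exists_starMap (k : Type u) [Field k] (n : ℕ) :
    ∃ t : Pois k n →ₗ[k] Ext (0 : Z2star k (Mat k)) n, ∀ x : Expr k PoisGen n,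
      t (Presented.mk k PoisGen (PoisRel k) x) - x.eval (starGen k) ∈ starIdeal k n := by
  obtain ⟨s, hs⟩ := LinearMap.exists_rightInverse_of_surjective (starIdeal k n).mkQ
    (Submodule.range_mkQ _)
  refine ⟨s ∘ₗ Presented.liftQ (starGen k) (starIdeal k) eval_starGen_sub_mem n, fun x => ?_⟩
  rw [← Submodule.Quotient.eq]
  exact LinearMap.congr_fun hs _

/-- A choice of the deformed representation. -/
noncomputable def starMap (k : Type u) [Field k] (n : ℕ) :
    Pois k n →ₗ[k] Ext (0 : Z2star k (Mat k)) n := (exists_starMap k n).choose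

theorem starMap_mk {n : ℕ} (x : Expr k PoisGen n) :
    starMap k n (Presented.mk k PoisGen (PoisRel k) x) - x.eval (starGen k) ∈ starIdeal k n :=
  (exists_starMap k n).choose_spec x

theorem fst_starMap {n : ℕ} (x : Pois k n) : Ext.fst (starMap k n x) = toMat k n x := by
  induction x using Presented.ind with
  | h x =>
    have h := fst_eq_zero_of_mem (starMap_mk x)
    rwa [map_sub, sub_eq_zero, fst_eval_starGen] at h

theorem starMap_act {n : ℕ} (σ : Equiv.Perm (Fin n)) (x : Pois k n) :
    starMap k n (act (k := k) σ x) - act (k := k) σ (starMap k n x) ∈ starIdeal k n := by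
  induction x using Presented.ind with
  | h x =>
    have h1 := starMap_mk (.act σ x)
    have h2 := act_mem_starIdeal σ (starMap_mk x)
    have h3 := sub_mem h1 h2
    rw [map_sub] at h3
    convert h3 using 1
    simp only [Expr.eval]
    rw [sub_sub_sub_cancel_right]
    rfl

theorem starMap_comp {m n r : ℕ} (h : m + n = r + 1) (i : Fin m) (x : Pois k m) (y : Pois k n) :
    starMap k r (comp (k := k) h i x y) - comp (k := k) h i (starMap k m x) (starMap k n y) ∈
      starIdeal k r := by
  have hy' := fst_starMap y
  induction x using Presented.ind with
  | h x =>
    induction y using Presented.ind with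
    | h y =>
      have h1 := starMap_mk (.comp h i x y)
      have h2 := comp_mem_starIdeal_left h i (starMap_mk x) ⟨_, hy'.symm⟩
      have h3 := comp_mem_starIdeal_right h i ⟨_, (fst_eval_starGen x).symm⟩ (starMap_mk y)
      have h4 := sub_mem (sub_mem h1 h2) h3
      rw [map_sub, map_sub, LinearMap.sub_apply] at h4
      convert h4 using 1
      simp only [Expr.eval]
      rw [sub_sub, sub_sub, sub_add_sub_cancel, add_sub_cancel]
      rfl

/-- The infinitesimal part of the deformed representation. -/
noncomputable def starDeriv (k : Type u) [Field k] (n : ℕ) : Pois k n →ₗ[k] Mat k n :=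
  Ext.snd ∘ₗ starMap k n

theorem starDeriv_act {n : ℕ} (σ : Equiv.Perm (Fin n)) (x : Pois k n) :
    starDeriv k n (act (k := k) σ x) - act (k := k) σ (starDeriv k n x) ∈
      LinearMap.range (toMat k n) := by
  have h := snd_mem_range_of_mem (starMap_act σ x)
  rwa [map_sub, snd_act_zero] at h

theorem starDeriv_comp {m n r : ℕ} (h : m + n = r + 1) (i : Fin m) (x : Pois k m) (y : Pois k n) :
    starDeriv k r (comp (k := k) h i x y) - (comp (k := k) h i (starDeriv k m x) (toMat k n y)
      + comp (k := k) h i (toMat k m x) (starDeriv k n y)) ∈ LinearMap.range (toMat k r) := by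
  have h := snd_mem_range_of_mem (starMap_comp h i x y)
  rwa [map_sub, snd_comp_zero, fst_starMap, fst_starMap] at h

theorem starDeriv_m : ∃ a : Pois k 2,
    starDeriv k 2 (m k) = Ext.snd (starGen k .product) + toMat k 2 a := by
  obtain ⟨a, ha⟩ := snd_mem_range_of_mem (starMap_mk (k := k) (.gen .product))
  refine ⟨a, ?_⟩
  rw [ha, map_sub, add_comm]
  exact (sub_add_cancel _ _).symm

/-- A left inverse of the faithful representation by functions on matrices. -/
noncomputable def ofMat (k : Type u) [Field k] (n : ℕ) : Mat k n →ₗ[k] Pois k n :=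
  (LinearMap.exists_leftInverse_of_injective (toMat k n)
    (LinearMap.ker_eq_bot.2 (toMat_injective n))).choose

theorem toMat_ofMat {n : ℕ} {x : Mat k n} (hx : x ∈ LinearMap.range (toMat k n)) :
    toMat k n (ofMat k n x) = x := by
  obtain ⟨y, rfl⟩ := hx
  exact congrArg _ (LinearMap.congr_fun (LinearMap.exists_leftInverse_of_injective (toMat k n)
    (LinearMap.ker_eq_bot.2 (toMat_injective n))).choose_spec y)

/-- The failure of `starDeriv` to be a derivation, as a collection of maps of the Poisson operad. -/
noncomputable def starCollection (k : Type u) [Field k] : Collection k (Pois k) :=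
  (fun q => LinearMap.compr₂ ((comp (k := k) q.arity q.i).compr₂ (starDeriv k q.r)
      - ((comp (k := k) q.arity q.i).compl₁₂ (starDeriv k q.m) (toMat k q.n)
        + (comp (k := k) q.arity q.i).compl₁₂ (toMat k q.m) (starDeriv k q.n))) (ofMat k q.r),
    fun n σ => ofMat k n ∘ₗ (starDeriv k n ∘ₗ act σ - act σ ∘ₗ starDeriv k n))

theorem toMat_starCollection_wp {m n r : ℕ} (h : m + n = r + 1) (i : Fin m) (x : Pois k m)
    (y : Pois k n) : toMat k r ((starCollection k).wp h i x y) =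
      starDeriv k r (comp (k := k) h i x y) - (comp (k := k) h i (starDeriv k m x) (toMat k n y)
      + comp (k := k) h i (toMat k m x) (starDeriv k n y)) :=
  toMat_ofMat (starDeriv_comp h i x y)

theorem toMat_starCollection_vs {n : ℕ} (σ : Equiv.Perm (Fin n)) (x : Pois k n) :
    toMat k n ((starCollection k).vs σ x) =
      starDeriv k n (act (k := k) σ x) - act (k := k) σ (starDeriv k n x) :=
  toMat_ofMat (starDeriv_act σ x)

theorem isTwoCocycle_starCollection : IsTwoCocycle (starCollection k) := by
  constructor
  · intro l m n r s t hr ht hs ht' i j lam μ ν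
    refine toMat_injective t ?_
    simp only [map_add, toMat_comp, toMat_starCollection_wp, map_sub, LinearMap.sub_apply,
      LinearMap.add_apply, assoc_inner hr ht hs ht']
    abel
  · intro l m n r s t hr ht hs ht' i p hip lam μ ν
    refine toMat_injective t ?_
    simp only [map_add, toMat_comp, toMat_starCollection_wp, map_sub, LinearMap.sub_apply,
      LinearMap.add_apply, assoc_outer hr ht hs ht' i p hip]
    abel
  · intro m n r h i σ μ ν
    refine toMat_injective r ?_
    simp only [map_add, toMat_comp, toMat_act, toMat_starCollection_wp, toMat_starCollection_vs,
      map_sub, comp_act]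
    abel
  · intro m n r h i φ μ ν
    refine toMat_injective r ?_
    simp only [map_add, toMat_comp, toMat_act, toMat_starCollection_wp, toMat_starCollection_vs,
      map_sub, LinearMap.sub_apply, act_comp]
    abel
  · intro n σ τ μ
    refine toMat_injective n ?_
    simp only [map_add, toMat_act, toMat_starCollection_vs, map_sub, act_mul]
    abel

/-- The linear map that sends a cocycle to the associator of the product `m` in its extension. -/
def associatorMap (k : Type u) [CommRing k] : Z2star k (Pois k) →ₗ[k] Pois k 3 where
  toFun c := c.1.wp (r := 3) (rfl : 2 + 2 = 3 + 1) 0 (m k) (m k)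
    - c.1.wp (r := 3) (rfl : 2 + 2 = 3 + 1) 1 (m k) (m k)
  map_add' c d := by
    simp only [Submodule.coe_add, Collection.wp_add, LinearMap.add_apply]
    abel
  map_smul' a c := by
    simp only [Submodule.coe_smul, Collection.wp_smul, LinearMap.smul_apply, smul_sub,
      RingHom.id_apply]

theorem associatorMap_apply {k : Type u} [CommRing k] (c : Z2star k (Pois k)) :
    associatorMap k c = c.1.wp (r := 3) (rfl : 2 + 2 = 3 + 1) 0 (m k) (m k)
      - c.1.wp (r := 3) (rfl : 2 + 2 = 3 + 1) 1 (m k) (m k) := rfl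

/-- Coboundaries only change the product of the extension, and to first order this does not affect
the associator. -/
theorem associatorMap_coboundary {k : Type u} [CommRing k] (c : Z2star k (Pois k))
    (hc : c.1 ∈ B2star k (Pois k)) : associatorMap k c = 0 := by
  obtain ⟨d, hd⟩ := hc
  have h := associatorChange_eq_zero (d 2 (m k))
  rw [← neg_eq_zero, ← h, associatorMap_apply, ← hd, associatorChange]
  change -((coboundaryFun k (Pois k) d).wp _ 0 _ _ - (coboundaryFun k (Pois k) d).wp _ 1 _ _) = _
  rw [coboundaryFun_wp, coboundaryFun_wp, m_assoc]
  abel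

/-- The cocycle of the Poisson operad given by the deformed representation. -/
noncomputable def starCocycle (k : Type u) [Field k] : Z2star k (Pois k) :=
  ⟨starCollection k, isTwoCocycle_starCollection⟩

theorem associatorMap_starCocycle :
    associatorMap k (starCocycle k) = (6 : k) • lieAssociator k := by
  refine toMat_injective 3 (funext fun W => ?_)
  obtain ⟨a, ha⟩ := starDeriv_m (k := k)
  have h0 := congrFun (congrArg (toMat k 3) (associatorChange_eq_zero a)) W
  rw [associatorChange, map_sub, map_add, map_add, map_zero] at h0
  simp only [toMat_comp] at h0
  rw [map_smul, Mat.smul_apply, toMat_lieAssociator, associatorMap_apply, map_sub]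
  change (toMat k 3 ((starCollection k).wp _ 0 _ _) -
    toMat k 3 ((starCollection k).wp _ 1 _ _)) W = _
  rw [toMat_starCollection_wp, toMat_starCollection_wp, m_assoc, ha]
  simp only [map_add, LinearMap.add_apply, Mat.sub_apply, Mat.add_apply, Mat.zero_apply] at h0 ⊢
  have hM : ∀ i, comp (k := k) (r := 3) (rfl : 2 + 2 = 3 + 1) i
      (Ext.snd (starGen k .product)) (toMat k 2 (m k)) W =
      3 * pairing k (conj (collapse k (rfl : 2 + 2 = 3 + 1) i) W) ^ 2 := fun i => by
    rw [Mat.comp_apply, toMat_m, mul_one]; rfl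
  have hM' : ∀ i, comp (k := k) (r := 3) (rfl : 2 + 2 = 3 + 1) i (toMat k 2 (m k))
      (Ext.snd (starGen k .product)) W =
      3 * pairing k (conj (restrict k (rfl : 2 + 2 = 3 + 1) i) W) ^ 2 := fun i => by
    rw [Mat.comp_apply, toMat_m, one_mul]; rfl
  rw [hM, hM, hM', hM', pairing_collapse_zero, pairing_collapse_one, pairing_restrict_zero,
    pairing_restrict_one]
  linear_combination (-1 : k) * h0

end StarCocycle

end Pois

/-! ### Leibniz rule and units in an arbitrary operad -/

section Leibnizator

variable {k : Type u} [CommRing k] {E : ℕ → Type v}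
  [∀ n, AddCommGroup (E n)] [∀ n, Module k (E n)] [SymOperad k E]

theorem comp_zero_comp_const_zero (θ θ' : E 2) (x : E 0) :
    comp (k := k) (rfl : 3 + 0 = 2 + 1) 0 (comp (k := k) (r := 3) (rfl : 2 + 2 = 3 + 1) 0 θ θ') x =
      comp (k := k) (rfl : 2 + 1 = 2 + 1) 0 θ (comp (k := k) (rfl : 2 + 0 = 1 + 1) 0 θ' x) :=
  assoc_inner (k := k) (rfl : 2 + 2 = 3 + 1) (rfl : 3 + 0 = 2 + 1) (rfl : 2 + 0 = 1 + 1)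
    (rfl : 2 + 1 = 2 + 1) 0 0 θ θ' x

theorem comp_zero_comp_const_one (θ θ' : E 2) (x : E 0) :
    comp (k := k) (rfl : 3 + 0 = 2 + 1) 1 (comp (k := k) (r := 3) (rfl : 2 + 2 = 3 + 1) 0 θ θ') x =
      comp (k := k) (rfl : 2 + 1 = 2 + 1) 0 θ (comp (k := k) (rfl : 2 + 0 = 1 + 1) 1 θ' x) :=
  assoc_inner (k := k) (rfl : 2 + 2 = 3 + 1) (rfl : 3 + 0 = 2 + 1) (rfl : 2 + 0 = 1 + 1)
    (rfl : 2 + 1 = 2 + 1) 0 1 θ θ' x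

theorem comp_zero_comp_const_two (θ θ' : E 2) (x : E 0) :
    comp (k := k) (rfl : 3 + 0 = 2 + 1) 2 (comp (k := k) (r := 3) (rfl : 2 + 2 = 3 + 1) 0 θ θ') x =
      comp (k := k) (rfl : 1 + 2 = 2 + 1) 0 (comp (k := k) (rfl : 2 + 0 = 1 + 1) 1 θ x) θ' :=
  assoc_outer (k := k) (rfl : 2 + 2 = 3 + 1) (rfl : 3 + 0 = 2 + 1) (rfl : 2 + 0 = 1 + 1)
    (rfl : 1 + 2 = 2 + 1) 0 1 (by decide) θ θ' x

theorem comp_one_comp_const_zero (θ θ' : E 2) (x : E 0) :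
    comp (k := k) (rfl : 3 + 0 = 2 + 1) 0 (comp (k := k) (r := 3) (rfl : 2 + 2 = 3 + 1) 1 θ θ') x =
      comp (k := k) (rfl : 1 + 2 = 2 + 1) 0 (comp (k := k) (rfl : 2 + 0 = 1 + 1) 0 θ x) θ' :=
  (assoc_outer (k := k) (rfl : 2 + 0 = 1 + 1) (rfl : 1 + 2 = 2 + 1) (rfl : 2 + 2 = 3 + 1)
    (rfl : 3 + 0 = 2 + 1) 0 1 (by decide) θ x θ').symm

theorem comp_one_comp_const_one (θ θ' : E 2) (x : E 0) :
    comp (k := k) (rfl : 3 + 0 = 2 + 1) 1 (comp (k := k) (r := 3) (rfl : 2 + 2 = 3 + 1) 1 θ θ') x =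
      comp (k := k) (rfl : 2 + 1 = 2 + 1) 1 θ (comp (k := k) (rfl : 2 + 0 = 1 + 1) 0 θ' x) :=
  assoc_inner (k := k) (rfl : 2 + 2 = 3 + 1) (rfl : 3 + 0 = 2 + 1) (rfl : 2 + 0 = 1 + 1)
    (rfl : 2 + 1 = 2 + 1) 1 0 θ θ' x

theorem comp_one_comp_const_two (θ θ' : E 2) (x : E 0) :
    comp (k := k) (rfl : 3 + 0 = 2 + 1) 2 (comp (k := k) (r := 3) (rfl : 2 + 2 = 3 + 1) 1 θ θ') x =
      comp (k := k) (rfl : 2 + 1 = 2 + 1) 1 θ (comp (k := k) (rfl : 2 + 0 = 1 + 1) 1 θ' x) :=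
  assoc_inner (k := k) (rfl : 2 + 2 = 3 + 1) (rfl : 3 + 0 = 2 + 1) (rfl : 2 + 0 = 1 + 1)
    (rfl : 2 + 1 = 2 + 1) 1 1 θ θ' x

theorem act_swap_comp_const_zero (θ : E 3) (x : E 0) :
    comp (k := k) (rfl : 3 + 0 = 2 + 1) 0 (act (k := k) (Equiv.swap 0 1) θ) x =
      comp (k := k) (rfl : 3 + 0 = 2 + 1) 1 θ x := by
  have h := act_comp (k := k) (rfl : 3 + 0 = 2 + 1) 0 (Equiv.swap 0 1) θ x
  have hp : permComp (rfl : 3 + 0 = 2 + 1) 0 (Equiv.swap (0 : Fin 3) 1)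
    (1 : Equiv.Perm (Fin 0)) = 1 := by decide
  rwa [hp, act_one] at h

theorem act_swap_comp_const_one (θ : E 3) (x : E 0) :
    comp (k := k) (rfl : 3 + 0 = 2 + 1) 1 (act (k := k) (Equiv.swap 0 1) θ) x =
      comp (k := k) (rfl : 3 + 0 = 2 + 1) 0 θ x := by
  have h := act_comp (k := k) (rfl : 3 + 0 = 2 + 1) 1 (Equiv.swap 0 1) θ x
  have hp : permComp (rfl : 3 + 0 = 2 + 1) 1 (Equiv.swap (0 : Fin 3) 1)
    (1 : Equiv.Perm (Fin 0)) = 1 := by decide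
  rwa [hp, act_one] at h

theorem act_swap_comp_const_two (θ : E 3) (x : E 0) :
    comp (k := k) (rfl : 3 + 0 = 2 + 1) 2 (act (k := k) (Equiv.swap 0 1) θ) x =
      act (k := k) (Equiv.swap 0 1) (comp (k := k) (rfl : 3 + 0 = 2 + 1) 2 θ x) := by
  have h := act_comp (k := k) (rfl : 3 + 0 = 2 + 1) 2 (Equiv.swap 0 1) θ x
  have hp : permComp (rfl : 3 + 0 = 2 + 1) 2 (Equiv.swap (0 : Fin 3) 1)
    (1 : Equiv.Perm (Fin 0)) = Equiv.swap 0 1 := by decide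
  have h2 : Equiv.swap (0 : Fin 3) 1 2 = 2 := by decide
  rwa [hp, h2] at h

theorem comp_zero_const_of_act_swap {ε : k} {θ : E 2} (hθ : act (k := k) (Equiv.swap 0 1) θ = ε • θ)
    (x : E 0) : ε • comp (k := k) (rfl : 2 + 0 = 1 + 1) 0 θ x =
      comp (k := k) (rfl : 2 + 0 = 1 + 1) 1 θ x := by
  have h := act_comp (k := k) (rfl : 2 + 0 = 1 + 1) 0 (Equiv.swap 0 1) θ x
  rwa [Subsingleton.elim (permComp _ _ _ _) 1, act_one, hθ, map_smul, LinearMap.smul_apply,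
    Equiv.swap_apply_left] at h

section Associator

variable {m : E 2} (hm : act (k := k) (Equiv.swap 0 1) m = m)
include hm

theorem act_swap_comp_zero (θ : E 2) : act (k := k) (Equiv.swap 0 1)
    (comp (k := k) (r := 3) (rfl : 2 + 2 = 3 + 1) 0 θ m) =
      comp (k := k) (r := 3) (rfl : 2 + 2 = 3 + 1) 0 θ m := by
  have e := comp_act (k := k) (r := 3) (rfl : 2 + 2 = 3 + 1) 0 (Equiv.swap 0 1) θ m
  have hp : permComp (r := 3) (rfl : 2 + 2 = 3 + 1) 0 (1 : Equiv.Perm (Fin 2))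
    (Equiv.swap (0 : Fin 2) 1) = Equiv.swap 0 1 := by decide
  rw [hm, hp] at e
  exact e.symm

theorem act_swap_associator :
    act (k := k) (Equiv.swap 0 2) (associator k m) = -associator k m := by
  have e := comp_act (k := k) (r := 3) (rfl : 2 + 2 = 3 + 1) 1 (Equiv.swap 0 1) m m
  have hp : permComp (r := 3) (rfl : 2 + 2 = 3 + 1) 1 (1 : Equiv.Perm (Fin 2))
    (Equiv.swap (0 : Fin 2) 1) = Equiv.swap 1 2 := by decide
  rw [hm, hp] at e
  have e' := comp_zero_act_swap (k := k) m m
  rw [hm] at e'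
  have h1 : act (k := k) (Equiv.swap 0 2) (comp (k := k) (r := 3) (rfl : 2 + 2 = 3 + 1) 0 m m) =
      comp (k := k) (r := 3) (rfl : 2 + 2 = 3 + 1) 1 m m := by
    have p : (Equiv.swap 0 1 * Equiv.swap 1 2 * Equiv.swap 0 2 : Equiv.Perm (Fin 3)) =
      Equiv.swap 1 2 := by decide
    rw [e', ← act_mul, p, ← e]
  have h2 : act (k := k) (Equiv.swap 0 2) (comp (k := k) (r := 3) (rfl : 2 + 2 = 3 + 1) 1 m m) =
      comp (k := k) (r := 3) (rfl : 2 + 2 = 3 + 1) 0 m m := by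
    rw [← h1, ← act_mul, Equiv.swap_mul_self, act_one]
  rw [associator, map_sub, h1, h2, neg_sub]

end Associator

theorem associator_comp_const {m : E 2} {e : E 0}
    (h0 : comp (k := k) (rfl : 2 + 0 = 1 + 1) 0 m e = one (k := k))
    (h1 : comp (k := k) (rfl : 2 + 0 = 1 + 1) 1 m e = one (k := k)) (i : Fin 3) :
    comp (k := k) (rfl : 3 + 0 = 2 + 1) i (associator k m) e = 0 := by
  have o1 : comp (k := k) (rfl : 1 + 2 = 2 + 1) 0 (one (k := k)) m = m := one_comp (k := k) m
  rw [associator, map_sub, LinearMap.sub_apply, sub_eq_zero]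
  match i with
  | 0 => rw [comp_zero_comp_const_zero, comp_one_comp_const_zero, h0, o1, comp_one]
  | 1 => rw [comp_zero_comp_const_one, comp_one_comp_const_one, h0, h1, comp_one, comp_one]
  | 2 => rw [comp_zero_comp_const_two, comp_one_comp_const_two, h1, o1, comp_one]

theorem jacobiator_comp_const {b : E 2} {e : E 0}
    (h0 : comp (k := k) (rfl : 2 + 0 = 1 + 1) 0 b e = 0)
    (h1 : comp (k := k) (rfl : 2 + 0 = 1 + 1) 1 b e = 0) (i : Fin 3) :
    comp (k := k) (rfl : 3 + 0 = 2 + 1) i (jacobiator k b) e = 0 := by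
  rw [jacobiator, map_sub, map_sub, LinearMap.sub_apply, LinearMap.sub_apply]
  match i with
  | 0 =>
    rw [act_swap_comp_const_zero, comp_zero_comp_const_zero, comp_one_comp_const_zero,
      comp_one_comp_const_one, h0]
    simp
  | 1 =>
    rw [act_swap_comp_const_one, comp_zero_comp_const_one, comp_one_comp_const_zero,
      comp_one_comp_const_one, h0, h1]
    simp
  | 2 =>
    rw [act_swap_comp_const_two, comp_zero_comp_const_two, comp_one_comp_const_two, h1]
    simp

variable (k) in
/-- The failure `[x₁x₂, x₃] - x₁[x₂, x₃] - x₂[x₁, x₃]` of the Leibniz rule. -/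
def leibnizator (m b : E 2) : E 3 :=
  comp (k := k) (r := 3) (rfl : 2 + 2 = 3 + 1) 0 b m
    - comp (k := k) (r := 3) (rfl : 2 + 2 = 3 + 1) 1 m b
    - act (k := k) (Equiv.swap 0 1) (comp (k := k) (r := 3) (rfl : 2 + 2 = 3 + 1) 1 m b)

theorem act_swap_leibnizator {m : E 2} (hm : act (k := k) (Equiv.swap 0 1) m = m) (b : E 2) :
    act (k := k) (Equiv.swap 0 1) (leibnizator k m b) = leibnizator k m b := by
  rw [leibnizator, map_sub, map_sub, act_swap_comp_zero hm, ← act_mul, Equiv.swap_mul_self,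
    act_one]
  abel

theorem leibnizator_comp_const_zero {m : E 2} {e : E 0}
    (h0 : comp (k := k) (rfl : 2 + 0 = 1 + 1) 0 m e = one (k := k)) (b : E 2) :
    comp (k := k) (rfl : 3 + 0 = 2 + 1) 0 (leibnizator k m b) e =
      -comp (k := k) (rfl : 2 + 1 = 2 + 1) 1 m (comp (k := k) (rfl : 2 + 0 = 1 + 1) 0 b e) := by
  have o1 : comp (k := k) (rfl : 1 + 2 = 2 + 1) 0 (one (k := k)) b = b := one_comp (k := k) b
  rw [leibnizator, map_sub, map_sub, LinearMap.sub_apply, LinearMap.sub_apply,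
    act_swap_comp_const_zero, comp_zero_comp_const_zero, comp_one_comp_const_zero,
    comp_one_comp_const_one, h0, o1, comp_one, sub_self, zero_sub]

theorem leibnizator_comp_const_one {m : E 2} {e : E 0}
    (h0 : comp (k := k) (rfl : 2 + 0 = 1 + 1) 0 m e = one (k := k))
    (h1 : comp (k := k) (rfl : 2 + 0 = 1 + 1) 1 m e = one (k := k)) (b : E 2) :
    comp (k := k) (rfl : 3 + 0 = 2 + 1) 1 (leibnizator k m b) e =
      -comp (k := k) (rfl : 2 + 1 = 2 + 1) 1 m (comp (k := k) (rfl : 2 + 0 = 1 + 1) 0 b e) := by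
  have o1 : comp (k := k) (rfl : 1 + 2 = 2 + 1) 0 (one (k := k)) b = b := one_comp (k := k) b
  rw [leibnizator, map_sub, map_sub, LinearMap.sub_apply, LinearMap.sub_apply,
    act_swap_comp_const_one, comp_zero_comp_const_one, comp_one_comp_const_zero,
    comp_one_comp_const_one, h0, h1, o1, comp_one]
  abel

theorem leibnizator_comp_const_two (m b : E 2) (e : E 0) :
    comp (k := k) (rfl : 3 + 0 = 2 + 1) 2 (leibnizator k m b) e =
      comp (k := k) (rfl : 1 + 2 = 2 + 1) 0 (comp (k := k) (rfl : 2 + 0 = 1 + 1) 1 b e) m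
      - comp (k := k) (rfl : 2 + 1 = 2 + 1) 1 m (comp (k := k) (rfl : 2 + 0 = 1 + 1) 1 b e)
      - act (k := k) (Equiv.swap 0 1)
        (comp (k := k) (rfl : 2 + 1 = 2 + 1) 1 m (comp (k := k) (rfl : 2 + 0 = 1 + 1) 1 b e)) := by
  rw [leibnizator, map_sub, map_sub, LinearMap.sub_apply, LinearMap.sub_apply,
    act_swap_comp_const_two, comp_zero_comp_const_two, comp_one_comp_const_two]

/-- For a commutative associative product the failure `L` of the Leibniz rule is a Harrison cocycle,
`L(x₁x₂, x₃; x₄) + x₃ L(x₁, x₂; x₄) = L(x₁, x₂x₃; x₄) + x₁ L(x₂, x₃; x₄)`. -/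
theorem leibnizator_cocycle {m : E 2} (hm : act (k := k) (Equiv.swap 0 1) m = m)
    (ha : comp (k := k) (r := 3) (rfl : 2 + 2 = 3 + 1) 0 m m =
      comp (k := k) (r := 3) (rfl : 2 + 2 = 3 + 1) 1 m m) (b : E 2) :
    comp (k := k) (r := 4) (rfl : 3 + 2 = 4 + 1) 0 (leibnizator k m b) m
      + act (k := k) (Equiv.swap 0 1 * Equiv.swap 1 2)
        (comp (k := k) (r := 4) (rfl : 2 + 3 = 4 + 1) 1 m (leibnizator k m b)) =
    comp (k := k) (r := 4) (rfl : 3 + 2 = 4 + 1) 1 (leibnizator k m b) m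
      + comp (k := k) (r := 4) (rfl : 2 + 3 = 4 + 1) 1 m (leibnizator k m b) := by
  have h2 : 2 + 2 = 3 + 1 := rfl
  have h3 : 3 + 2 = 4 + 1 := rfl
  have h3' : 2 + 3 = 4 + 1 := rfl
  set X := comp (k := k) h2 0 b m with hX
  set Y := comp (k := k) h2 1 m b with hY
  set M := comp (k := k) h3' 1 m Y with hM
  have x0 : comp (k := k) h3 0 X m = comp (k := k) h3 1 X m := by
    have e0 := assoc_inner (k := k) h2 h3 h2 h3' 0 0 b m m
    have e1 := assoc_inner (k := k) h2 h3 h2 h3' 0 1 b m m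
    rw [ha] at e0
    exact e0.trans e1.symm
  have y0 : comp (k := k) h3 0 Y m = M := by
    have e0 := assoc_outer (k := k) h2 h3 h2 h3 0 1 (by decide) m m b
    have e1 := assoc_inner (k := k) h2 h3 h2 h3' 1 1 m m b
    rw [ha] at e0
    exact e0.symm.trans e1
  have y1 : comp (k := k) h3 1 Y m = comp (k := k) h3' 1 m X :=
    assoc_inner (k := k) h2 h3 h2 h3' 1 0 m b m
  have z0 : comp (k := k) h3 0 (act (k := k) (Equiv.swap 0 1) Y) m =
      act (k := k) (Equiv.swap 0 1 * Equiv.swap 1 2) (comp (k := k) h3' 1 m X) := by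
    have hp : permComp (rfl : 3 + 2 = 4 + 1) 0 (Equiv.swap (0 : Fin 3) 1) (1 : Equiv.Perm (Fin 2)) =
      Equiv.swap 0 1 * Equiv.swap 1 2 := by decide
    rw [act_comp, hp, Equiv.swap_apply_left, y1]
  have z1 : comp (k := k) h3 1 (act (k := k) (Equiv.swap 0 1) Y) m =
      act (k := k) (Equiv.swap 1 2 * Equiv.swap 0 1) M := by
    have hp : permComp (rfl : 3 + 2 = 4 + 1) 1 (Equiv.swap (0 : Fin 3) 1) (1 : Equiv.Perm (Fin 2)) =
      Equiv.swap 1 2 * Equiv.swap 0 1 := by decide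
    rw [act_comp, hp, Equiv.swap_apply_right, y0]
  have z2 : comp (k := k) h3' 1 m (act (k := k) (Equiv.swap 0 1) Y) =
      act (k := k) (Equiv.swap 1 2) M := by
    have hp : permComp (rfl : 2 + 3 = 4 + 1) 1 (1 : Equiv.Perm (Fin 2)) (Equiv.swap (0 : Fin 3) 1) =
      Equiv.swap 1 2 := by decide
    rw [comp_act, hp]
  have s : act (k := k) (Equiv.swap 0 1) M = M := by
    have e := comp_act (k := k) h3 0 (Equiv.swap 0 1) Y m
    have hp : permComp (rfl : 3 + 2 = 4 + 1) 0 (1 : Equiv.Perm (Fin 3)) (Equiv.swap (0 : Fin 2) 1) =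
      Equiv.swap 0 1 := by decide
    rw [hm, hp, y0] at e
    exact e.symm
  have s1 : act (k := k) (Equiv.swap 0 1 * Equiv.swap 1 2) M = act (k := k) (Equiv.swap 1 2) M := by
    rw [act_mul, s]
  have s2 : act (k := k) (Equiv.swap 0 1 * Equiv.swap 1 2) (act (k := k) (Equiv.swap 1 2) M) =
      act (k := k) (Equiv.swap 1 2 * Equiv.swap 0 1) M := by
    have p : (Equiv.swap 1 2 * (Equiv.swap 0 1 * Equiv.swap 1 2) : Equiv.Perm (Fin 4)) =
      Equiv.swap 0 1 * (Equiv.swap 1 2 * Equiv.swap 0 1) := by decide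
    rw [← act_mul, p, act_mul, s]
  have hL : leibnizator k m b = X - Y - act (k := k) (Equiv.swap 0 1) Y := rfl
  simp only [hL, map_sub, LinearMap.sub_apply]
  change comp (k := k) h3 0 X m - comp (k := k) h3 0 Y m
      - comp (k := k) h3 0 (act (k := k) (Equiv.swap 0 1) Y) m
      + (act (k := k) (Equiv.swap 0 1 * Equiv.swap 1 2) (comp (k := k) h3' 1 m X)
        - act (k := k) (Equiv.swap 0 1 * Equiv.swap 1 2) M
        - act (k := k) (Equiv.swap 0 1 * Equiv.swap 1 2)
          (comp (k := k) h3' 1 m (act (k := k) (Equiv.swap 0 1) Y))) =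
    comp (k := k) h3 1 X m - comp (k := k) h3 1 Y m
      - comp (k := k) h3 1 (act (k := k) (Equiv.swap 0 1) Y) m
      + (comp (k := k) h3' 1 m X - M - comp (k := k) h3' 1 m (act (k := k) (Equiv.swap 0 1) Y))
  rw [x0, y0, y1, z0, z1, z2, s1, s2]
  abel

end Leibnizator

namespace Pois

/-! ### The second cohomology of the Poisson operad -/

theorem eps_comp_e {k : Type u} [CommRing k] {c : Z2star k (Pois k)} {x : Ext c 3}
    {e' : Ext c 0} (he : Ext.fst e' = e k) {z : Pois k 3} (hx : x = Ext.eps z) (i : Fin 3) :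
    comp (k := k) (rfl : 3 + 0 = 2 + 1) i x e' =
      Ext.eps (comp (k := k) (rfl : 3 + 0 = 2 + 1) i z (e k)) := by
  rw [hx, Ext.eps_comp, he]

theorem toMat_comp_e {k : Type u} [CommRing k] (x : Pois k 3) (i : Fin 3)
    (W : Matrix (Fin 2) (Fin 2) k) : toMat k 2 (comp (k := k) (rfl : 3 + 0 = 2 + 1) i x (e k)) W =
      toMat k 3 x (conj (collapse k (rfl : 3 + 0 = 2 + 1) i) W) := by
  rw [toMat_comp, Mat.comp_apply, toMat_e, mul_one]

/-- A ternary operation that vanishes on the unit is a combination of double brackets. -/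
theorem toMat_apply_of_comp_e {k : Type u} [CommRing k] (x : Pois k 3)
    (hx : ∀ i, comp (k := k) (rfl : 3 + 0 = 2 + 1) i x (e k) = 0) : ∃ γ δ : k, ∀ V, toMat k 3 x V =
      γ * ((V 0 1 - V 1 0) * ((V 0 2 - V 2 0) + (V 1 2 - V 2 1))) +
      δ * ((V 1 2 - V 2 1) * ((V 0 1 - V 1 0) + (V 0 2 - V 2 0))) := by
  obtain ⟨α, β₀₁, β₀₂, β₁₂, γ, δ, h⟩ := toMat_apply_three x
  refine ⟨γ, δ, fun V => ?_⟩
  have h0 : ∀ i (W : Matrix (Fin 2) (Fin 2) k),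
      toMat k 3 x (conj (collapse k (rfl : 3 + 0 = 2 + 1) i) W) = 0 := fun i W => by
    rw [← toMat_comp_e, hx, map_zero, Mat.zero_apply]
  have b0 : block (r := 2) (rfl : 3 + 0 = 2 + 1) (0 : Fin 3) = ![1, 2] := by decide
  have b1 : block (r := 2) (rfl : 3 + 0 = 2 + 1) (1 : Fin 3) = ![0, 2] := by decide
  have b2 : block (r := 2) (rfl : 3 + 0 = 2 + 1) (2 : Fin 3) = ![0, 1] := by decide
  have hα : α = 0 := by
    have e := h0 0 0
    rw [h] at e
    simpa [conj_collapse_apply] using e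
  have h12 : β₁₂ = 0 := by
    have e := h0 0 !![0, 1; 0, 0]
    rw [h, hα] at e
    simpa [conj_collapse_apply, b0] using e
  have h02 : β₀₂ = 0 := by
    have e := h0 1 !![0, 1; 0, 0]
    rw [h, hα] at e
    simpa [conj_collapse_apply, b1] using e
  have h01 : β₀₁ = 0 := by
    have e := h0 2 !![0, 1; 0, 0]
    rw [h, hα] at e
    simpa [conj_collapse_apply, b2] using e
  rw [h, hα, h01, h02, h12]
  ring

theorem snd_associator {k : Type u} [CommRing k] {c : Z2star k (Pois k)} {m' : Ext c 2}
    (hm : Ext.fst m' = m k) : Ext.snd (associator k m') = associatorMap k c := by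
  have h : Ext.snd (associator k m') = associatorMap k c + associatorChange (Ext.snd m') := by
    rw [associator, map_sub, Ext.snd_comp, Ext.snd_comp, hm, associatorMap_apply, associatorChange]
    abel
  rw [h, associatorChange_eq_zero, add_zero]

theorem associator_eq_eps_associatorMap {k : Type u} [CommRing k] {c : Z2star k (Pois k)}
    {m' : Ext c 2} (hm : Ext.fst m' = m k) :
    associator k m' = Ext.eps (associatorMap k c) := by
  rw [← snd_associator hm]
  exact Ext.associator_eq_eps (by rw [hm, associator, m_assoc, sub_self])

section UpperBound

variable {k : Type u} [Field k] [CharZero k]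

/-- In an extension the product and the unit lift to a commutative product with a unit. -/
theorem exists_unital_lift (c : Z2star k (Pois k)) : ∃ (m' : Ext c 2) (e' : Ext c 0),
    Ext.fst m' = m k ∧ Ext.fst e' = e k ∧ act (k := k) (Equiv.swap 0 1) m' = m' ∧
    comp (k := k) (rfl : 2 + 0 = 1 + 1) 0 m' e' = one (k := k) ∧
    comp (k := k) (rfl : 2 + 0 = 1 + 1) 1 m' e' = one (k := k) := by
  obtain ⟨m', hm, hsym⟩ : ∃ m' : Ext c 2, Ext.fst m' = m k ∧
      act (k := k) (Equiv.swap 0 1) m' = m' := by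
    let m₀ : Ext c 2 := Ext.mk c (m k) 0
    refine ⟨(2 : k)⁻¹ • (m₀ + act (k := k) (Equiv.swap 0 1) m₀), ?_, ?_⟩
    · rw [map_smul, map_add, Ext.fst_act]
      change (2 : k)⁻¹ • (m k + act (k := k) _ (m k)) = m k
      rw [act_m, ← two_smul k (m k), inv_smul_smul₀ two_ne_zero]
    · rw [map_smul, map_add, ← act_mul, Equiv.swap_mul_self, act_one, add_comm]
  let e₀ : Ext c 0 := Ext.mk c (e k) 0
  have hx := Ext.eq_add_eps (x := comp (k := k) (rfl : 2 + 0 = 1 + 1) 0 m' e₀)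
    (y := one (k := k)) (by
      rw [Ext.fst_comp, hm]
      exact m_unit_left)
  obtain ⟨a, ha⟩ := eq_smul_one
    (Ext.snd (comp (k := k) (rfl : 2 + 0 = 1 + 1) 0 m' e₀ - one (k := k)))
  rw [ha] at hx
  have h0 : comp (k := k) (rfl : 2 + 0 = 1 + 1) 0 m' (e₀ + Ext.eps (-(a • e k))) =
      one (k := k) := by
    rw [map_add, Ext.comp_eps, hm, map_neg, map_smul, m_unit_left, hx, map_neg,
      add_neg_cancel_right]
  refine ⟨m', e₀ + Ext.eps (-(a • e k)), hm, ?_, hsym, h0, ?_⟩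
  · rw [map_add, Ext.fst_eps, add_zero]
    rfl
  · have h := comp_zero_const_of_act_swap (k := k) (ε := 1) (θ := m') (by rw [one_smul, hsym])
      (e₀ + Ext.eps (-(a • e k)))
    rw [← h, one_smul, h0]

/-- The associator of a commutative unital lift of the product vanishes on the unit and is
antisymmetric under `x₁ ↔ x₃`, which leaves only the multiples of `lieAssociator`. -/
theorem associatorMap_mem_span (c : Z2star k (Pois k)) :
    ∃ a : k, associatorMap k c = a • lieAssociator k := by
  obtain ⟨m', e', hm, he, hsym, h0, h1⟩ := exists_unital_lift c
  have hz := associator_eq_eps_associatorMap hm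
  obtain ⟨γ, δ, h⟩ := toMat_apply_of_comp_e (associatorMap k c) fun i => by
    refine Ext.eps_injective (c := c) ?_
    rw [← eps_comp_e he hz i, associator_comp_const h0 h1, map_zero]
  have hs := act_swap_associator hsym
  rw [hz, Ext.act_eps, ← map_neg] at hs
  replace hs := congrFun (congrArg (toMat k 3) (Ext.eps_injective hs)) !![0, 1, 1; 0, 0, 0; 0, 0, 0]
  have e0 : Equiv.swap (0 : Fin 3) 2 0 = 2 := by decide
  have e1 : Equiv.swap (0 : Fin 3) 2 1 = 1 := by decide
  have e2 : Equiv.swap (0 : Fin 3) 2 2 = 0 := by decide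
  rw [toMat_act, Mat.act_apply, h, map_neg, Mat.neg_apply, h] at hs
  simp only [conj_permMat_apply, Equiv.symm_swap] at hs
  rw [e0, e1, e2] at hs
  have hδ : δ = -γ := by
    simp at hs
    linear_combination hs
  refine ⟨γ, toMat_injective 3 (funext fun V => ?_)⟩
  rw [h, map_smul, Mat.smul_apply, toMat_lieAssociator, hδ]
  ring

/-- In an extension with associative commutative unital product, a skew-symmetric lift of the
bracket vanishes on the unit and satisfies the Leibniz rule.  Plugging the unit into the failure of
the Leibniz rule shows the former, and leaves two coefficients of double brackets `γ, δ`; these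
vanish by the symmetry in `x₁, x₂` and the Harrison cocycle identity. -/
theorem leibnizator_eq_zero {c : Z2star k (Pois k)} {m' b' : Ext c 2} {e' : Ext c 0}
    (hm : Ext.fst m' = m k) (hb : Ext.fst b' = b k) (he : Ext.fst e' = e k)
    (hsym : act (k := k) (Equiv.swap 0 1) m' = m')
    (h0 : comp (k := k) (rfl : 2 + 0 = 1 + 1) 0 m' e' = one (k := k))
    (h1 : comp (k := k) (rfl : 2 + 0 = 1 + 1) 1 m' e' = one (k := k))
    (ha : comp (k := k) (r := 3) (rfl : 2 + 2 = 3 + 1) 0 m' m' =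
      comp (k := k) (r := 3) (rfl : 2 + 2 = 3 + 1) 1 m' m')
    (hskew : act (k := k) (Equiv.swap 0 1) b' = -b') :
    comp (k := k) (rfl : 2 + 0 = 1 + 1) 0 b' e' = 0 ∧
      comp (k := k) (rfl : 2 + 0 = 1 + 1) 1 b' e' = 0 ∧ leibnizator k m' b' = 0 := by
  have hw : leibnizator k m' b' = Ext.eps (Ext.snd (leibnizator k m' b')) := by
    refine Ext.eq_eps ?_
    rw [leibnizator]
    simp only [map_sub, Ext.fst_act, Ext.fst_comp, hm, hb]
    rw [leibniz]
    abel
  set w := Ext.snd (leibnizator k m' b')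
  have hx : comp (k := k) (rfl : 2 + 0 = 1 + 1) 0 b' e' =
      Ext.eps (Ext.snd (comp (k := k) (rfl : 2 + 0 = 1 + 1) 0 b' e')) := by
    refine Ext.eq_eps ?_
    rw [Ext.fst_comp, hb, he]
    exact b_unit_left
  obtain ⟨β, hβ⟩ := eq_smul_one (Ext.snd (comp (k := k) (rfl : 2 + 0 = 1 + 1) 0 b' e'))
  rw [hβ] at hx
  have hx1 : comp (k := k) (rfl : 2 + 0 = 1 + 1) 1 b' e' = Ext.eps ((-β) • one (k := k)) := by
    rw [← comp_zero_const_of_act_swap (k := k) (ε := -1) (by rw [hskew, neg_one_smul]), hx,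
      neg_one_smul, neg_smul, map_neg]
  have c1 : ∀ β : k, comp (k := k) (rfl : 2 + 1 = 2 + 1) 1 (m k) (β • one (k := k)) = β • m k :=
    fun β => by rw [map_smul, comp_one]
  have c2 : ∀ β : k, comp (k := k) (rfl : 1 + 2 = 2 + 1) 0 (β • one (k := k)) (m k) = β • m k :=
    fun β => by
      rw [map_smul, LinearMap.smul_apply]
      exact congrArg _ (one_comp (k := k) (m k))
  have c3 : ∀ β : k, act (k := k) (Equiv.swap 0 1) (β • m k) = β • m k :=
    fun β => by rw [map_smul, act_m]
  have l0 := leibnizator_comp_const_zero h0 b'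
  have l1 := leibnizator_comp_const_one h0 h1 b'
  have l2 := leibnizator_comp_const_two (k := k) m' b' e'
  rw [eps_comp_e he hw, hx, Ext.comp_eps, hm, c1, ← map_neg] at l0 l1
  rw [eps_comp_e he hw, hx1, Ext.comp_eps, Ext.eps_comp, hm, c1, c2, Ext.act_eps,
    c3, ← map_sub, ← map_sub] at l2
  replace l0 := Ext.eps_injective l0
  replace l1 := Ext.eps_injective l1
  replace l2 := Ext.eps_injective l2
  -- The constant term of `w` is `-β` when the unit is plugged into a slot of the product, and `β`
  -- when it is plugged into the remaining slot.
  have hβ0 : β = 0 := by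
    have e0 := congrFun (congrArg (toMat k 2) l0) 0
    have e2 := congrFun (congrArg (toMat k 2) l2) 0
    rw [toMat_comp_e] at e0 e2
    have hc : ∀ i, conj (collapse k (rfl : 3 + 0 = 2 + 1) i) 0 = 0 := fun i => by simp [conj]
    rw [hc] at e0 e2
    rw [e0] at e2
    have hM : ∀ β : k, toMat k 2 (β • m k) 0 = β := fun β => by
      rw [map_smul, Mat.smul_apply, toMat_m, mul_one]
    simp only [map_sub, map_neg, Mat.sub_apply, Mat.neg_apply, hM] at e2
    have h2 : (2 : k) * β = 0 := by linear_combination -e2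
    exact (mul_eq_zero.1 h2).resolve_left two_ne_zero
  rw [hβ0] at hx hx1 l0 l1 l2
  obtain ⟨γ, δ, h⟩ := toMat_apply_of_comp_e w fun i => by
    match i with
    | 0 => rw [l0, zero_smul, neg_zero]
    | 1 => rw [l1, zero_smul, neg_zero]
    | 2 => rw [l2, neg_zero, zero_smul, sub_zero, sub_zero]
  have hs := act_swap_leibnizator hsym b'
  have hH := leibnizator_cocycle hsym ha b'
  rw [hw, Ext.act_eps] at hs
  rw [hw, Ext.comp_eps, Ext.eps_comp, Ext.eps_comp, Ext.act_eps, hm, ← map_add, ← map_add] at hH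
  have e0 : Equiv.swap (0 : Fin 3) 1 0 = 1 := by decide
  have e1 : Equiv.swap (0 : Fin 3) 1 1 = 0 := by decide
  have e2 : Equiv.swap (0 : Fin 3) 1 2 = 2 := by decide
  have hγδ : δ = -2 * γ := by
    have e := congrFun (congrArg (toMat k 3) (Ext.eps_injective hs)) !![0, 1, 0; 0, 0, 1; 0, 0, 0]
    rw [toMat_act, Mat.act_apply, h, h] at e
    simp only [conj_permMat_apply, Equiv.symm_swap] at e
    rw [e0, e1, e2] at e
    simp at e
    linear_combination -e
  have hδ : δ = 0 := by
    have e := congrFun (congrArg (toMat k 4) (Ext.eps_injective hH))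
      !![0, 0, 1, 0; 0, 0, 0, 1; 0, 0, 0, 0; 0, 0, 0, 0]
    have b0 : block (r := 4) (rfl : 3 + 2 = 4 + 1) (0 : Fin 3) = ![0, 0, 1, 2] := by decide
    have b1 : block (r := 4) (rfl : 3 + 2 = 4 + 1) (1 : Fin 3) = ![0, 1, 1, 2] := by decide
    have i0 : innerPos (r := 4) (rfl : 2 + 3 = 4 + 1) (1 : Fin 2) (0 : Fin 3) = 1 := by decide
    have i1 : innerPos (r := 4) (rfl : 2 + 3 = 4 + 1) (1 : Fin 2) (1 : Fin 3) = 2 := by decide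
    have i2 : innerPos (r := 4) (rfl : 2 + 3 = 4 + 1) (1 : Fin 2) (2 : Fin 3) = 3 := by decide
    have p1 : (Equiv.swap 0 1 * Equiv.swap 1 2 : Equiv.Perm (Fin 4)).symm 1 = 0 := by decide
    have p2 : (Equiv.swap 0 1 * Equiv.swap 1 2 : Equiv.Perm (Fin 4)).symm 2 = 1 := by decide
    have p3 : (Equiv.swap 0 1 * Equiv.swap 1 2 : Equiv.Perm (Fin 4)).symm 3 = 3 := by decide
    rw [map_add, map_add, toMat_act, toMat_comp, toMat_comp, toMat_comp, Mat.add_apply,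
      Mat.add_apply, Mat.act_apply, Mat.comp_apply, Mat.comp_apply, Mat.comp_apply, Mat.comp_apply,
      toMat_m, h, h, h, h] at e
    simp only [conj_restrict_apply, conj_permMat_apply, i0, i1, i2, p1, p2, p3] at e
    simp [conj_collapse_apply, Fin.sum_univ_four, b0, b1] at e
    exact e
  have hγ : γ = 0 := by
    rw [hδ] at hγδ
    simpa using hγδ.symm
  have hw0 : w = 0 := toMat_injective 3 (funext fun V => by
    rw [h, hγ, hδ, map_zero, Mat.zero_apply]
    ring)
  refine ⟨?_, ?_, ?_⟩
  · rw [hx, zero_smul, map_zero]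
  · rw [hx1, neg_zero, zero_smul, map_zero]
  · rw [hw, hw0, map_zero]

/-- In an extension a skew-symmetric bracket that vanishes on the unit satisfies the Jacobi
identity. -/
theorem jacobiator_eq_zero {c : Z2star k (Pois k)} {b' : Ext c 2} {e' : Ext c 0}
    (hb : Ext.fst b' = b k) (he : Ext.fst e' = e k)
    (hskew : act (k := k) (Equiv.swap 0 1) b' = -b')
    (h0 : comp (k := k) (rfl : 2 + 0 = 1 + 1) 0 b' e' = 0)
    (h1 : comp (k := k) (rfl : 2 + 0 = 1 + 1) 1 b' e' = 0) : jacobiator k b' = 0 := by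
  have hz : jacobiator k b' = Ext.eps (Ext.snd (jacobiator k b')) := by
    refine Ext.eq_eps ?_
    rw [jacobiator]
    simp only [map_sub, Ext.fst_act, Ext.fst_comp, hb]
    rw [sub_sub, sub_eq_zero]
    exact jacobi
  obtain ⟨γ, δ, h⟩ := toMat_apply_of_comp_e (Ext.snd (jacobiator k b')) fun i => by
    refine Ext.eps_injective (c := c) ?_
    rw [← eps_comp_e he hz i, jacobiator_comp_const h0 h1, map_zero]
  have h01 := act_swap01_jacobiator hskew
  have h12 := act_swap12_jacobiator hskew
  rw [hz, Ext.act_eps, ← map_neg] at h01 h12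
  replace h01 := congrFun (congrArg (toMat k 3) (Ext.eps_injective h01))
    !![0, 0, 1; 0, 0, 1; 0, 0, 0]
  replace h12 := congrFun (congrArg (toMat k 3) (Ext.eps_injective h12))
    !![0, 1, 1; 0, 0, 0; 0, 0, 0]
  rw [toMat_act, Mat.act_apply, h, map_neg, Mat.neg_apply, h] at h01 h12
  simp only [conj_permMat_apply, Equiv.symm_swap] at h01 h12
  have e0 : Equiv.swap (0 : Fin 3) 1 0 = 1 := by decide
  have e1 : Equiv.swap (0 : Fin 3) 1 1 = 0 := by decide
  have e2 : Equiv.swap (0 : Fin 3) 1 2 = 2 := by decide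
  have f0 : Equiv.swap (1 : Fin 3) 2 0 = 0 := by decide
  have f1 : Equiv.swap (1 : Fin 3) 2 1 = 2 := by decide
  have f2 : Equiv.swap (1 : Fin 3) 2 2 = 1 := by decide
  rw [e0, e1, e2] at h01
  rw [f0, f1, f2] at h12
  have hδ : δ = 0 := by
    have h2 : (2 : k) * δ = 0 := by
      simp at h01
      linear_combination h01
    exact (mul_eq_zero.1 h2).resolve_left two_ne_zero
  have hγ : γ = 0 := by
    have h2 : (2 : k) * γ = 0 := by
      simp at h12
      linear_combination h12
    exact (mul_eq_zero.1 h2).resolve_left two_ne_zero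
  have hw0 : Ext.snd (jacobiator k b') = 0 := toMat_injective 3 (funext fun V => by
    rw [h, hγ, hδ, map_zero, Mat.zero_apply]
    ring)
  rw [hz, hw0, map_zero]

/-- A cocycle of the Poisson operad is a coboundary if the associator of the product vanishes in its
extension. -/
theorem mem_B2star_of_associatorMap (c : Z2star k (Pois k)) (hc : associatorMap k c = 0) :
    c.1 ∈ B2star k (Pois k) := by
  obtain ⟨m', e', hm, he, hsym, h0, h1⟩ := exists_unital_lift c
  have ha : comp (k := k) (r := 3) (rfl : 2 + 2 = 3 + 1) 0 m' m' =
      comp (k := k) (r := 3) (rfl : 2 + 2 = 3 + 1) 1 m' m' := by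
    have h := associator_eq_eps_associatorMap hm
    rw [hc, map_zero, associator, sub_eq_zero] at h
    exact h
  obtain ⟨b', hb, hskew⟩ : ∃ b' : Ext c 2, Ext.fst b' = b k ∧
      act (k := k) (Equiv.swap 0 1) b' = -b' := by
    let b₀ : Ext c 2 := Ext.mk c (b k) 0
    refine ⟨(2 : k)⁻¹ • (b₀ - act (k := k) (Equiv.swap 0 1) b₀), ?_, ?_⟩
    · rw [map_smul, map_sub, Ext.fst_act]
      change (2 : k)⁻¹ • (b k - act (k := k) _ (b k)) = b k
      rw [act_b, sub_neg_eq_add, ← two_smul k (b k), inv_smul_smul₀ two_ne_zero]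
    · rw [map_smul, map_sub, ← act_mul, Equiv.swap_mul_self, act_one, ← smul_neg, neg_sub]
  obtain ⟨hb0, hb1, hL⟩ := leibnizator_eq_zero hm hb he hsym h0 h1 ha hskew
  have hJ := jacobiator_eq_zero hb he hskew hb0 hb1
  let g : {n : ℕ} → PoisGen n → Ext c n := fun a => match a with
    | .unit => e'
    | .product => m'
    | .bracket => b'
  refine Presented.mem_B2star_of_lift c g (fun a => by
    cases a
    · exact he
    · exact hm
    · exact hb) (fun x y h => ?_)
  cases h with
  | unit_left => exact h0
  | unit_right => exact h1
  | bracket_unit_left => exact hb0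
  | bracket_unit_right => exact hb1
  | comm => exact hsym
  | antisymm => exact hskew.trans (neg_one_smul k _).symm
  | assoc => exact ha
  | leibniz =>
    rw [leibnizator, sub_sub, sub_eq_zero] at hL
    exact hL
  | jacobi =>
    rw [jacobiator, sub_sub, sub_eq_zero] at hJ
    exact hJ

/-- The second cohomology of the Poisson operad is one-dimensional. -/
theorem nonempty_H2star_equiv : Nonempty (H2star k (Pois k) ≃ₗ[k] k) := by
  -- At this matrix the value of `lieAssociator` is `1`.
  let ev : Pois k 3 →ₗ[k] k :=
    { toFun := fun x => toMat k 3 x !![0, 1, 1; 0, 0, 0; 0, 0, 0]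
      map_add' := fun x y => by rw [map_add, Mat.add_apply]
      map_smul' := fun a x => by rw [map_smul, Mat.smul_apply]; rfl }
  have hev : ev (lieAssociator k) = 1 := by
    change toMat k 3 (lieAssociator k) _ = 1
    rw [toMat_lieAssociator]
    simp
  let φ : Z2star k (Pois k) →ₗ[k] k := ev ∘ₗ associatorMap k
  have hφ : LinearMap.ker φ = (B2star k (Pois k)).submoduleOf (Z2star k (Pois k)) := by
    ext c
    change φ c = 0 ↔ c.1 ∈ B2star k (Pois k)
    refine ⟨fun h => mem_B2star_of_associatorMap c ?_, fun h => ?_⟩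
    · obtain ⟨a, ha⟩ := associatorMap_mem_span c
      change ev (associatorMap k c) = 0 at h
      rw [ha, map_smul, hev, smul_eq_mul, mul_one] at h
      rw [ha, h, zero_smul]
    · change ev (associatorMap k c) = 0
      rw [associatorMap_coboundary c h, map_zero]
  have hsurj : Function.Surjective φ := fun a => ⟨(a / 6) • starCocycle k, by
    change ev (associatorMap k ((a / 6) • starCocycle k)) = a
    rw [map_smul, associatorMap_starCocycle, map_smul, map_smul, hev, smul_eq_mul, smul_eq_mul]
    field_simp⟩
  exact ⟨(Submodule.quotEquivOfEq _ _ hφ.symm).trans (φ.quotKerEquivOfSurjective hsurj)⟩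

end UpperBound

end Pois

end Opd

theorem theorem0p6 (k : Type u) [Field k] :
    (Subsingleton (Opd.H2star k (Opd.As k)) ∧ Subsingleton (Opd.H2 k (Opd.As k))) ∧
    (Subsingleton (Opd.H2star k (Opd.Com k)) ∧ Subsingleton (Opd.H2 k (Opd.Com k))) ∧
    (Subsingleton (Opd.H2 k (Opd.Lie k)) ∧
      (ringChar k ≠ 2 → ringChar k ≠ 3 → Subsingleton (Opd.H2star k (Opd.Lie k)))) ∧
    (CharZero k →
      Function.Bijective (Opd.H2.toH2star k (Opd.Pois k)) ∧
      Nonempty (Opd.H2star k (Opd.Pois k) ≃ₗ[k] k) ∧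
      Nonempty (Opd.H2 k (Opd.Pois k) ≃ₗ[k] k)) := by
  refine ⟨⟨Opd.subsingleton_H2star Opd.As.mem_B2star,
      Opd.subsingleton_H2 fun c _ => Opd.As.mem_B2star ⟨c.1, c.2⟩⟩,
    ⟨Opd.subsingleton_H2star Opd.Com.mem_B2star,
      Opd.subsingleton_H2 fun c _ => Opd.Com.mem_B2star ⟨c.1, c.2⟩⟩,
    ⟨Opd.subsingleton_H2 Opd.Lie.mem_B2star_of_equivariant, fun h2 _ =>
      Opd.subsingleton_H2star (Opd.Lie.mem_B2star (Ring.two_ne_zero h2))⟩, fun _ => ?_⟩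
  have hbij : Function.Bijective (Opd.H2.toH2star k (Opd.Pois k)) :=
    ⟨Opd.toH2star_injective, Opd.toH2star_surjective⟩
  obtain ⟨ψ⟩ := Opd.Pois.nonempty_H2star_equiv (k := k)
  exact ⟨hbij, ⟨ψ⟩, ⟨(LinearEquiv.ofBijective _ hbij).trans ψ⟩⟩
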